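/- **Model.** Let $K\ge 2$, let $\pi^\star$ be a probability vector on $[K]$, $\mu^\star_1,\dots,\mu^\star_K\in\mathbb R^d$, $\Sigma^\star\in\mathbb R^{d\times d}$ positive definite, and $\mathbb Q$ a Borel probability measure on $\mathbb R^d$ with mean $0$ and $\int zz^\top d\mathbb Q=I_d$. A pair $(x,y^\star)$ follows the mixture model if $x=\mu^\star_{y^\star}+\Sigma^{\star1/2}z$ with $y^\star,z$ independent, $\mathbb P(y^\star=j)=\pi_j^\star$ and $z\sim\mathbb Q$. We say $\mathbb Q\in T_2(\sigma)$ if $W_2(\mathbb Q,\mathbb P')\le\sqrt{2\sigma^2D(\mathbb P'\|\mathbb Q)}$ for every Borel probability measure $\mathbb P'$ on $\mathbb R^d$ ($W_2$ the Wasserstein-2 distance, $D$ the Kullback–Leibler divergence). Put $\bar\mu^\star=\sum_j\pi^\star_j\mu^\star_j$ and $V^\star=\Sigma^{\star-1/2}(\mu_1^\star-\bar\mu^\star,\dots,\mu_K^\star-\bar\mu^\star)\in\mathbb R^{d\times K}$, and let $\sigma_{K-1}(V^\star)$ be its $(K-1)$-th largest singular value (zero if $d<K-1$). **Algorithm** (cross-validated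 whitened $k$-means, $n$ even). For a sample $u_1,\dots,u_m$ let $\bar u$ be its mean, $\widetilde\Sigma=\frac1m\sum_i(u_i-\bar u)(u_i-\bar u)^\top$, and $w(u)=\widetilde\Sigma^{-1/2}(u-\bar u)$ (with $\widetilde\Sigma^{-1/2}:=0$ if $\widetilde\Sigma$ is singular). Whitened $k$-means returns labels $\widehat s\in[K]^m$ minimizing $\sum_i\|w(u_i)-c_{s_i}(s)\|_2^2$ over $s\in[K]^m$, where $c_j(s)$ is the average of the $w(u_i)$ with $s_i=j$ ($0$ for an empty cluster), the centers $\widehat\mu_j=c_j(\widehat s)$, and the classifier $u\mapsto\operatorname{argmin}_{j\in[K]}\|w(u)-\widehat\mu_j\|_2$. Given $x_1,\dots,x_n$, run it separately on $\{x_i\}_{i\le n/2}$ and $\{x_i\}_{i>n/2}$; label each half by the classifier trained on the other half, getting $\widetilde y\in[K]^n$; choose a permutation $\widehat\tau$ of $[K]$ minimizing $|\{i\le n/2:\widehat s^{(1)}_i\ne\tau(\widetilde y_i)\}|$, where $\widehat s^{(1)}$ are the $k$-means labels of the first half; return $\widehat y=(\widehat\tau(\widetilde y_1),\dots,\widehat\tau(\widetilde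 y_{n/2}),\widetilde y_{n/2+1},\dots,\widetilde y_n)$. The optimal $k$-means solution of each half is chosen by any measurable function of that half; ties in classification and alignment are broken arbitrarily, with $\widehat y$ measurable. For $y^{(1)},y^{(2)}\in[K]^n$ let $\mathcal R(y^{(1)},y^{(2)})=n^{-1}\min_{\tau\in S_K}|\{i\in[n]:y_i^{(1)}\ne\tau(y^{(2)}_i)\}|$. **Theorem.** For all $\sigma>0$, $K_0\in\mathbb N$ and $p>0$ there are constants $c,C>0$, depending only on $\sigma,K_0,p$, such that the following holds. For every even $n$ let $(x_i,y_i^\star)_{i=1}^n$ be i.i.d. from a mixture model with parameters $d=d_n$, $K=K_n$, $\pi^\star,\mu^\star,\Sigma^\star,\mathbb Q$ that may depend on $n$, such that $\mathbb Q\in T_2(\sigma)$, $2\le K\le K_0$, $\min_j\pi^\star_j\ge p$, and $\sigma_{K-1}(V^\star)\ge R_n>0$. Assume $R_n\to\infty$ and $n/(d_n\log^2n)\to\infty$, and let $\widehat y$ be the output of the algorithm. Then there is $N$ such that for all even $n>N$ $$\mathbb E\,\mathcal R(\widehat y,y^\star)\le C\big(e^{-cR_n^2}+n^{-10}\big).$$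 Moreover: 1. if $R_n\le\sqrt{c^{-1}\log n}$ for all large $n$, then $\mathbb E\,\mathcal R(\widehat y,y^\star)\le C e^{-cR_n^2}$ for all large even $n$; 2. if, for some $\varepsilon>0$, $R_n\ge\sqrt{(1+\varepsilon)c^{-1}\log n}$ for all large $n$, then $\mathbb P[\mathcal R(\widehat y,y^\star)=0]\to1$ as $n\to\infty$ along even $n$. -/

import Mathlib

open MeasureTheory ProbabilityTheory Filter Topology
open scoped ENNReal MatrixOrder Matrix.Norms.L2Operator

noncomputable section

/-- `d`-dimensional Euclidean space. -/
abbrev EucSp (d : ℕ) : Type := EuclideanSpace ℝ (Fin d)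

/-! ## Transportation-cost inequality -/

/-- The Wasserstein-2 distance: the infimum over all couplings `γ` of `μ` and `ν` of
`(∫ ‖u - v‖² dγ(u, v)) ^ (1 / 2)`, with values in `[0, ∞]`. -/
def wasserstein2 {d : ℕ} (μ ν : Measure (EucSp d)) : ℝ≥0∞ :=
  ⨅ (γ : Measure (EucSp d × EucSp d)) (_ : γ.map Prod.fst = μ ∧ γ.map Prod.snd = ν),
    (∫⁻ p, ‖p.1 - p.2‖ₑ ^ 2 ∂γ) ^ (1 / 2 : ℝ)

/-- The class `T₂(σ)`: `W₂(μ, ν) ≤ √(2 σ² D(ν ‖ μ))` for every Borel probability measure `ν`,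
where `D` is the Kullback-Leibler divergence. -/
def IsT2 {d : ℕ} (σ : ℝ) (μ : Measure (EucSp d)) : Prop :=
  ∀ ν : Measure (EucSp d), IsProbabilityMeasure ν →
    wasserstein2 μ ν ≤
      (ENNReal.ofReal (2 * σ ^ 2) * InformationTheory.klDiv ν μ) ^ (1 / 2 : ℝ)

/-! ## Mixture model -/

/-- Parameters `(π, M, Σ, Q)` of a `K`-component mixture model in dimension `d`:
the weights `π` form a probability vector, the columns of `M` are the class centers, `Σ` is positive
semi-definite, and `Q` is a zero-mean isotropic (`E z zᵀ = I`) probability distribution. -/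
structure MixtureModel (d K : ℕ) where
  weight : Fin K → ℝ
  weight_nonneg : ∀ j, 0 ≤ weight j
  weight_sum : ∑ j, weight j = 1
  center : Fin K → EucSp d
  cov : Matrix (Fin d) (Fin d) ℝ
  cov_posSemidef : cov.PosSemidef
  noise : Measure (EucSp d)
  noise_prob : IsProbabilityMeasure noise
  noise_memLp : MemLp (fun z : EucSp d => z) 2 noise
  noise_mean : ∀ a : Fin d, ∫ z, z a ∂noise = 0
  noise_isotropic : ∀ a b : Fin d, ∫ z, z a * z b ∂noise = if a = b then 1 else 0

/-- The random labels `y i` and random vectors `x i` (`i < n`) are i.i.d. pairs from the mixture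
model `θ`: `x i = μ_{y i} + Σ^{1/2} z i` with `y i`, `z i` independent, `y i` of law `π`, `z i` of
law `Q`, and the pairs `(y i, z i)` independent over `i`. -/
def IsMixtureSample {d K n : ℕ} {Ω : Type*} [MeasurableSpace Ω] (θ : MixtureModel d K)
    (P : Measure Ω) (y : Fin n → Ω → Fin K) (x : Fin n → Ω → EucSp d) : Prop :=
  ∃ z : Fin n → Ω → EucSp d,
    (∀ i, Measurable (y i)) ∧
    (∀ i, Measurable (z i)) ∧
    iIndepFun (fun i ω => (y i ω, z i ω)) P ∧
    (∀ i, IndepFun (y i) (z i) P) ∧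
    (∀ i j, P.real {ω | y i ω = j} = θ.weight j) ∧
    (∀ i, P.map (z i) = θ.noise) ∧
    (∀ i ω, x i ω =
      θ.center (y i ω) + Matrix.toEuclideanCLM (𝕜 := ℝ) (CFC.sqrt θ.cov) (z i ω))

/-- `A^{-1/2}` for a positive definite matrix `A` (the zero matrix when `A` is singular). -/
def invSqrt {d : ℕ} (A : Matrix (Fin d) (Fin d) ℝ) : Matrix (Fin d) (Fin d) ℝ :=
  (CFC.sqrt A)⁻¹

/-- The overall mean `μ̄ = ∑ j, π_j μ_j`. -/
def MixtureModel.meanCenter {d K : ℕ} (θ : MixtureModel d K) : EucSp d :=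
  ∑ j, θ.weight j • θ.center j

/-- The `d × K` matrix `V = Σ^{-1/2} (μ_1 - μ̄, …, μ_K - μ̄)`. -/
def MixtureModel.signalMatrix {d K : ℕ} (θ : MixtureModel d K) : Matrix (Fin d) (Fin K) ℝ :=
  Matrix.of fun a j =>
    Matrix.toEuclideanCLM (𝕜 := ℝ) (invSqrt θ.cov) (θ.center j - θ.meanCenter) a

/-- Signal strength: `Σ` is positive definite and the `(K - 1)`-th largest singular value of `V` is
at least `R > 0`. Mathlib numbers singular values from `0`, so that one has index `K - 2`; the
notion is used for `K ≥ 2` only. -/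
def MixtureModel.SignalStrength {d K : ℕ} (θ : MixtureModel d K) (R : ℝ) : Prop :=
  θ.cov.PosDef ∧ 0 < R ∧
    R ≤ (Matrix.toLpLin 2 2 θ.signalMatrix).singularValues (K - 2)

/-! ## Whitened `k`-means -/

section Algorithm

variable {d K m : ℕ}

/-- The sample mean `x̄`. -/
def sampleMean (x : Fin m → EucSp d) : EucSp d := (m : ℝ)⁻¹ • ∑ i, x i

/-- The sample covariance matrix, with normalization `1 / m`. -/
def sampleCov (x : Fin m → EucSp d) : Matrix (Fin d) (Fin d) ℝ :=
  Matrix.of fun a b =>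
    (m : ℝ)⁻¹ * ∑ i, (x i a - sampleMean x a) * (x i b - sampleMean x b)

/-- Whitening of a point `u` by the sample `x`: `Σ̃^{-1/2} (u - x̄)`. -/
def whiten (x : Fin m → EucSp d) (u : EucSp d) : EucSp d :=
  Matrix.toEuclideanCLM (𝕜 := ℝ) (invSqrt (sampleCov x)) (u - sampleMean x)

/-- The mean of the points `w i` with label `j` (zero for an empty cluster). -/
def clusterMean (w : Fin m → EucSp d) (s : Fin m → Fin K) (j : Fin K) : EucSp d :=
  ((Finset.univ.filter fun i => s i = j).card : ℝ)⁻¹ •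
    ∑ i ∈ Finset.univ.filter (fun i => s i = j), w i

/-- The `k`-means objective of the label vector `s` on the points `w`. -/
def kmeansLoss (w : Fin m → EucSp d) (s : Fin m → Fin K) : ℝ :=
  ∑ i, ‖w i - clusterMean w s (s i)‖ ^ 2

/-- `s` is an optimal solution of the `k`-means program on the whitened sample. -/
def IsWhitenedKMeans (x : Fin m → EucSp d) (s : Fin m → Fin K) : Prop :=
  ∀ s' : Fin m → Fin K,
    kmeansLoss (fun i => whiten x (x i)) s ≤ kmeansLoss (fun i => whiten x (x i)) s'

/-- The class centers `μ̂_j` of the whitened sample `x` with labels `s`. -/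
def whitenedCenter (x : Fin m → EucSp d) (s : Fin m → Fin K) (j : Fin K) : EucSp d :=
  clusterMean (fun i => whiten x (x i)) s j

/-- The label `j` is a value at `u` of the classifier trained on the sample `x` with labels `s`:
`j` minimizes `‖Σ̃^{-1/2} (u - x̄) - μ̂_j‖`. -/
def IsPredictedLabel (x : Fin m → EucSp d) (s : Fin m → Fin K) (u : EucSp d) (j : Fin K) : Prop :=
  ∀ k : Fin K, ‖whiten x u - whitenedCenter x s j‖ ≤ ‖whiten x u - whitenedCenter x s k‖

/-- The permutation `τ` minimizes `#{i | y₁ i ≠ τ (y₂ i)}`. -/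
def IsAlignment (y₁ y₂ : Fin m → Fin K) (τ : Equiv.Perm (Fin K)) : Prop :=
  ∀ τ' : Equiv.Perm (Fin K),
    hammingDist y₁ (fun i => τ (y₂ i)) ≤ hammingDist y₁ (fun i => τ' (y₂ i))

/-- The first half of a sample of size `m + m`. -/
def firstHalf (x : Fin (m + m) → EucSp d) : Fin m → EucSp d := fun i => x (Fin.castAdd m i)

/-- The second half of a sample of size `m + m`. -/
def secondHalf (x : Fin (m + m) → EucSp d) : Fin m → EucSp d := fun i => x (Fin.natAdd m i)

/-- A `k`-means solver: a measurable map that sends each sample of size `m` to an optimal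
solution of the whitened `k`-means program. -/
def IsWhitenedKMeansSolver (solver : (Fin m → EucSp d) → Fin m → Fin K) : Prop :=
  Measurable solver ∧ ∀ x, IsWhitenedKMeans x (solver x)

/-- `yhat` is an output of cross-validated whitened `k`-means on the data `x`, when the clustering
step is carried out by `solver₁` on the first half and by `solver₂` on the second half: each half
is labelled by the classifier trained on the other half, and the predicted labels of the first
half are then aligned with the `k`-means labels of that half. Ties in the classification and the
alignment steps may be broken in any way. -/
def IsCVKMeansOutput (solver₁ solver₂ : (Fin m → EucSp d) → Fin m → Fin K)
    (x : Fin (m + m) → EucSp d) (yhat : Fin (m + m) → Fin K) : Prop :=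
  ∃ (ytilde₁ ytilde₂ : Fin m → Fin K) (τ : Equiv.Perm (Fin K)),
    (∀ i, IsPredictedLabel (secondHalf x) (solver₂ (secondHalf x)) (firstHalf x i) (ytilde₁ i)) ∧
    (∀ i, IsPredictedLabel (firstHalf x) (solver₁ (firstHalf x)) (secondHalf x i) (ytilde₂ i)) ∧
    IsAlignment (solver₁ (firstHalf x)) ytilde₁ τ ∧
    yhat = Fin.append (fun i => τ (ytilde₁ i)) ytilde₂

/-- The misclassification error `n⁻¹ min_τ #{i | y₁ i ≠ τ (y₂ i)}` over permutations `τ`. -/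
def misclassError {n : ℕ} (y₁ y₂ : Fin n → Fin K) : ℝ :=
  (n : ℝ)⁻¹ * ⨅ τ : Equiv.Perm (Fin K), (hammingDist y₁ (fun i => τ (y₂ i)) : ℝ)

end Algorithm

end

/-!
Whitening turns `k`-means into the choice of a partition whose cluster indicators have the least
total relative residual under affine least squares on the sample. On a good sample (non-negligible
classes, bounded empirical second moments, no one-dimensional projection of the noise of a class
close to two points) the true labels have residual `O(R⁻²)`. The least-squares predictors for the
`k`-means labels are then nearly indicators, and on each class they are affine functions of the
noise. As no projection of the noise is close to two points, their slopes are `O(R⁻¹)`, which forces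
the clusters to be the classes up to a permutation and few errors. A sample is good off probability
`B ^ (d + 1) e^{-γ m}`: the inequality `T₂` gives Marton's concentration and hence a gap-filling
property of the projections, which nets make uniform in the direction.

A new point is misclassified only if its noise has a component of order `1` along one of these
slopes. Cross-validation makes the noise independent of the slopes, so Marton's concentration bounds
this probability by `e^{-cR²}`, and the alignment step recovers the permutation between the halves.
-/

section RelativeEntropy

open InformationTheory

variable {α : Type*} [MeasurableSpace α] {μ : Measure α}

theorem klDiv_cond_self [IsProbabilityMeasure μ] {A : Set α} (hA : MeasurableSet A)
    (hμA : μ A ≠ 0) :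
    klDiv (μ[|A]) μ = ENNReal.ofReal (-Real.log (μ.real A)) := by
  have := cond_isProbabilityMeasure hμA
  have hderiv : (μ[|A]).rnDeriv μ =ᵐ[μ] (μ A)⁻¹ • A.indicator 1 := by
    refine (Measure.rnDeriv_smul_left_of_ne_top (μ.restrict A) μ
      (ENNReal.inv_ne_top.2 hμA)).trans ?_
    filter_upwards [Measure.rnDeriv_restrict_self μ hA] with x hx
    simp [hx]
  have hllr : llr (μ[|A]) μ =ᵐ[μ[|A]] fun _ => -Real.log (μ.real A) := by
    filter_upwards [cond_absolutelyContinuous hderiv, ae_cond_mem hA] with x hx hxA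
    simp [llr, hx, hxA, measureReal_def]
  rw [klDiv_of_ac_of_integrable cond_absolutelyContinuous
    ((integrable_const _).congr hllr.symm), integral_congr_ae hllr]
  simp

theorem klFun_le_sub_one_sq {x : ℝ} (hx : 0 ≤ x) : klFun x ≤ (x - 1) ^ 2 := by
  rw [klFun_apply]
  rcases hx.eq_or_lt with rfl | hx
  · norm_num
  · nlinarith [mul_le_mul_of_nonneg_left (Real.log_le_sub_one_of_pos hx) hx.le]

/-- The probability measure of density `1 + (g - ∫ g)` with respect to `μ`, the first-order form of
an exponential tilt. It is used only when this density is nonnegative. -/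
noncomputable def linearTilt (μ : Measure α) (g : α → ℝ) : Measure α :=
  μ.withDensity fun x => ENNReal.ofReal (1 + (g x - ∫ y, g y ∂μ))

variable {f g : α → ℝ} [IsProbabilityMeasure μ]

theorem isProbabilityMeasure_linearTilt (hg : Integrable g μ)
    (hpos : ∀ x, 0 ≤ 1 + (g x - ∫ y, g y ∂μ)) : IsProbabilityMeasure (linearTilt μ g) := by
  have hsub : Integrable (fun x => g x - ∫ y, g y ∂μ) μ := hg.sub (integrable_const _)
  have hint : Integrable (fun x => 1 + (g x - ∫ y, g y ∂μ)) μ := (integrable_const 1).add hsub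
  constructor
  rw [linearTilt, withDensity_apply _ MeasurableSet.univ, Measure.restrict_univ,
    ← ofReal_integral_eq_lintegral_ofReal hint (ae_of_all _ hpos),
    integral_add (integrable_const 1) hsub, integral_sub hg (integrable_const _)]
  simp

theorem integrable_linearTilt (hgm : Measurable g) (hg : MemLp g 2 μ)
    (hpos : ∀ x, 0 ≤ 1 + (g x - ∫ y, g y ∂μ)) (hf : MemLp f 2 μ) :
    Integrable f (linearTilt μ g) := by
  rw [linearTilt, integrable_withDensity_iff_integrable_smul' (by fun_prop) (by simp)]
  have hsub : MemLp (fun x => g x - ∫ y, g y ∂μ) 2 μ := hg.sub (memLp_const _)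
  have hdens : MemLp (fun x => 1 + (g x - ∫ y, g y ∂μ)) 2 μ := (memLp_const (1 : ℝ)).add hsub
  have hprod : Integrable (fun x => (1 + (g x - ∫ y, g y ∂μ)) * f x) μ := hdens.integrable_mul hf
  simpa only [ENNReal.toReal_ofReal (hpos _), smul_eq_mul] using hprod

theorem integral_linearTilt (hgm : Measurable g) (hg : MemLp g 2 μ)
    (hpos : ∀ x, 0 ≤ 1 + (g x - ∫ y, g y ∂μ)) (hf : MemLp f 2 μ) :
    ∫ x, f x ∂(linearTilt μ g) = ∫ x, f x ∂μ + cov[g, f; μ] := by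
  have hfint : Integrable f μ := hf.integrable one_le_two
  have hgf : Integrable (fun x => g x * f x) μ := hg.integrable_mul hf
  have hmf : Integrable (fun x => (∫ y, g y ∂μ) * f x) μ := hfint.const_mul _
  calc ∫ x, f x ∂(linearTilt μ g) = ∫ x, (1 + (g x - ∫ y, g y ∂μ)) * f x ∂μ := by
        rw [linearTilt, integral_withDensity_eq_integral_toReal_smul (by fun_prop) (by simp)]
        exact integral_congr_ae (ae_of_all _ fun x => by simp [ENNReal.toReal_ofReal (hpos x)])
    _ = ∫ x, (f x + (g x * f x - (∫ y, g y ∂μ) * f x)) ∂μ := by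
        congr with x; ring
    _ = ∫ x, f x ∂μ + cov[g, f; μ] := by
        rw [integral_add hfint (hgf.sub' hmf), integral_sub hgf hmf, integral_const_mul,
          covariance_eq_sub hg hf]
        rfl

theorem klDiv_linearTilt_le (hgm : Measurable g) (hg : MemLp g 2 μ)
    (hpos : ∀ x, 0 ≤ 1 + (g x - ∫ y, g y ∂μ)) :
    klDiv (linearTilt μ g) μ ≤ ENNReal.ofReal Var[g; μ] := by
  have := isProbabilityMeasure_linearTilt (hg.integrable one_le_two) hpos
  rw [linearTilt] at this ⊢
  have hsq : Integrable (fun x => (g x - ∫ y, g y ∂μ) ^ 2) μ :=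
    (hg.sub (memLp_const _)).integrable_sq
  rw [klDiv_eq_lintegral_klFun_of_ac (withDensity_absolutelyContinuous _ _),
    variance_eq_integral hgm.aemeasurable,
    ofReal_integral_eq_lintegral_ofReal hsq (ae_of_all _ fun x => sq_nonneg _)]
  refine lintegral_mono_ae ?_
  filter_upwards [Measure.rnDeriv_withDensity μ
    (f := fun x => ENNReal.ofReal (1 + (g x - ∫ y, g y ∂μ))) (by fun_prop)] with x hx
  rw [hx, ENNReal.toReal_ofReal (hpos x)]
  refine ENNReal.ofReal_le_ofReal ((klFun_le_sub_one_sq (hpos x)).trans_eq ?_)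
  rw [add_sub_cancel_left]

end RelativeEntropy

section Transport

variable {d : ℕ} {σ : ℝ} {μ ν : Measure (EucSp d)}

theorem IsT2.exists_coupling (h : IsT2 σ μ) [IsProbabilityMeasure ν] {D B : ℝ} (hD : 0 ≤ D)
    (hkl : InformationTheory.klDiv ν μ ≤ ENNReal.ofReal D) (hB : 2 * σ ^ 2 * D < B) :
    ∃ γ : Measure (EucSp d × EucSp d), γ.map Prod.fst = μ ∧ γ.map Prod.snd = ν ∧
      ∫⁻ p, ‖p.1 - p.2‖ₑ ^ 2 ∂γ < ENNReal.ofReal B := by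
  have hB0 : 0 < B := lt_of_le_of_lt (by positivity) hB
  have hW : wasserstein2 μ ν < ENNReal.ofReal B ^ (1 / 2 : ℝ) := by
    refine (h ν inferInstance).trans_lt (ENNReal.rpow_lt_rpow ?_ (by norm_num))
    calc ENNReal.ofReal (2 * σ ^ 2) * InformationTheory.klDiv ν μ
        ≤ ENNReal.ofReal (2 * σ ^ 2) * ENNReal.ofReal D := by gcongr
      _ = ENNReal.ofReal (2 * σ ^ 2 * D) := (ENNReal.ofReal_mul (by positivity)).symm
      _ < ENNReal.ofReal B := (ENNReal.ofReal_lt_ofReal_iff hB0).2 hB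
  simp only [wasserstein2, iInf_lt_iff] at hW
  obtain ⟨γ, ⟨hfst, hsnd⟩, hγ⟩ := hW
  exact ⟨γ, hfst, hsnd, (ENNReal.rpow_lt_rpow_iff (by norm_num)).1 hγ⟩

theorem integral_snd_sub_integral_fst_le {γ : Measure (EucSp d × EucSp d)} {a B : ℝ} (ha : 0 ≤ a)
    (hB : 0 < B) (hγ : ∫⁻ p, ‖p.1 - p.2‖ₑ ^ 2 ∂γ < ENNReal.ofReal B) {φ ψ : EucSp d → ℝ}
    (hφ : Integrable φ (γ.map Prod.fst)) (hψ : Integrable ψ (γ.map Prod.snd))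
    (hle : ∀ u v, ψ v - φ u ≤ a * ‖u - v‖ ^ 2) :
    ∫ v, ψ v ∂(γ.map Prod.snd) - ∫ u, φ u ∂(γ.map Prod.fst) ≤ a * B := by
  have hnorm : ∀ p : EucSp d × EucSp d, ‖p.1 - p.2‖ₑ ^ 2 = ENNReal.ofReal (‖p.1 - p.2‖ ^ 2) :=
    fun p => by rw [← ofReal_norm, ENNReal.ofReal_pow (norm_nonneg _)]
  have hnonneg : 0 ≤ᵐ[γ] fun p : EucSp d × EucSp d => ‖p.1 - p.2‖ ^ 2 :=
    ae_of_all _ fun p => by positivity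
  simp_rw [hnorm] at hγ
  have hint : Integrable (fun p : EucSp d × EucSp d => ‖p.1 - p.2‖ ^ 2) γ := by
    refine ⟨by fun_prop, ?_⟩
    rw [hasFiniteIntegral_iff_ofReal hnonneg]
    exact hγ.trans ENNReal.ofReal_lt_top
  rw [← ofReal_integral_eq_lintegral_ofReal hint hnonneg, ENNReal.ofReal_lt_ofReal_iff hB] at hγ
  have hψ' : Integrable (fun p : EucSp d × EucSp d => ψ p.2) γ := hψ.comp_measurable measurable_snd
  have hφ' : Integrable (fun p : EucSp d × EucSp d => φ p.1) γ := hφ.comp_measurable measurable_fst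
  rw [integral_map (by fun_prop) hψ.1, integral_map (by fun_prop) hφ.1, ← integral_sub hψ' hφ']
  calc ∫ p, ψ p.2 - φ p.1 ∂γ ≤ ∫ p, a * ‖p.1 - p.2‖ ^ 2 ∂γ :=
        integral_mono (hψ'.sub hφ') (hint.const_mul a) fun p => hle _ _
    _ = a * ∫ p, ‖p.1 - p.2‖ ^ 2 ∂γ := integral_const_mul _ _
    _ ≤ a * B := by gcongr

theorem IsT2.integral_sub_integral_le (h : IsT2 σ μ) [IsProbabilityMeasure ν] {D a : ℝ}
    (hD : 0 ≤ D) (ha : 0 ≤ a) (hkl : InformationTheory.klDiv ν μ ≤ ENNReal.ofReal D)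
    {φ ψ : EucSp d → ℝ} (hφ : Integrable φ μ) (hψ : Integrable ψ ν)
    (hle : ∀ u v, ψ v - φ u ≤ a * ‖u - v‖ ^ 2) :
    ∫ v, ψ v ∂ν - ∫ u, φ u ∂μ ≤ a * (2 * σ ^ 2 * D) := by
  refine le_mul_of_forall_lt₀ fun a' ha' B hB => ?_
  have hB0 : 0 < B := lt_of_le_of_lt (by positivity) hB
  obtain ⟨γ, rfl, rfl, hγ⟩ := h.exists_coupling hD hkl hB
  exact (integral_snd_sub_integral_fst_le ha hB0 hγ hφ hψ hle).trans (by gcongr)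

/-- Marton's argument: conditioning on the tail event `A` costs relative entropy `-log μ(A)` and
moves the mean of `f` by at least `t`. -/
theorem IsT2.measureReal_integral_add_le_le_exp (h : IsT2 σ μ) [IsProbabilityMeasure μ]
    {f : EucSp d → ℝ} {L : NNReal} (hf : LipschitzWith L f) (hint : Integrable f μ) {t : ℝ}
    (ht : 0 < t) :
    μ.real {z | ∫ u, f u ∂μ + t ≤ f z} ≤ Real.exp (-(t ^ 2 / (2 * σ ^ 2 * L ^ 2))) := by
  set A : Set (EucSp d) := {z | ∫ u, f u ∂μ + t ≤ f z}
  have hAm : MeasurableSet A := measurableSet_le measurable_const hf.continuous.measurable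
  rcases eq_or_ne (μ A) 0 with h0 | h0
  · rw [measureReal_def, h0]; positivity
  have hpos : 0 < μ.real A := ENNReal.toReal_pos h0 (measure_ne_top _ _)
  have := cond_isProbabilityMeasure h0
  have hD : 0 ≤ -Real.log (μ.real A) := neg_nonneg.2 (Real.log_nonpos hpos.le measureReal_le_one)
  have hint' : Integrable f (μ[|A]) :=
    hint.restrict.smul_measure (ENNReal.inv_ne_top.2 h0)
  have hshift : ∫ u, f u ∂μ + t ≤ ∫ v, f v ∂(μ[|A]) := by
    have := integral_mono_ae (integrable_const (∫ u, f u ∂μ + t)) hint' (ae_cond_mem hAm)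
    simpa only [integral_const, probReal_univ, one_smul] using this
  have hyoung : ∀ r : ℝ, L * r ≤ t / 2 + L ^ 2 / (2 * t) * r ^ 2 := fun r => by
    have : t / 2 + L ^ 2 / (2 * t) * r ^ 2 - L * r = (t - L * r) ^ 2 / (2 * t) := by
      field_simp; ring
    have : 0 ≤ (t - L * r) ^ 2 / (2 * t) := by positivity
    linarith
  have hdual := h.integral_sub_integral_le (a := L ^ 2 / (2 * t)) hD (by positivity)
    (klDiv_cond_self hAm h0).le (hint.add (integrable_const (t / 2))) hint' fun u v => by
      have := (le_abs_self _).trans (hf.norm_sub_le v u)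
      rw [norm_sub_rev] at this
      simp only [Pi.add_apply]
      linarith [hyoung ‖u - v‖]
  simp only [Pi.add_apply, integral_add hint (integrable_const _), integral_const, probReal_univ,
    one_smul] at hdual
  rcases (by positivity : 0 ≤ 2 * σ ^ 2 * (L : ℝ) ^ 2).eq_or_lt with hL | hL
  · rw [← hL]; simp
  rw [← Real.log_le_iff_le_exp hpos, le_neg, div_le_iff₀ hL]
  have hlog : t / 2 ≤ L ^ 2 / (2 * t) * (2 * σ ^ 2 * -Real.log (μ.real A)) := by linarith
  rw [div_mul_eq_mul_div, le_div_iff₀ (by positivity)] at hlog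
  nlinarith

theorem IsT2.measureReal_le_abs_sub_integral_le_exp (h : IsT2 σ μ) [IsProbabilityMeasure μ]
    {f : EucSp d → ℝ} {L : NNReal} (hf : LipschitzWith L f) (hint : Integrable f μ) {t : ℝ}
    (ht : 0 < t) :
    μ.real {z | t ≤ |f z - ∫ u, f u ∂μ|} ≤
      2 * Real.exp (-(t ^ 2 / (2 * σ ^ 2 * L ^ 2))) := by
  have hupper := h.measureReal_integral_add_le_le_exp hf hint ht
  have hlower := h.measureReal_integral_add_le_le_exp hf.neg hint.neg ht
  have hsub : {z | t ≤ |f z - ∫ u, f u ∂μ|} ⊆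
      {z | ∫ u, f u ∂μ + t ≤ f z} ∪ {z | ∫ u, (-f) u ∂μ + t ≤ (-f) z} := by
    intro z hz
    simp only [Pi.neg_apply, integral_neg, Set.mem_union, Set.mem_ofPred_eq] at hz ⊢
    exact (le_abs.1 hz).imp (fun h => by linarith) fun h => by linarith
  calc _ ≤ _ := measureReal_mono hsub
    _ ≤ _ := measureReal_union_le _ _
    _ ≤ _ := by linarith

theorem IsT2.variance_le_add (h : IsT2 σ μ) [IsProbabilityMeasure μ] {f H : EucSp d → ℝ}
    {A M ε θ : ℝ} (hfm : Measurable f) (hfM : ∀ x, |f x| ≤ M) (hH : MemLp H 2 μ) (hA : 0 ≤ A)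
    (hε : 0 < ε) (hεM : ε * (2 * M) ≤ 1) (hθ : 0 < θ)
    (hle : ∀ u v, f v - f u ≤ A / θ * ‖u - v‖ ^ 2 + θ * (H u + H v)) :
    ε * Var[f; μ] ≤ A / θ * (2 * σ ^ 2 * (ε ^ 2 * Var[f; μ])) +
      θ * (2 * ∫ z, H z ∂μ + ε * cov[f, H; μ]) := by
  have hf : MemLp f 2 μ := MemLp.of_bound hfm.aestronglyMeasurable M (ae_of_all _ hfM)
  have hmean : |∫ x, f x ∂μ| ≤ M := by
    simpa using norm_integral_le_of_norm_le_const (f := f) (μ := μ) (ae_of_all _ hfM)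
  have hpos : ∀ x, 0 ≤ 1 + (ε * f x - ∫ y, ε * f y ∂μ) := fun x => by
    have hsub := mul_le_mul_of_nonneg_left
      (show ∫ y, f y ∂μ - f x ≤ 2 * M by linarith [abs_le.1 hmean, abs_le.1 (hfM x)]) hε.le
    rw [integral_const_mul]
    linarith
  have hεfm : Measurable fun x => ε * f x := by fun_prop
  have hprob := isProbabilityMeasure_linearTilt ((hf.const_mul ε).integrable one_le_two) hpos
  have hψ : MemLp (fun v => f v - θ * H v) 2 μ := hf.sub (hH.const_mul θ)
  have hdual := h.integral_sub_integral_le (φ := fun u => f u + θ * H u) (variance_nonneg _ μ)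
    (div_nonneg hA hθ.le) (klDiv_linearTilt_le hεfm (hf.const_mul ε) hpos)
    ((hf.add (hH.const_mul θ)).integrable one_le_two)
    (integrable_linearTilt hεfm (hf.const_mul ε) hpos hψ) fun u v => by linarith [hle u v]
  have hfint := hf.integrable one_le_two
  have hθHint := (hH.const_mul θ).integrable one_le_two
  rw [integral_linearTilt hεfm (hf.const_mul ε) hpos hψ, integral_sub hfint hθHint,
    integral_add hfint hθHint, integral_const_mul, covariance_const_mul_left, variance_const_mul,
    covariance_fun_sub_right hf hf (hH.const_mul θ), covariance_const_mul_right,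
    covariance_self hfm.aemeasurable] at hdual
  linarith

/-- A Poincaré inequality in which the gap function `H` stands for the squared gradient of `f`. It
linearizes the transport inequality at `ν = linearTilt μ (ε f)` as `ε → 0`, with `θ` of order
`ε`. -/
theorem IsT2.variance_le_of_sub_le (h : IsT2 σ μ) (hσ : 0 < σ) [IsProbabilityMeasure μ]
    {f H : EucSp d → ℝ} {A M θ₀ : ℝ} (hf : Measurable f) (hfM : ∀ x, |f x| ≤ M)
    (hH : MemLp H 2 μ) (hA : 0 < A) (hθ₀ : 0 < θ₀)
    (hle : ∀ θ, 0 < θ → θ ≤ θ₀ → ∀ u v, f v - f u ≤ A / θ * ‖u - v‖ ^ 2 + θ * (H u + H v)) :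
    Var[f; μ] ≤ 16 * σ ^ 2 * A * ∫ z, H z ∂μ := by
  set c := cov[f, H; μ]
  have hsmall : ∀ᶠ ε in 𝓝[>] (0 : ℝ),
      Var[f; μ] ≤ 16 * σ ^ 2 * A * ∫ z, H z ∂μ + 8 * σ ^ 2 * A * c * ε := by
    have hεθ : ∀ᶠ ε in 𝓝[>] (0 : ℝ), 4 * σ ^ 2 * A * ε ≤ θ₀ := by
      refine nhdsWithin_le_nhds (ContinuousAt.tendsto (by fun_prop) |>.eventually_le_const ?_)
      simpa using hθ₀
    have hεM : ∀ᶠ ε in 𝓝[>] (0 : ℝ), ε * (2 * M) ≤ 1 := by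
      refine nhdsWithin_le_nhds (ContinuousAt.tendsto (by fun_prop) |>.eventually_le_const ?_)
      simp
    filter_upwards [hεθ, hεM, self_mem_nhdsWithin] with ε hεθ hεM (hε : 0 < ε)
    have hθ : 0 < 4 * σ ^ 2 * A * ε := by positivity
    have hbound := h.variance_le_add hf hfM hH hA.le hε hεM hθ (hle _ hθ hεθ)
    have hhalf : A / (4 * σ ^ 2 * A * ε) * (2 * σ ^ 2 * (ε ^ 2 * Var[f; μ])) =
        ε * (Var[f; μ] / 2) := by
      field_simp; ring
    rw [hhalf] at hbound
    have := le_of_mul_le_mul_left (a := ε) (b := Var[f; μ] / 2)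
      (c := 4 * σ ^ 2 * A * (2 * ∫ z, H z ∂μ + ε * c)) (by linarith) hε
    linarith
  have hlim : Tendsto (fun ε => 16 * σ ^ 2 * A * ∫ z, H z ∂μ + 8 * σ ^ 2 * A * c * ε)
      (𝓝[>] 0) (𝓝 (16 * σ ^ 2 * A * ∫ z, H z ∂μ)) := by
    refine (Continuous.tendsto' (by fun_prop) _ _ (by simp)).mono_left nhdsWithin_le_nhds
  exact ge_of_tendsto hlim hsmall

end Transport

section Moments

theorem lintegral_exp_mul_sub_one_le {α : Type*} [MeasurableSpace α] {μ : Measure α}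
    [IsProbabilityMeasure μ] {Y : α → ℝ} {B l : ℝ} (hYm : AEMeasurable Y μ) (hY : ∀ x, 0 ≤ Y x)
    (hl : 0 < l) (htail : ∀ t, 0 < t → μ.real {x | t ≤ Y x} ≤ B * Real.exp (-(2 * l * t))) :
    ∫⁻ x, ENNReal.ofReal (Real.exp (l * Y x) - 1) ∂μ ≤ ENNReal.ofReal B := by
  have hprim : ∀ x : ℝ, ∫ t in (0 : ℝ)..x, l * Real.exp (l * t) = Real.exp (l * x) - 1 := by
    intro x
    have hderiv : ∀ t : ℝ, HasDerivAt (fun t => Real.exp (l * t)) (l * Real.exp (l * t)) t :=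
      fun t => by simpa [mul_comm] using ((hasDerivAt_id t).const_mul l).exp
    rw [intervalIntegral.integral_eq_sub_of_hasDerivAt (fun t _ => hderiv t)
      (Continuous.intervalIntegrable (by fun_prop) _ _)]
    simp
  have hlayer := lintegral_comp_eq_lintegral_meas_le_mul μ (f := Y)
    (g := fun t => l * Real.exp (l * t)) (ae_of_all _ hY) hYm
    (fun t _ => Continuous.intervalIntegrable (by fun_prop) _ _)
    (ae_of_all _ fun t => by positivity)
  simp_rw [hprim] at hlayer
  have hB : 0 ≤ B := nonneg_of_mul_nonneg_left
    (measureReal_nonneg.trans (htail 1 one_pos)) (Real.exp_pos _)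
  calc _ = ∫⁻ t in Set.Ioi (0 : ℝ), μ {x | t ≤ Y x} * ENNReal.ofReal (l * Real.exp (l * t)) :=
        hlayer
    _ ≤ ∫⁻ t in Set.Ioi (0 : ℝ), ENNReal.ofReal (B * l * Real.exp (-l * t)) := by
        refine setLIntegral_mono (by fun_prop) fun t (ht : 0 < t) => ?_
        rw [← ofReal_measureReal, ← ENNReal.ofReal_mul measureReal_nonneg]
        refine ENNReal.ofReal_le_ofReal ?_
        calc _ ≤ B * Real.exp (-(2 * l * t)) * (l * Real.exp (l * t)) := by gcongr; exact htail t ht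
          _ = B * l * (Real.exp (-(2 * l * t)) * Real.exp (l * t)) := by ring
          _ = _ := by rw [← Real.exp_add]; ring_nf
    _ = ENNReal.ofReal (∫ t in Set.Ioi (0 : ℝ), B * l * Real.exp (-l * t)) := by
        rw [ofReal_integral_eq_lintegral_ofReal]
        · exact (integrableOn_exp_mul_Ioi (by linarith) 0).const_mul _
        · exact ae_of_all _ fun t => by positivity
    _ = ENNReal.ofReal B := by
        rw [integral_const_mul, integral_exp_mul_Ioi (by linarith) 0]
        simp only [mul_zero, Real.exp_zero]
        field_simp

theorem integrable_exp_mul_of_tail {α : Type*} [MeasurableSpace α] {μ : Measure α}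
    [IsProbabilityMeasure μ] {Y : α → ℝ} {B l : ℝ} (hYm : AEMeasurable Y μ) (hY : ∀ x, 0 ≤ Y x)
    (hl : 0 < l) (htail : ∀ t, 0 < t → μ.real {x | t ≤ Y x} ≤ B * Real.exp (-(2 * l * t))) :
    Integrable (fun x => Real.exp (l * Y x) - 1) μ := by
  refine ⟨by fun_prop, ?_⟩
  rw [hasFiniteIntegral_iff_ofReal
    (ae_of_all _ fun x => sub_nonneg.2 (Real.one_le_exp (mul_nonneg hl.le (hY x))))]
  exact (lintegral_exp_mul_sub_one_le hYm hY hl htail).trans_lt ENNReal.ofReal_lt_top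

theorem pow_four_le_exp_sq {σ : ℝ} (hσ : 0 < σ) (x : ℝ) :
    x ^ 4 ≤ 32 * σ ^ 4 * Real.exp (x ^ 2 / (4 * σ ^ 2)) := by
  set y := x ^ 2 / (4 * σ ^ 2) with hy
  have hy0 : 0 ≤ y := by positivity
  calc x ^ 4 = 32 * σ ^ 4 * (y ^ 2 / 2) := by rw [hy]; field_simp; ring
    _ ≤ 32 * σ ^ 4 * Real.exp y := by
        gcongr
        linarith [Real.quadratic_le_exp_of_nonneg hy0]

variable {d : ℕ} {σ : ℝ} {μ : Measure (EucSp d)} [IsProbabilityMeasure μ] {f : EucSp d → ℝ}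

theorem IsT2.measureReal_le_sq_le (h : IsT2 σ μ) (hf : LipschitzWith 1 f) (hint : Integrable f μ)
    (hmean : ∫ z, f z ∂μ = 0) {t : ℝ} (ht : 0 < t) :
    μ.real {z | t ≤ f z ^ 2} ≤ 2 * Real.exp (-(2 * (4 * σ ^ 2)⁻¹ * t)) := by
  have htail := h.measureReal_le_abs_sub_integral_le_exp hf hint (Real.sqrt_pos.2 ht)
  simp only [hmean, sub_zero, Real.sqrt_le_left (abs_nonneg _), sq_abs, Real.sq_sqrt ht.le,
    NNReal.coe_one, one_pow, mul_one] at htail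
  convert htail using 3
  ring

theorem IsT2.integrable_exp_sq (h : IsT2 σ μ) (hσ : 0 < σ) (hf : LipschitzWith 1 f)
    (hint : Integrable f μ) (hmean : ∫ z, f z ∂μ = 0) :
    Integrable (fun z => Real.exp (f z ^ 2 / (4 * σ ^ 2))) μ := by
  have hfm : AEMeasurable (fun z => f z ^ 2) μ := hint.aemeasurable.pow_const 2
  have hexp := (integrable_exp_mul_of_tail hfm (fun z => sq_nonneg _)
    (by positivity) fun t => h.measureReal_le_sq_le hf hint hmean).add (integrable_const 1)
  refine hexp.congr (ae_of_all _ fun z => ?_)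
  simp [div_eq_inv_mul]

theorem IsT2.integral_exp_sq_le (h : IsT2 σ μ) (hσ : 0 < σ) (hf : LipschitzWith 1 f)
    (hint : Integrable f μ) (hmean : ∫ z, f z ∂μ = 0) :
    ∫ z, Real.exp (f z ^ 2 / (4 * σ ^ 2)) ∂μ ≤ 3 := by
  have hfm : AEMeasurable (fun z => f z ^ 2) μ := hint.aemeasurable.pow_const 2
  have hl : 0 < (4 * σ ^ 2)⁻¹ := by positivity
  have htail := fun t => h.measureReal_le_sq_le (t := t) hf hint hmean
  have hle := lintegral_exp_mul_sub_one_le hfm (fun z => sq_nonneg _) hl htail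
  rw [← ofReal_integral_eq_lintegral_ofReal
      (integrable_exp_mul_of_tail hfm (fun z => sq_nonneg _) hl htail)
      (ae_of_all _ fun z => sub_nonneg.2 (Real.one_le_exp (by positivity))),
    ENNReal.ofReal_le_ofReal_iff two_pos.le] at hle
  simp_rw [← div_eq_inv_mul] at hle
  rw [integral_sub (h.integrable_exp_sq hσ hf hint hmean) (integrable_const _)] at hle
  simp only [integral_const, probReal_univ, smul_eq_mul, mul_one] at hle
  linarith

theorem IsT2.integrable_pow_four (h : IsT2 σ μ) (hσ : 0 < σ) (hf : LipschitzWith 1 f)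
    (hint : Integrable f μ) (hmean : ∫ z, f z ∂μ = 0) : Integrable (fun z => f z ^ 4) μ := by
  refine ((h.integrable_exp_sq hσ hf hint hmean).const_mul (32 * σ ^ 4)).mono'
    (hint.1.pow 4) (ae_of_all _ fun z => ?_)
  rw [Real.norm_of_nonneg (by positivity)]
  exact pow_four_le_exp_sq hσ _

theorem IsT2.integral_pow_four_le (h : IsT2 σ μ) (hσ : 0 < σ) (hf : LipschitzWith 1 f)
    (hint : Integrable f μ) (hmean : ∫ z, f z ∂μ = 0) : ∫ z, f z ^ 4 ∂μ ≤ 96 * σ ^ 4 := by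
  have hexp := h.integrable_exp_sq hσ hf hint hmean
  calc _ ≤ ∫ z, 32 * σ ^ 4 * Real.exp (f z ^ 2 / (4 * σ ^ 2)) ∂μ :=
        integral_mono (h.integrable_pow_four hσ hf hint hmean) (hexp.const_mul _)
          fun z => pow_four_le_exp_sq hσ _
    _ ≤ 32 * σ ^ 4 * 3 := by
        rw [integral_const_mul]
        gcongr
        exact h.integral_exp_sq_le hσ hf hint hmean
    _ = _ := by ring

end Moments

section StepFunction

/-- Squared distance from `x` to the pair `{t₁, t₂}`. -/
def sqDistPair (t₁ t₂ x : ℝ) : ℝ := min ((x - t₁) ^ 2) ((x - t₂) ^ 2)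

theorem sqDistPair_nonneg (t₁ t₂ x : ℝ) : 0 ≤ sqDistPair t₁ t₂ x := by
  unfold sqDistPair; positivity

theorem sqDistPair_comm (t₁ t₂ x : ℝ) : sqDistPair t₁ t₂ x = sqDistPair t₂ t₁ x := min_comm _ _

theorem continuous_sqDistPair (t₁ t₂ : ℝ) : Continuous (sqDistPair t₁ t₂) := by
  unfold sqDistPair; fun_prop

theorem sqDistPair_eq_mul {t₁ t₂ : ℝ} (h : t₁ < t₂) (x : ℝ) :
    sqDistPair t₁ t₂ x = (t₂ - t₁) ^ 2 * sqDistPair 0 1 ((x - t₁) / (t₂ - t₁)) := by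
  have hne : t₂ - t₁ ≠ 0 := (sub_pos.2 h).ne'
  rw [sqDistPair, sqDistPair, mul_min_of_nonneg _ _ (sq_nonneg _), ← mul_pow, ← mul_pow]
  congr 2 <;> field_simp <;> ring

theorem sub_left_sq_le_sqDistPair (t₁ t₂ x : ℝ) :
    (x - t₁) ^ 2 ≤ 2 * sqDistPair t₁ t₂ x + 2 * (t₂ - t₁) ^ 2 := by
  rw [sqDistPair]
  rcases min_choice ((x - t₁) ^ 2) ((x - t₂) ^ 2) with h | h <;> rw [h]
  · nlinarith [sq_nonneg (x - t₁), sq_nonneg (t₂ - t₁)]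
  · nlinarith [sq_nonneg (x - t₂ - (t₂ - t₁))]

/-- A piecewise linear step from `0` to `1` across the interval `[1/3, 2/3]`. -/
def stepFun (s : ℝ) : ℝ := max 0 (min 1 (3 * s - 1))

theorem continuous_stepFun : Continuous stepFun := by unfold stepFun; fun_prop

theorem stepFun_nonneg (s : ℝ) : 0 ≤ stepFun s := le_max_left _ _

theorem stepFun_le_one (s : ℝ) : stepFun s ≤ 1 := max_le zero_le_one (min_le_left _ _)

theorem abs_stepFun_le_one (s : ℝ) : |stepFun s| ≤ 1 :=
  abs_le.2 ⟨by linarith [stepFun_nonneg s], stepFun_le_one s⟩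

theorem stepFun_of_le {s : ℝ} (hs : s ≤ 1 / 3) : stepFun s = 0 := by
  rw [stepFun, min_eq_right (by linarith), max_eq_left (by linarith)]

theorem stepFun_of_ge {s : ℝ} (hs : 2 / 3 ≤ s) : stepFun s = 1 := by
  rw [stepFun, min_eq_left (by linarith), max_eq_right zero_le_one]

theorem stepFun_sub_le_three_mul (s r : ℝ) : stepFun r - stepFun s ≤ 3 * |s - r| := by
  have hmax := abs_max_sub_max_le_abs (min 1 (3 * r - 1)) (min 1 (3 * s - 1)) 0
  have hmin := abs_min_sub_min_le_max 1 (3 * r - 1) 1 (3 * s - 1)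
  rw [max_comm _ 0, max_comm _ 0] at hmax
  rw [sub_self, abs_zero, max_eq_right (abs_nonneg _),
    show 3 * r - 1 - (3 * s - 1) = 3 * (r - s) by ring, abs_mul, Nat.abs_ofNat,
    abs_sub_comm r s] at hmin
  exact (le_abs_self _).trans (hmax.trans hmin)

theorem sub_stepFun_sq_le (s : ℝ) : (s - stepFun s) ^ 2 ≤ sqDistPair 0 1 s := by
  rw [sqDistPair, le_min_iff]
  rcases le_total s (1 / 3) with h | h
  · rw [stepFun_of_le h]; constructor <;> nlinarith
  rcases le_total s (2 / 3) with h' | h'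
  · rw [stepFun, min_eq_right (by linarith), max_eq_right (by linarith)]
    constructor <;> nlinarith
  · rw [stepFun_of_ge h']; constructor <;> nlinarith

/-- The indicator of the interval on which `stepFun` is not locally constant. -/
noncomputable def stepGap : ℝ → ℝ := (Set.Ioo (1 / 3) (2 / 3)).indicator 1

theorem measurable_stepGap : Measurable stepGap := measurable_one.indicator measurableSet_Ioo

theorem stepGap_nonneg (s : ℝ) : 0 ≤ stepGap s := Set.indicator_nonneg (fun _ _ => zero_le_one) s

theorem stepGap_le_one (s : ℝ) : stepGap s ≤ 1 := Set.indicator_le_self' (fun _ _ => zero_le_one) s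

theorem stepGap_le_nine_mul_sqDistPair (s : ℝ) : stepGap s ≤ 9 * sqDistPair 0 1 s := by
  by_cases h : s ∈ Set.Ioo (1 / 3 : ℝ) (2 / 3)
  · have : 1 / 9 ≤ sqDistPair 0 1 s := le_min (by nlinarith [h.1]) (by nlinarith [h.2])
    rw [stepGap, Set.indicator_of_mem h, Pi.one_apply]
    linarith
  · rw [stepGap, Set.indicator_of_notMem h]
    linarith [sqDistPair_nonneg 0 1 s]

theorem stepFun_sub_le_nine_mul_sq {s r : ℝ} (hs : s ∉ Set.Ioo (1 / 3 : ℝ) (2 / 3))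
    (hr : r ∉ Set.Ioo (1 / 3 : ℝ) (2 / 3)) : stepFun r - stepFun s ≤ 9 * (s - r) ^ 2 := by
  simp only [Set.mem_Ioo, not_and_or, not_lt] at hs hr
  rcases hs with hs | hs <;> rcases hr with hr | hr <;>
    simp only [stepFun_of_le, stepFun_of_ge, hs, hr] <;> nlinarith

theorem stepFun_sub_le {θ : ℝ} (hθ : 0 < θ) (hθ1 : θ ≤ 1) (s r : ℝ) :
    stepFun r - stepFun s ≤ 9 / θ * (s - r) ^ 2 + θ * (stepGap s + stepGap r) := by
  by_cases h : s ∈ Set.Ioo (1 / 3 : ℝ) (2 / 3) ∨ r ∈ Set.Ioo (1 / 3 : ℝ) (2 / 3)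
  · have hgap : 1 ≤ stepGap s + stepGap r := by
      rcases h with h | h <;> simp only [stepGap, Set.indicator_of_mem h, Pi.one_apply]
      · exact le_add_of_nonneg_right (stepGap_nonneg r)
      · exact le_add_of_nonneg_left (stepGap_nonneg s)
    have hyoung : 3 * |s - r| ≤ 9 / θ * (s - r) ^ 2 + θ := by
      have hsq : 9 / θ * (s - r) ^ 2 + θ - 3 * |s - r| =
          ((3 * |s - r| - θ) ^ 2 + θ * (3 * |s - r|)) / θ := by
        rw [← sq_abs (s - r)]; field_simp; ring
      have : 0 ≤ ((3 * |s - r| - θ) ^ 2 + θ * (3 * |s - r|)) / θ := by positivity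
      linarith
    nlinarith [stepFun_sub_le_three_mul s r]
  · obtain ⟨hs, hr⟩ := not_or.1 h
    simp only [stepGap, Set.indicator_of_notMem hs, Set.indicator_of_notMem hr, add_zero, mul_zero]
    refine (stepFun_sub_le_nine_mul_sq hs hr).trans ?_
    gcongr
    rw [le_div_iff₀ hθ]
    linarith

end StepFunction

section Bimodality

variable {d : ℕ} {σ : ℝ} {μ : Measure (EucSp d)} [IsProbabilityMeasure μ] {f : EucSp d → ℝ}

theorem IsT2.variance_stepFun_le (h : IsT2 σ μ) (hσ : 0 < σ) {g : EucSp d → ℝ} {L : ℝ} (hL : 0 < L)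
    (hg : ∀ u v, |g u - g v| ≤ ‖u - v‖ / L) (hgm : Measurable g) :
    L ^ 2 * Var[fun z => stepFun (g z); μ] ≤ 144 * σ ^ 2 * ∫ z, stepGap (g z) ∂μ := by
  have hgap : MemLp (fun z => stepGap (g z)) 2 μ := by
    refine MemLp.of_bound (measurable_stepGap.comp hgm).aestronglyMeasurable 1
      (ae_of_all _ fun z => ?_)
    rw [Real.norm_of_nonneg (stepGap_nonneg _)]
    exact stepGap_le_one _
  have hvar := h.variance_le_of_sub_le hσ (A := 9 / L ^ 2) (continuous_stepFun.measurable.comp hgm)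
    (fun z => abs_stepFun_le_one (g z)) hgap (by positivity) one_pos fun θ hθ hθ1 u v => by
      refine (stepFun_sub_le hθ hθ1 (g u) (g v)).trans (add_le_add ?_ le_rfl)
      calc 9 / θ * (g u - g v) ^ 2 ≤ 9 / θ * (‖u - v‖ / L) ^ 2 := by
            rw [← sq_abs]; gcongr; exact hg u v
        _ = 9 / L ^ 2 / θ * ‖u - v‖ ^ 2 := by ring
  calc _ ≤ L ^ 2 * (16 * σ ^ 2 * (9 / L ^ 2) * ∫ z, stepGap (g z) ∂μ) :=
        mul_le_mul_of_nonneg_left hvar (sq_nonneg L)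
    _ = _ := by field_simp; ring

theorem variance_le_integral_sub_sq (hf : MemLp f 2 μ) (c : ℝ) :
    Var[f; μ] ≤ ∫ z, (f z - c) ^ 2 ∂μ := by
  rw [← variance_sub_const hf.1 c]
  exact variance_le_expectation_sq (hf.1.sub aestronglyMeasurable_const)

theorem integrable_sqDistPair (hf : MemLp f 2 μ) (t₁ t₂ : ℝ) :
    Integrable (fun z => sqDistPair t₁ t₂ (f z)) μ :=
  (hf.sub (memLp_const t₁)).integrable_sq.inf (hf.sub (memLp_const t₂)).integrable_sq

theorem variance_le_integral_sqDistPair_add_sq (hf : MemLp f 2 μ) (t₁ t₂ : ℝ) :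
    Var[f; μ] ≤ 2 * ∫ z, sqDistPair t₁ t₂ (f z) ∂μ + 2 * (t₂ - t₁) ^ 2 := by
  have hpair := (integrable_sqDistPair hf t₁ t₂).const_mul 2
  calc Var[f; μ] ≤ ∫ z, (f z - t₁) ^ 2 ∂μ := variance_le_integral_sub_sq hf t₁
    _ ≤ ∫ z, (2 * sqDistPair t₁ t₂ (f z) + 2 * (t₂ - t₁) ^ 2) ∂μ :=
        integral_mono (hf.sub (memLp_const t₁)).integrable_sq (hpair.add (integrable_const _))
          fun z => sub_left_sq_le_sqDistPair t₁ t₂ (f z)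
    _ = _ := by rw [integral_add hpair (integrable_const _), integral_const_mul]; simp

theorem variance_le_integral_sqDistPair_add_variance (hf : MemLp f 2 μ) {t₁ t₂ : ℝ}
    (ht : t₁ < t₂) :
    Var[f; μ] ≤ 2 * ∫ z, sqDistPair t₁ t₂ (f z) ∂μ +
      2 * (t₂ - t₁) ^ 2 * Var[fun z => stepFun ((f z - t₁) / (t₂ - t₁)); μ] := by
  set L := t₂ - t₁
  have hL : 0 < L := sub_pos.2 ht
  set s : EucSp d → ℝ := fun z => (f z - t₁) / L
  set v := ∫ z, stepFun (s z) ∂μ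
  have hstepm : AEStronglyMeasurable (fun z => stepFun (s z)) μ :=
    continuous_stepFun.comp_aestronglyMeasurable
      ((hf.1.sub aestronglyMeasurable_const).mul_const _)
  have hstep : MemLp (fun z => stepFun (s z)) 2 μ :=
    MemLp.of_bound hstepm 1 (ae_of_all _ fun z => abs_stepFun_le_one _)
  have hpair := (integrable_sqDistPair hf t₁ t₂).const_mul 2
  have hdev : Integrable (fun z => 2 * L ^ 2 * (stepFun (s z) - v) ^ 2) μ :=
    (hstep.sub (memLp_const v)).integrable_sq.const_mul _
  have hpt : ∀ z, (f z - (t₁ + L * v)) ^ 2 ≤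
      2 * sqDistPair t₁ t₂ (f z) + 2 * L ^ 2 * (stepFun (s z) - v) ^ 2 := fun z => by
    have hscale : f z - (t₁ + L * v) = L * ((s z - stepFun (s z)) + (stepFun (s z) - v)) := by
      simp only [s]; field_simp; ring
    rw [hscale, mul_pow, sqDistPair_eq_mul ht]
    nlinarith [mul_le_mul_of_nonneg_left ((add_sq_le (a := s z - stepFun (s z))
      (b := stepFun (s z) - v))) (sq_nonneg L),
      mul_le_mul_of_nonneg_left (sub_stepFun_sq_le (s z)) (sq_nonneg L)]
  calc Var[f; μ] ≤ ∫ z, (f z - (t₁ + L * v)) ^ 2 ∂μ := variance_le_integral_sub_sq hf _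
    _ ≤ ∫ z, (2 * sqDistPair t₁ t₂ (f z) + 2 * L ^ 2 * (stepFun (s z) - v) ^ 2) ∂μ :=
        integral_mono (hf.sub (memLp_const _)).integrable_sq (hpair.add hdev) hpt
    _ = _ := by
        rw [integral_add hpair hdev, integral_const_mul, integral_const_mul,
          variance_eq_integral hstep.aemeasurable]

theorem IsT2.variance_le_mul_integral_sqDistPair (h : IsT2 σ μ) (hσ : 0 < σ)
    (hf : LipschitzWith 1 f) (hf2 : MemLp f 2 μ) {t₁ t₂ : ℝ} (ht : t₁ < t₂) :
    Var[f; μ] ≤ (2 + 2592 * σ ^ 2 / (t₂ - t₁) ^ 2) * ∫ z, sqDistPair t₁ t₂ (f z) ∂μ := by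
  set L := t₂ - t₁ with hLdef
  have hL : 0 < L := sub_pos.2 ht
  have hstep := h.variance_stepFun_le hσ (g := fun z => (f z - t₁) / L) hL (fun u v => by
    rw [div_sub_div_same, sub_sub_sub_cancel_right, abs_div, abs_of_pos hL]
    gcongr
    simpa using hf.norm_sub_le u v) (by have := hf.continuous.measurable; fun_prop)
  have hgap : ∫ z, stepGap ((f z - t₁) / L) ∂μ ≤ 9 / L ^ 2 * ∫ z, sqDistPair t₁ t₂ (f z) ∂μ := by
    rw [← integral_const_mul]
    refine integral_mono_of_nonneg (ae_of_all _ fun z => stepGap_nonneg _)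
      ((integrable_sqDistPair hf2 t₁ t₂).const_mul _) (ae_of_all _ fun z => ?_)
    refine (stepGap_le_nine_mul_sqDistPair _).trans_eq ?_
    simp only [sqDistPair_eq_mul ht, ← hLdef]
    field_simp
  calc Var[f; μ] ≤ 2 * ∫ z, sqDistPair t₁ t₂ (f z) ∂μ +
        2 * L ^ 2 * Var[fun z => stepFun ((f z - t₁) / L); μ] :=
        variance_le_integral_sqDistPair_add_variance hf2 ht
    _ ≤ 2 * ∫ z, sqDistPair t₁ t₂ (f z) ∂μ +
        2 * (144 * σ ^ 2 * (9 / L ^ 2 * ∫ z, sqDistPair t₁ t₂ (f z) ∂μ)) := by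
        linarith [hstep.trans (mul_le_mul_of_nonneg_left hgap (by positivity))]
    _ = _ := by ring

theorem IsT2.one_le_mul_integral_sqDistPair (h : IsT2 σ μ) (hσ : 0 < σ) (hf : LipschitzWith 1 f)
    (hf2 : MemLp f 2 μ) (hvar : 1 ≤ Var[f; μ]) (t₁ t₂ : ℝ) :
    1 ≤ (4 + 10368 * σ ^ 2) * ∫ z, sqDistPair t₁ t₂ (f z) ∂μ := by
  wlog hle : t₁ ≤ t₂ generalizing t₁ t₂
  · simpa only [sqDistPair_comm t₂] using this t₂ t₁ (le_of_not_ge hle)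
  set m := ∫ z, sqDistPair t₁ t₂ (f z) ∂μ
  have hm : 0 ≤ m := integral_nonneg fun z => sqDistPair_nonneg _ _ _
  rcases lt_or_ge (t₂ - t₁) (1 / 2) with hnear | hfar
  · have := variance_le_integral_sqDistPair_add_sq hf2 t₁ t₂
    have hsq : (t₂ - t₁) ^ 2 ≤ (1 / 2) ^ 2 := by
      have := sub_nonneg.2 hle
      gcongr
    nlinarith [mul_nonneg (sq_nonneg σ) hm]
  · calc 1 ≤ (2 + 2592 * σ ^ 2 / (t₂ - t₁) ^ 2) * m :=
          hvar.trans (h.variance_le_mul_integral_sqDistPair hσ hf hf2 (by linarith))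
      _ ≤ (2 + 2592 * σ ^ 2 / (1 / 2) ^ 2) * m := by gcongr
      _ = (2 + 10368 * σ ^ 2) * m := by ring
      _ ≤ _ := by gcongr; norm_num

end Bimodality

section Truncation

/-- The projection of `t` to `[-T, T]`. -/
def clampTo (T t : ℝ) : ℝ := max (-T) (min T t)

theorem abs_clampTo_le {T : ℝ} (hT : 0 ≤ T) (t : ℝ) : |clampTo T t| ≤ T := by
  rw [abs_le]
  exact ⟨le_max_left _ _, max_le (by linarith) (min_le_left _ _)⟩

theorem sub_clampTo_sq_le {T x : ℝ} (hx : |x| ≤ T) (t : ℝ) :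
    (x - clampTo T t) ^ 2 ≤ (x - t) ^ 2 := by
  obtain ⟨hx₁, hx₂⟩ := abs_le.1 hx
  unfold clampTo
  rcases le_total T t with h | h
  · rw [min_eq_left h, max_eq_right (by linarith)]; nlinarith
  rcases le_total (-T) t with h' | h'
  · rw [min_eq_right h, max_eq_right h']
  · rw [min_eq_right h, max_eq_left h']; nlinarith

theorem sqDistPair_clampTo_le {T x : ℝ} (hx : |x| ≤ T) (t₁ t₂ : ℝ) :
    sqDistPair (clampTo T t₁) (clampTo T t₂) x ≤ sqDistPair t₁ t₂ x :=
  min_le_min (sub_clampTo_sq_le hx _) (sub_clampTo_sq_le hx _)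

theorem sqDistPair_clampTo_le_four_mul {T : ℝ} (hT : 0 ≤ T) (t₁ t₂ x : ℝ) :
    sqDistPair (clampTo T t₁) (clampTo T t₂) x ≤ 4 * max T |x| ^ 2 := by
  have hdist : |x - clampTo T t₁| ≤ 2 * max T |x| := by
    linarith [abs_sub x (clampTo T t₁), abs_clampTo_le hT t₁, le_max_left T |x|, le_max_right T |x|]
  calc sqDistPair (clampTo T t₁) (clampTo T t₂) x ≤ |x - clampTo T t₁| ^ 2 := by
        rw [sq_abs]; exact min_le_left _ _
    _ ≤ (2 * max T |x|) ^ 2 := by gcongr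
    _ = _ := by ring

theorem sqDistPair_clampTo_le_min_add {T : ℝ} (hT : 0 < T) (t₁ t₂ x : ℝ) :
    sqDistPair (clampTo T t₁) (clampTo T t₂) x ≤
      min (sqDistPair t₁ t₂ x) (4 * T ^ 2) + 4 / T ^ 2 * x ^ 4 := by
  have hbound := sqDistPair_clampTo_le_four_mul hT.le t₁ t₂ x
  rcases le_or_gt |x| T with hx | hx
  · rw [max_eq_left hx] at hbound
    exact le_add_of_le_of_nonneg (le_min (sqDistPair_clampTo_le hx t₁ t₂) hbound) (by positivity)
  · rw [max_eq_right hx.le, sq_abs] at hbound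
    have hsq : T ^ 2 ≤ x ^ 2 := by rw [← sq_abs x]; gcongr
    refine (hbound.trans ?_).trans
      (le_add_of_nonneg_left (le_min (sqDistPair_nonneg _ _ _) (by positivity)))
    rw [div_mul_eq_mul_div, le_div_iff₀ (by positivity)]
    nlinarith [sq_nonneg x]

theorem exists_le_integral_min_sqDistPair {σ : ℝ} (hσ : 0 < σ) :
    ∃ a M : ℝ, 0 < a ∧ 0 < M ∧ ∀ {d : ℕ} {μ : Measure (EucSp d)} [IsProbabilityMeasure μ],
      IsT2 σ μ → ∀ f : EucSp d → ℝ, LipschitzWith 1 f → MemLp f 2 μ → ∫ z, f z ∂μ = 0 →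
        1 ≤ Var[f; μ] → ∀ t₁ t₂ : ℝ, a ≤ ∫ z, min (sqDistPair t₁ t₂ (f z)) M ∂μ := by
  set c : ℝ := 1 / (4 + 10368 * σ ^ 2)
  have hc : 0 < c := by positivity
  set T : ℝ := √(768 * σ ^ 4 / c)
  have hT : 0 < T := Real.sqrt_pos.2 (by positivity)
  refine ⟨c / 2, 4 * T ^ 2, by positivity, by positivity, ?_⟩
  intro d μ _ hT2 f hf hf2 hmean hvar t₁ t₂
  have hfint := hf2.integrable one_le_two
  have hclamped : c ≤ ∫ z, sqDistPair (clampTo T t₁) (clampTo T t₂) (f z) ∂μ :=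
    (div_le_iff₀' (by positivity)).2 (hT2.one_le_mul_integral_sqDistPair hσ hf hf2 hvar _ _)
  have hmin : Integrable (fun z => min (sqDistPair t₁ t₂ (f z)) (4 * T ^ 2)) μ :=
    (integrable_sqDistPair hf2 t₁ t₂).inf (integrable_const _)
  have hfour := (hT2.integrable_pow_four hσ hf hfint hmean).const_mul (4 / T ^ 2)
  have htrunc := integral_mono (integrable_sqDistPair hf2 (clampTo T t₁) (clampTo T t₂))
    (hmin.add hfour) fun z => sqDistPair_clampTo_le_min_add hT t₁ t₂ (f z)
  have hfourle : 4 / T ^ 2 * ∫ z, f z ^ 4 ∂μ ≤ c / 2 := by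
    calc _ ≤ 4 / T ^ 2 * (96 * σ ^ 4) := by
          gcongr; exact hT2.integral_pow_four_le hσ hf hfint hmean
      _ = c / 2 := by
          rw [Real.sq_sqrt (by positivity)]; field_simp; norm_num
  simp only [Pi.add_apply] at htrunc
  rw [integral_add hmin hfour, integral_const_mul] at htrunc
  linarith

end Truncation

section NoiseMoments

theorem lipschitzWith_one_inner {E : Type*} [NormedAddCommGroup E] [InnerProductSpace ℝ E] {e : E}
    (he : ‖e‖ = 1) : LipschitzWith 1 fun z => inner ℝ e z := by
  have h := (innerSL ℝ e).lipschitz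
  rwa [← NNReal.coe_inj.1 (show ((‖innerSL ℝ e‖₊ : NNReal) : ℝ) = (1 : NNReal) by simp [he])]

namespace MixtureModel

variable {d K : ℕ} (θ : MixtureModel d K)

theorem memLp_noise_coord (a : Fin d) : MemLp (fun z : EucSp d => z a) 2 θ.noise :=
  θ.noise_memLp.mono (by fun_prop) (ae_of_all _ fun z => PiLp.norm_apply_le z a)

theorem memLp_noise_inner (b : EucSp d) : MemLp (fun z => inner ℝ b z) 2 θ.noise :=
  θ.noise_memLp.const_inner b

theorem integrable_noise_inner (b : EucSp d) : Integrable (fun z => inner ℝ b z) θ.noise :=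
  haveI := θ.noise_prob
  (θ.memLp_noise_inner b).integrable one_le_two

theorem integral_noise_inner (b : EucSp d) : ∫ z, inner ℝ b z ∂θ.noise = 0 := by
  have := θ.noise_prob
  simp only [PiLp.inner_apply, RCLike.inner_apply, conj_trivial]
  rw [integral_finsetSum _ fun a _ => ((θ.memLp_noise_coord a).integrable one_le_two).mul_const _]
  simp [integral_mul_const, θ.noise_mean]

theorem integral_noise_inner_sq (b : EucSp d) : ∫ z, inner ℝ b z ^ 2 ∂θ.noise = ‖b‖ ^ 2 := by
  have hexpand : ∀ z : EucSp d, inner ℝ b z ^ 2 = ∑ a, ∑ c, b a * b c * (z a * z c) := fun z => by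
    simp only [PiLp.inner_apply, RCLike.inner_apply, conj_trivial, sq, Finset.sum_mul_sum]
    exact Finset.sum_congr rfl fun a _ => Finset.sum_congr rfl fun c _ => by ring
  have hint : ∀ a c : Fin d, Integrable (fun z : EucSp d => b a * b c * (z a * z c)) θ.noise :=
    fun a c => ((θ.memLp_noise_coord a).integrable_mul (θ.memLp_noise_coord c)).const_mul _
  simp_rw [hexpand, integral_finsetSum _ fun a _ => integrable_finsetSum _ fun c _ => hint a c,
    integral_finsetSum _ fun c _ => hint _ c, integral_const_mul, θ.noise_isotropic]
  rw [EuclideanSpace.real_norm_sq_eq]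
  simp [sq]

theorem variance_noise_inner (b : EucSp d) : Var[fun z => inner ℝ b z; θ.noise] = ‖b‖ ^ 2 := by
  rw [variance_of_integral_eq_zero (θ.integrable_noise_inner b).aemeasurable
    (θ.integral_noise_inner b), integral_noise_inner_sq]

end MixtureModel

end NoiseMoments

section Chernoff

variable {Ω ι : Type*} [MeasurableSpace Ω] {P : Measure Ω}

theorem measureReal_exists_mem_le {s : Finset ι} {E : ι → Ω → Prop} {b : ℝ}
    (h : ∀ i ∈ s, P.real {ω | E i ω} ≤ b) : P.real {ω | ∃ i ∈ s, E i ω} ≤ s.card * b := by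
  have hunion : {ω | ∃ i ∈ s, E i ω} = ⋃ i ∈ s, {ω | E i ω} := by ext; simp
  calc P.real {ω | ∃ i ∈ s, E i ω} ≤ ∑ i ∈ s, P.real {ω | E i ω} :=
        hunion ▸ measureReal_biUnion_finset_le _ _
    _ ≤ s.card * b := by simpa using Finset.sum_le_card_nsmul s _ b h

theorem exp_neg_le_one_sub_half {x : ℝ} (h0 : 0 ≤ x) (h1 : x ≤ 1) :
    Real.exp (-x) ≤ 1 - x / 2 := by
  calc Real.exp (-x) = (Real.exp x)⁻¹ := Real.exp_neg x
    _ ≤ (x + 1)⁻¹ := by gcongr; exact Real.add_one_le_exp x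
    _ ≤ 1 - x / 2 := by rw [inv_le_iff_one_le_mul₀ (by linarith)]; nlinarith

variable [Fintype ι] {X : ι → Ω → ℝ}

theorem mgf_sum_le_exp (hX : ∀ i, Measurable (X i)) (hind : iIndepFun X P) {t b : ℝ}
    (hb : ∀ i, mgf (X i) P t ≤ Real.exp b) :
    mgf (∑ i, X i) P t ≤ Real.exp (b * Fintype.card ι) := by
  rw [hind.mgf_sum hX]
  calc ∏ i, mgf (X i) P t ≤ ∏ _i : ι, Real.exp b :=
        Finset.prod_le_prod (fun i _ => mgf_nonneg) fun i _ => hb i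
    _ = _ := by rw [Finset.prod_const, Finset.card_univ, ← Real.exp_nat_mul, mul_comm]

variable [IsProbabilityMeasure P]

theorem mgf_neg_inv_le_exp {Y : Ω → ℝ} {a M : ℝ} (hY : Measurable Y) (hM : 0 < M)
    (h0 : ∀ ω, 0 ≤ Y ω) (h1 : ∀ ω, Y ω ≤ M) (ha : a ≤ ∫ ω, Y ω ∂P) :
    mgf Y P (-M⁻¹) ≤ Real.exp (-(a / (2 * M))) := by
  have hpt : ∀ ω, Real.exp (-M⁻¹ * Y ω) ≤ 1 - (2 * M)⁻¹ * Y ω := fun ω => by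
    have h := exp_neg_le_one_sub_half (div_nonneg (h0 ω) hM.le) ((div_le_one hM).2 (h1 ω))
    calc Real.exp (-M⁻¹ * Y ω) = Real.exp (-(Y ω / M)) := by ring_nf
      _ ≤ 1 - Y ω / M / 2 := h
      _ = _ := by field_simp
  have hint : Integrable Y P := Integrable.of_bound hY.aestronglyMeasurable M
    (ae_of_all _ fun ω => by rw [Real.norm_of_nonneg (h0 ω)]; exact h1 ω)
  calc mgf Y P (-M⁻¹) ≤ ∫ ω, (1 - (2 * M)⁻¹ * Y ω) ∂P :=
        integral_mono_of_nonneg (ae_of_all _ fun ω => (Real.exp_pos _).le)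
          ((integrable_const _).sub (hint.const_mul _)) (ae_of_all _ hpt)
    _ = 1 - (2 * M)⁻¹ * ∫ ω, Y ω ∂P := by
        rw [integral_sub (integrable_const _) (hint.const_mul _), integral_const_mul]; simp
    _ ≤ 1 - (2 * M)⁻¹ * a := by gcongr
    _ ≤ Real.exp (-((2 * M)⁻¹ * a)) := by linarith [Real.add_one_le_exp (-((2 * M)⁻¹ * a))]
    _ = _ := by ring_nf

theorem measureReal_sum_le_le_exp (hX : ∀ i, Measurable (X i)) (hind : iIndepFun X P)
    {a M : ℝ} (hM : 0 < M) (h0 : ∀ i ω, 0 ≤ X i ω) (h1 : ∀ i ω, X i ω ≤ M)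
    (ha : ∀ i, a ≤ ∫ ω, X i ω ∂P) :
    P.real {ω | ∑ i, X i ω ≤ a / 4 * Fintype.card ι} ≤
      Real.exp (-(a / (4 * M)) * Fintype.card ι) := by
  have hint : ∀ i, Integrable (fun ω => Real.exp (-M⁻¹ * X i ω)) P := fun i =>
    Integrable.of_bound (C := 1) (by have := hX i; fun_prop) (ae_of_all _ fun ω => by
      rw [Real.norm_of_nonneg (Real.exp_pos _).le, Real.exp_le_one_iff, neg_mul, neg_nonpos]
      exact mul_nonneg (by positivity) (h0 i ω))
  have hchernoff := measure_le_le_exp_mul_mgf (X := ∑ i, X i) (μ := P) (a / 4 * Fintype.card ι)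
    (t := -M⁻¹) (by rw [neg_nonpos]; positivity)
    (hind.integrable_exp_mul_sum hX fun i _ => hint i)
  simp only [Finset.sum_apply] at hchernoff
  calc _ ≤ _ := hchernoff
    _ ≤ Real.exp (-(-M⁻¹) * (a / 4 * Fintype.card ι)) *
          Real.exp (-(a / (2 * M)) * Fintype.card ι) := by
        gcongr
        exact mgf_sum_le_exp hX hind fun i => mgf_neg_inv_le_exp (hX i) hM (h0 i) (h1 i) (ha i)
    _ = _ := by rw [← Real.exp_add]; congr 1; field_simp; ring

theorem measureReal_le_sum_le_exp (hX : ∀ i, Measurable (X i)) (hind : iIndepFun X P)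
    {l b : ℝ} (hl : 0 ≤ l) (hint : ∀ i, Integrable (fun ω => Real.exp (l * X i ω)) P)
    (hb : ∀ i, ∫ ω, Real.exp (l * X i ω) ∂P ≤ Real.exp b) (C : ℝ) :
    P.real {ω | C * Fintype.card ι ≤ ∑ i, X i ω} ≤ Real.exp ((b - l * C) * Fintype.card ι) := by
  have hchernoff := measure_ge_le_exp_mul_mgf (X := ∑ i, X i) (μ := P) (C * Fintype.card ι)
    hl (hind.integrable_exp_mul_sum hX fun i _ => hint i)
  simp only [Finset.sum_apply] at hchernoff
  calc _ ≤ _ := hchernoff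
    _ ≤ Real.exp (-l * (C * Fintype.card ι)) * Real.exp (b * Fintype.card ι) := by
        gcongr
        exact mgf_sum_le_exp hX hind hb
    _ = _ := by rw [← Real.exp_add]; ring_nf

end Chernoff

section Nets

open Metric Module
open scoped NNReal

variable {E : Type*} [NormedAddCommGroup E] [NormedSpace ℝ E]

theorem card_le_of_isSeparated [FiniteDimensional ℝ E] {s : Finset E} {ε : ℝ≥0} (hε : 0 < ε)
    (hs : (s : Set E) ⊆ closedBall 0 1) (hsep : IsSeparated ε (s : Set E)) :
    (s.card : ℝ) ≤ (1 + 2 / ε) ^ finrank ℝ E := by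
  borelize E
  set n := finrank ℝ E
  set μ : Measure E := Measure.addHaar
  have hr : 0 < (ε : ℝ) / 2 := by positivity
  have hdisj : (s : Set E).PairwiseDisjoint fun c => ball c (ε / 2 : ℝ) := fun c hc c' hc' hne => by
    refine ball_disjoint_ball ?_
    have h : (ε : ℝ≥0∞) < edist c c' := hsep hc hc' hne
    rw [edist_nndist, ENNReal.coe_lt_coe, ← NNReal.coe_lt_coe, coe_nndist] at h
    linarith
  have hsub : ⋃ c ∈ s, ball c (ε / 2 : ℝ) ⊆ ball 0 (1 + ε / 2 : ℝ) :=
    Set.iUnion₂_subset fun c hc => ball_subset_ball' (by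
      linarith [mem_closedBall.1 (hs hc)])
  have hvol : s.card * (μ.real (ball 0 1) * (ε / 2 : ℝ) ^ n) ≤
      μ.real (ball 0 1) * (1 + ε / 2 : ℝ) ^ n := by
    calc s.card * (μ.real (ball 0 1) * (ε / 2 : ℝ) ^ n)
        = ∑ c ∈ s, μ.real (ball c (ε / 2 : ℝ)) := by
          simp [Measure.real, μ.addHaar_ball_of_pos _ hr, n, hr.le, mul_comm]
      _ = μ.real (⋃ c ∈ s, ball c (ε / 2 : ℝ)) :=
          (measureReal_biUnion_finset hdisj (fun _ _ => measurableSet_ball)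
            fun _ _ => measure_ball_lt_top.ne).symm
      _ ≤ μ.real (ball 0 (1 + ε / 2 : ℝ)) := measureReal_mono hsub measure_ball_lt_top.ne
      _ = _ := by
          have h1 : (0 : ℝ) < 1 + ε / 2 := by positivity
          simp [Measure.real, μ.addHaar_ball_of_pos _ h1, n, h1.le, mul_comm]
  have hball : 0 < μ.real (ball 0 1) :=
    ENNReal.toReal_pos (measure_ball_pos μ 0 one_pos).ne' measure_ball_lt_top.ne
  calc (s.card : ℝ) ≤ (1 + ε / 2 : ℝ) ^ n / (ε / 2 : ℝ) ^ n := by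
        rw [le_div_iff₀ (by positivity)]
        exact le_of_mul_le_mul_left (by linarith) hball
    _ = _ := by
        rw [← div_pow]
        congr 1
        field_simp
        ring

theorem exists_finset_net [FiniteDimensional ℝ E] {ε : ℝ≥0} (hε : 0 < ε) {A : Set E}
    (hA : A ⊆ closedBall 0 1) :
    ∃ N : Finset E, (N.card : ℝ) ≤ (1 + 2 / ε) ^ finrank ℝ E ∧ (N : Set E) ⊆ A ∧
      ∀ x ∈ A, ∃ c ∈ N, ‖x - c‖ ≤ ε := by
  have hcard : ∀ {s : Finset E}, (s : Set E) ⊆ A → IsSeparated ε (s : Set E) →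
      (s.card : ℝ) ≤ (1 + 2 / ε) ^ finrank ℝ E := fun hsA =>
    card_le_of_isSeparated hε (hsA.trans hA)
  have hpack : packingNumber ε A ≠ ⊤ := by
    set k := ⌊(1 + 2 / (ε : ℝ)) ^ finrank ℝ E⌋₊
    refine ne_top_of_le_ne_top (ENat.natCast_ne_top k) (iSup₂_le fun C hCA => iSup_le fun hC => ?_)
    by_contra! hlt
    obtain ⟨t, htC, htcard⟩ := Set.exists_subset_encard_eq (Order.add_one_le_of_lt hlt)
    have htfin : t.Finite := Set.finite_of_encard_eq_coe (k := k + 1) (by simpa using htcard)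
    lift t to Finset E using htfin
    have hle := Nat.le_floor (hcard (htC.trans hCA) (hC.mono htC))
    rw [Set.encard_coe_eq_coe_finsetCard] at htcard
    have : t.card = k + 1 := by exact_mod_cast htcard
    omega
  have hfin : (maximalSeparatedSet ε A).Finite :=
    Set.encard_ne_top_iff.1 (encard_maximalSeparatedSet hpack ▸ hpack)
  refine ⟨hfin.toFinset, hcard ?_ ?_, ?_, fun x hx => ?_⟩
  · simpa using maximalSeparatedSet_subset
  · simpa using isSeparated_maximalSeparatedSet
  · simpa using maximalSeparatedSet_subset
  · obtain ⟨c, hc, hxc⟩ := isCover_maximalSeparatedSet hpack hx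
    exact ⟨c, hfin.mem_toFinset.2 hc, by
      simpa [edist_nndist, nndist_eq_nnnorm, ← NNReal.coe_le_coe] using hxc⟩

theorem norm_apply_le_of_unit_net {F : Type*} [NormedAddCommGroup F] [NormedSpace ℝ F]
    (A : E →L[ℝ] F) {N : Set E} {B : ℝ} (hB : 0 ≤ B)
    (hnet : ∀ x : E, ‖x‖ = 1 → ∃ c ∈ N, ‖x - c‖ ≤ 1 / 2) (hA : ∀ c ∈ N, ‖A c‖ ≤ B) (x : E) :
    ‖A x‖ ≤ 2 * B * ‖x‖ := by
  have hself : ‖A‖ ≤ B + ‖A‖ * (1 / 2) := by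
    refine ContinuousLinearMap.opNorm_le_of_unit_norm (by positivity) fun x hx => ?_
    obtain ⟨c, hc, hxc⟩ := hnet x hx
    calc ‖A x‖ = ‖A c + A (x - c)‖ := by rw [← map_add, add_sub_cancel]
      _ ≤ ‖A c‖ + ‖A (x - c)‖ := norm_add_le _ _
      _ ≤ B + ‖A‖ * (1 / 2) := by
        gcongr
        · exact hA c hc
        · exact A.le_of_opNorm_le_of_le le_rfl hxc
  exact A.le_of_opNorm_le (by linarith) x

end Nets

section GoodSample

/-- Labels `y i` of law `π` and noise vectors `z i` of law `Q`, all mutually independent. -/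
structure IsNoiseSample {d K : ℕ} {Ω ι : Type*} [MeasurableSpace Ω] (θ : MixtureModel d K)
    (P : Measure Ω) (y : ι → Ω → Fin K) (z : ι → Ω → EucSp d) : Prop where
  measurable_label : ∀ i, Measurable (y i)
  measurable_noise : ∀ i, Measurable (z i)
  indep : iIndepFun (fun i ω => (y i ω, z i ω)) P
  indep_label_noise : ∀ i, IndepFun (y i) (z i) P
  label_law : ∀ i j, P.real {ω | y i ω = j} = θ.weight j
  noise_law : ∀ i, P.map (z i) = θ.noise

/-- A sample of labels and noise vectors with non-negligible classes, with bounded empirical second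
moments, and such that no one-dimensional projection of a class of noise vectors is close to a
two-point configuration. -/
structure GoodSample {d K m : ℕ} (κ C : ℝ) (y : Fin m → Fin K) (z : Fin m → EucSp d) : Prop where
  le_card : ∀ k, κ * m ≤ ((Finset.univ.filter fun i => y i = k).card : ℝ)
  sum_inner_sq_le : ∀ b : EucSp d, ∑ i, inner ℝ b (z i) ^ 2 ≤ C * m * ‖b‖ ^ 2
  le_sum_sqDistPair : ∀ (b : EucSp d) (β : ℝ) (k : Fin K),
    κ * m * ‖b‖ ^ 2 ≤ ∑ i with y i = k, sqDistPair 0 1 (β + inner ℝ b (z i))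

variable {d K m : ℕ}

theorem IsNoiseSample.comp {Ω ι ι' : Type*} [MeasurableSpace Ω] {θ : MixtureModel d K}
    {P : Measure Ω} {y : ι → Ω → Fin K} {z : ι → Ω → EucSp d} (h : IsNoiseSample θ P y z)
    {f : ι' → ι} (hf : Function.Injective f) :
    IsNoiseSample θ P (fun i => y (f i)) (fun i => z (f i)) where
  measurable_label _ := h.measurable_label _
  measurable_noise _ := h.measurable_noise _
  indep := h.indep.precomp hf
  indep_label_noise _ := h.indep_label_noise _
  label_law _ := h.label_law _
  noise_law _ := h.noise_law _

theorem sub_sq_le_three (x x' t t' : ℝ) :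
    (x' - t') ^ 2 ≤ 3 * (x - t) ^ 2 + 3 * (x - x') ^ 2 + 3 * (t - t') ^ 2 := by
  nlinarith [sq_nonneg ((x - t) + (x - x')), sq_nonneg ((x - t) - (t - t')),
    sq_nonneg ((x - x') + (t - t'))]

theorem sqDistPair_le_three {x x' t₁ t₁' t₂ t₂' η : ℝ} (h1 : |t₁ - t₁'| ≤ η)
    (h2 : |t₂ - t₂'| ≤ η) :
    sqDistPair t₁' t₂' x' ≤ 3 * sqDistPair t₁ t₂ x + 3 * (x - x') ^ 2 + 3 * η ^ 2 := by
  have e1 : (t₁ - t₁') ^ 2 ≤ η ^ 2 := by rw [← sq_abs]; gcongr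
  have e2 : (t₂ - t₂') ^ 2 ≤ η ^ 2 := by rw [← sq_abs]; gcongr
  have f1 := sub_sq_le_three x x' t₁ t₁'
  have f2 := sub_sq_le_three x x' t₂ t₂'
  unfold sqDistPair
  rcases min_cases ((x - t₁) ^ 2) ((x - t₂) ^ 2) with hc | hc
  · rw [hc.1]; exact (min_le_left _ _).trans (by linarith)
  · rw [hc.1]; exact (min_le_right _ _).trans (by linarith)

theorem min_sqDistPair_le_of_near {x x' t₁ t₂ s₁ s₂ T M η : ℝ} (hT : 0 < T) (hM : 0 < M)
    (h1 : |clampTo T t₁ - s₁| ≤ η) (h2 : |clampTo T t₂ - s₂| ≤ η) :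
    min (sqDistPair s₁ s₂ x') M ≤
      3 * sqDistPair t₁ t₂ x + 3 * (x - x') ^ 2 + 3 * η ^ 2 + M / T ^ 2 * x ^ 2 := by
  have h0 := sqDistPair_nonneg t₁ t₂ x
  rcases le_or_gt |x| T with hx | hx
  · have hpair := sqDistPair_le_three (x := x) (x' := x') h1 h2
    have hclamp := sqDistPair_clampTo_le hx t₁ t₂
    have : 0 ≤ M / T ^ 2 * x ^ 2 := by positivity
    exact (min_le_left _ _).trans (by linarith)
  · have hlarge : M ≤ M / T ^ 2 * x ^ 2 := by
      rw [div_mul_eq_mul_div, le_div_iff₀ (by positivity), ← sq_abs x]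
      gcongr
    have : 0 ≤ 3 * (x - x') ^ 2 + 3 * η ^ 2 := by positivity
    exact (min_le_right _ _).trans (by linarith)

theorem le_sum_sqDistPair_of_net {y : Fin m → Fin K} {z : Fin m → EucSp d} {A M C T η : ℝ}
    (hT : 0 < T) (hM : 0 < M) (hC0 : 0 ≤ C)
    (hC : ∀ b : EucSp d, ∑ i, inner ℝ b (z i) ^ 2 ≤ C * m * ‖b‖ ^ 2)
    {N : Finset (EucSp d)} (hN : ∀ x : EucSp d, ‖x‖ = 1 → ∃ c ∈ N, ‖x - c‖ ≤ η)
    {F : Finset ℝ} (hF : ∀ t : ℝ, |t| ≤ T → ∃ t' ∈ F, |t - t'| ≤ η) (k : Fin K)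
    (hnet : ∀ c ∈ N, ∀ t₁ ∈ F, ∀ t₂ ∈ F,
      A * m ≤ ∑ i with y i = k, min (sqDistPair t₁ t₂ (inner ℝ c (z i))) M)
    (hparam : 3 * (C + 1) * η ^ 2 + M * C / T ^ 2 ≤ A / 2)
    {e : EucSp d} (he : ‖e‖ = 1) (t₁ t₂ : ℝ) :
    A / 6 * m ≤ ∑ i with y i = k, sqDistPair t₁ t₂ (inner ℝ e (z i)) := by
  obtain ⟨c, hcN, hec⟩ := hN e he
  obtain ⟨s₁, hs₁, hts₁⟩ := hF _ (abs_clampTo_le hT.le t₁)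
  obtain ⟨s₂, hs₂, hts₂⟩ := hF _ (abs_clampTo_le hT.le t₂)
  set err : Fin m → ℝ := fun i =>
    3 * inner ℝ (e - c) (z i) ^ 2 + 3 * η ^ 2 + M / T ^ 2 * inner ℝ e (z i) ^ 2
  have herr0 : ∀ i, 0 ≤ err i := fun i => by positivity
  have hpt : ∀ i, min (sqDistPair s₁ s₂ (inner ℝ c (z i))) M ≤
      3 * sqDistPair t₁ t₂ (inner ℝ e (z i)) + err i := fun i => by
    have h := min_sqDistPair_le_of_near (x := inner ℝ e (z i)) (x' := inner ℝ c (z i)) hT hM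
      hts₁ hts₂
    simp only [err, inner_sub_left]
    linarith
  have herr : ∑ i with y i = k, err i ≤ A / 2 * m := by
    calc ∑ i with y i = k, err i ≤ ∑ i, err i :=
          Finset.sum_le_sum_of_subset_of_nonneg (Finset.filter_subset _ _) fun i _ _ => herr0 i
      _ = 3 * ∑ i, inner ℝ (e - c) (z i) ^ 2 + 3 * η ^ 2 * m +
          M / T ^ 2 * ∑ i, inner ℝ e (z i) ^ 2 := by
          simp only [err, Finset.sum_add_distrib, ← Finset.mul_sum]
          simp
          ring
      _ ≤ 3 * (C * m * η ^ 2) + 3 * η ^ 2 * m + M / T ^ 2 * (C * m * 1 ^ 2) := by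
          gcongr
          · exact (hC _).trans (by gcongr)
          · exact he ▸ hC e
      _ = (3 * (C + 1) * η ^ 2 + M * C / T ^ 2) * m := by ring
      _ ≤ _ := by gcongr
  have hsum := (hnet c hcN s₁ hs₁ s₂ hs₂).trans (Finset.sum_le_sum fun i _ => hpt i)
  rw [Finset.sum_add_distrib, ← Finset.mul_sum] at hsum
  linarith

theorem sqDistPair_add_mul {c : ℝ} (hc : 0 < c) (β x : ℝ) :
    sqDistPair 0 1 (β + c * x) = c ^ 2 * sqDistPair (-β / c) ((1 - β) / c) x := by
  unfold sqDistPair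
  rw [mul_min_of_nonneg _ _ (sq_nonneg c), ← mul_pow, ← mul_pow]
  congr 2 <;> field_simp <;> ring

theorem goodSample_of_unit {y : Fin m → Fin K} {z : Fin m → EucSp d} {κ C : ℝ}
    (h1 : ∀ k, κ * m ≤ ((Finset.univ.filter fun i => y i = k).card : ℝ))
    (h2 : ∀ b : EucSp d, ∑ i, inner ℝ b (z i) ^ 2 ≤ C * m * ‖b‖ ^ 2)
    (h3 : ∀ e : EucSp d, ‖e‖ = 1 → ∀ (t₁ t₂ : ℝ) (k : Fin K),
      κ * m ≤ ∑ i with y i = k, sqDistPair t₁ t₂ (inner ℝ e (z i))) :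
    GoodSample κ C y z := by
  refine ⟨h1, h2, fun b β k => ?_⟩
  rcases eq_or_ne b 0 with rfl | hb
  · simp only [norm_zero, ne_eq, OfNat.ofNat_ne_zero, not_false_eq_true, zero_pow, mul_zero]
    exact Finset.sum_nonneg fun i _ => sqDistPair_nonneg _ _ _
  have hb0 : 0 < ‖b‖ := norm_pos_iff.2 hb
  have he : ‖(‖b‖⁻¹ • b)‖ = 1 := norm_smul_inv_norm hb
  have hinner : ∀ i, inner ℝ b (z i) = ‖b‖ * inner ℝ (‖b‖⁻¹ • b) (z i) := fun i => by
    rw [real_inner_smul_left, mul_inv_cancel_left₀ hb0.ne']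
  simp_rw [hinner, sqDistPair_add_mul hb0]
  rw [← Finset.mul_sum, mul_comm]
  exact mul_le_mul_of_nonneg_left (h3 _ he _ _ k) (by positivity)

theorem exists_real_net (T : ℝ) {η : ℝ} (hη : 0 < η) :
    ∃ F : Finset ℝ, ∀ t : ℝ, |t| ≤ T → ∃ t' ∈ F, |t - t'| ≤ η := by
  obtain ⟨s, -, hfin, hcover⟩ := (isCompact_Icc (a := -T) (b := T)).finite_cover_balls hη
  refine ⟨hfin.toFinset, fun t ht => ?_⟩
  obtain ⟨t', ht', hlt⟩ := Set.mem_iUnion₂.1 (hcover (abs_le.1 ht))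
  exact ⟨t', hfin.mem_toFinset.2 ht', (Metric.mem_ball.1 hlt).le⟩

/-- The linear map `b ↦ (⟪b, z i⟫)_i`. -/
noncomputable def innerMap (z : Fin m → EucSp d) : EucSp d →L[ℝ] EuclideanSpace ℝ (Fin m) :=
  (PiLp.continuousLinearEquiv 2 ℝ (fun _ : Fin m => ℝ)).symm.toContinuousLinearMap ∘L
    ContinuousLinearMap.pi fun i => innerSL ℝ (z i)

theorem norm_innerMap_sq (z : Fin m → EucSp d) (b : EucSp d) :
    ‖innerMap z b‖ ^ 2 = ∑ i, inner ℝ b (z i) ^ 2 := by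
  rw [EuclideanSpace.real_norm_sq_eq]
  simp [innerMap, real_inner_comm]

theorem sum_inner_sq_le_of_net {z : Fin m → EucSp d} {C : ℝ} (hC : 0 ≤ C)
    {N : Finset (EucSp d)} (hN : ∀ x : EucSp d, ‖x‖ = 1 → ∃ c ∈ N, ‖x - c‖ ≤ 1 / 2)
    (hle : ∀ c ∈ N, ∑ i, inner ℝ c (z i) ^ 2 ≤ C * m) (b : EucSp d) :
    ∑ i, inner ℝ b (z i) ^ 2 ≤ 4 * C * m * ‖b‖ ^ 2 := by
  have h := norm_apply_le_of_unit_net (innerMap z) (N := (N : Set (EucSp d))) (B := √(C * m))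
    (Real.sqrt_nonneg _) hN (fun c hc => by
      refine Real.le_sqrt_of_sq_le ?_
      rw [norm_innerMap_sq]; exact hle c hc) b
  rw [← norm_innerMap_sq]
  calc ‖innerMap z b‖ ^ 2 ≤ (2 * √(C * m) * ‖b‖) ^ 2 := by gcongr
    _ = 4 * (√(C * m)) ^ 2 * ‖b‖ ^ 2 := by ring
    _ = _ := by rw [Real.sq_sqrt (by positivity)]; ring

theorem goodSample_of_net {y : Fin m → Fin K} {z : Fin m → EucSp d} {A M C T η κ : ℝ}
    (hT : 0 < T) (hM : 0 < M) (hC0 : 0 ≤ C) (hη : η ≤ 1 / 2)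
    {N : Finset (EucSp d)} (hN : ∀ x : EucSp d, ‖x‖ = 1 → ∃ c ∈ N, ‖x - c‖ ≤ η)
    {F : Finset ℝ} (hF : ∀ t : ℝ, |t| ≤ T → ∃ t' ∈ F, |t - t'| ≤ η)
    (hκ : κ ≤ A / 6) (hparam : 3 * (4 * C + 1) * η ^ 2 + M * (4 * C) / T ^ 2 ≤ A / 2)
    (hsq : ∀ c ∈ N, ∑ i, inner ℝ c (z i) ^ 2 ≤ C * m)
    (hpair : ∀ k, ∀ c ∈ N, ∀ t₁ ∈ F, ∀ t₂ ∈ F,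
      A * m ≤ ∑ i with y i = k, min (sqDistPair t₁ t₂ (inner ℝ c (z i))) M)
    (hcard : ∀ k, κ * m ≤ ((Finset.univ.filter fun i => y i = k).card : ℝ)) :
    GoodSample κ (4 * C) y z := by
  have hmoment := sum_inner_sq_le_of_net hC0 (fun x hx =>
    (hN x hx).imp fun _ ⟨hc, hxc⟩ => ⟨hc, hxc.trans hη⟩) hsq
  refine goodSample_of_unit hcard hmoment fun e he t₁ t₂ k => ?_
  exact (mul_le_mul_of_nonneg_right hκ (by positivity)).trans
    (le_sum_sqDistPair_of_net hT hM (by positivity) hmoment hN hF k (hpair k) hparam he t₁ t₂)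

theorem MixtureModel.natCast_mul_le_one {p : ℝ} {θ : MixtureModel d K}
    (hw : ∀ j, p ≤ θ.weight j) : K * p ≤ 1 := by
  simpa [θ.weight_sum] using Finset.card_nsmul_le_sum Finset.univ θ.weight p fun j _ => hw j

namespace IsNoiseSample

variable {Ω : Type*} [MeasurableSpace Ω] {P : Measure Ω}
  {θ : MixtureModel d K} {y : Fin m → Ω → Fin K} {z : Fin m → Ω → EucSp d} {σ p a M : ℝ}

theorem integral_indicator_mul (hs : IsNoiseSample θ P y z)
    (i : Fin m) (k : Fin K) {f : EucSp d → ℝ} (hf : Measurable f) :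
    ∫ ω, (if y i ω = k then (1 : ℝ) else 0) * f (z i ω) ∂P =
      θ.weight k * ∫ u, f u ∂θ.noise := by
  have h1 := (hs.indep_label_noise i).integral_fun_comp_mul_comp
    (f := fun j : Fin K => if j = k then (1 : ℝ) else 0) (g := f)
    (hs.measurable_label i).aemeasurable (hs.measurable_noise i).aemeasurable
    (measurable_of_countable _).aestronglyMeasurable hf.aestronglyMeasurable
  rw [h1, ← hs.noise_law i,
    integral_map (hs.measurable_noise i).aemeasurable hf.aestronglyMeasurable]
  congr 1
  have hset : MeasurableSet {ω | y i ω = k} := hs.measurable_label i (measurableSet_singleton k)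
  rw [← hs.label_law i k, ← integral_indicator_one hset]
  refine integral_congr_ae (ae_of_all _ fun ω => ?_)
  simp [Set.indicator_apply]

variable [IsProbabilityMeasure P]

theorem measureReal_le_sum_inner_sq (hs : IsNoiseSample θ P y z) (hσ : 0 < σ)
    (hT2 : IsT2 σ θ.noise) {e : EucSp d} (he : ‖e‖ = 1) :
    P.real {ω | 28 * σ ^ 2 * m ≤ ∑ i, inner ℝ e (z i ω) ^ 2} ≤ Real.exp (-5 * m) := by
  have := θ.noise_prob
  set φ : EucSp d → ℝ := fun u => Real.exp ((4 * σ ^ 2)⁻¹ * inner ℝ e u ^ 2)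
  have hφ : Integrable φ θ.noise ∧ ∫ u, φ u ∂θ.noise ≤ 3 := by
    simp only [φ, ← div_eq_inv_mul]
    exact ⟨hT2.integrable_exp_sq hσ (lipschitzWith_one_inner he) (θ.integrable_noise_inner e)
      (θ.integral_noise_inner e), hT2.integral_exp_sq_le hσ (lipschitzWith_one_inner he)
      (θ.integrable_noise_inner e) (θ.integral_noise_inner e)⟩
  have h := measureReal_le_sum_le_exp (P := P) (X := fun i ω => inner ℝ e (z i ω) ^ 2)
    (l := (4 * σ ^ 2)⁻¹) (b := 2)
    (fun i => by have := hs.measurable_noise i; fun_prop)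
    (hs.indep.comp (fun _ q => inner ℝ e q.2 ^ 2) fun _ => by fun_prop) (by positivity)
    (fun i => (hs.noise_law i ▸ hφ.1).comp_measurable (hs.measurable_noise i))
    (fun i => by
      have hint := hφ.2
      rw [← hs.noise_law i, integral_map (hs.measurable_noise i).aemeasurable
        (by fun_prop)] at hint
      exact hint.trans (by linarith [Real.add_one_le_exp 2])) (28 * σ ^ 2)
  rw [Fintype.card_fin] at h
  refine h.trans_eq ?_
  congr 2
  field_simp
  norm_num

theorem measureReal_sum_label_le (hs : IsNoiseSample θ P y z)
    (k : Fin K) (hp : 0 ≤ p) (hw : p ≤ θ.weight k) {f : EucSp d → ℝ} (hf : Measurable f)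
    (hM : 0 < M) (h0 : ∀ u, 0 ≤ f u) (h1 : ∀ u, f u ≤ M) (ha : 0 ≤ a)
    (hfa : a ≤ ∫ u, f u ∂θ.noise) :
    P.real {ω | ∑ i with y i ω = k, f (z i ω) ≤ p * a / 4 * m} ≤
      Real.exp (-(p * a / (4 * M)) * m) := by
  have hmk : Measurable fun j : Fin K => if j = k then (1 : ℝ) else 0 := measurable_of_countable _
  have hmeas : ∀ i, Measurable fun ω => (if y i ω = k then (1 : ℝ) else 0) * f (z i ω) := fun i =>
    (hmk.comp (hs.measurable_label i)).mul (hf.comp (hs.measurable_noise i))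
  have hind : iIndepFun (fun i ω => (if y i ω = k then (1 : ℝ) else 0) * f (z i ω)) P :=
    hs.indep.comp (fun _ q => (if q.1 = k then (1 : ℝ) else 0) * f q.2) fun _ =>
      (hmk.comp measurable_fst).mul (hf.comp measurable_snd)
  have h := measureReal_sum_le_le_exp hmeas hind hM (a := p * a)
    (fun i ω => by have := h0 (z i ω); split_ifs <;> simp [this])
    (fun i ω => by have := h1 (z i ω); split_ifs <;> simp [this, hM.le])
    (fun i => by rw [hs.integral_indicator_mul i k hf]; gcongr; exact hp.trans hw)
  rw [Fintype.card_fin] at h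
  simpa [Finset.sum_filter] using h

theorem measureReal_exists_sum_inner_sq_ge_le (hs : IsNoiseSample θ P y z) (hσ : 0 < σ)
    (hT2 : IsT2 σ θ.noise) {N : Finset (EucSp d)} (hN : ∀ c ∈ N, ‖c‖ = 1) :
    P.real {ω | ∃ c ∈ N, 28 * σ ^ 2 * m ≤ ∑ i, inner ℝ c (z i ω) ^ 2} ≤
      N.card * Real.exp (-5 * m) :=
  measureReal_exists_mem_le fun c hc => hs.measureReal_le_sum_inner_sq hσ hT2 (hN c hc)

theorem measureReal_exists_sum_sqDistPair_le (hs : IsNoiseSample θ P y z) (hp : 0 ≤ p)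
    (hw : ∀ k, p ≤ θ.weight k) {N : Finset (EucSp d)} {F : Finset ℝ} (ha : 0 ≤ a) (hM : 0 < M)
    (hpop : ∀ c ∈ N, ∀ t₁ t₂ : ℝ, a ≤ ∫ u, min (sqDistPair t₁ t₂ (inner ℝ c u)) M ∂θ.noise) :
    P.real {ω | ∃ q ∈ (Finset.univ : Finset (Fin K)) ×ˢ N ×ˢ F ×ˢ F, ∑ i with y i ω = q.1,
        min (sqDistPair q.2.2.1 q.2.2.2 (inner ℝ q.2.1 (z i ω))) M ≤ p * a / 4 * m} ≤
      K * N.card * F.card ^ 2 * Real.exp (-(p * a / (4 * M)) * m) := by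
  refine (measureReal_exists_mem_le (b := Real.exp (-(p * a / (4 * M)) * m))
    fun q hq => ?_).trans_eq (by
    simp only [Finset.card_product, Finset.card_univ, Fintype.card_fin]
    push_cast
    ring)
  simp only [Finset.mem_product, Finset.mem_univ, true_and] at hq
  exact hs.measureReal_sum_label_le q.1 hp (hw _)
    (f := fun u => min (sqDistPair q.2.2.1 q.2.2.2 (inner ℝ q.2.1 u)) M)
    (((continuous_sqDistPair _ _).comp (by fun_prop)).min continuous_const).measurable hM
    (fun u => le_min (sqDistPair_nonneg _ _ _) hM.le) (fun u => min_le_right _ _) ha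
    (hpop _ hq.1 _ _)

theorem measureReal_exists_card_label_le (hs : IsNoiseSample θ P y z) (hp : 0 ≤ p)
    (hw : ∀ k, p ≤ θ.weight k) :
    P.real {ω | ∃ k ∈ (Finset.univ : Finset (Fin K)),
        ((Finset.univ.filter fun i => y i ω = k).card : ℝ) ≤ p / 4 * m} ≤
      K * Real.exp (-(p / 4) * m) := by
  have := θ.noise_prob
  refine (measureReal_exists_mem_le (b := Real.exp (-(p / 4) * m)) fun k _ => ?_).trans_eq
    (by simp)
  simpa using hs.measureReal_sum_label_le k hp (hw k) (f := fun _ => (1 : ℝ)) (M := 1)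
    measurable_const one_pos (fun _ => zero_le_one) (fun _ => le_rfl) zero_le_one (by simp)

theorem measureReal_not_goodSample_le (hs : IsNoiseSample θ P y z) (hσ : 0 < σ)
    (hT2 : IsT2 σ θ.noise) (hp : 0 ≤ p) (hw : ∀ k, p ≤ θ.weight k) (ha : 0 ≤ a) (hM : 0 < M)
    {T η : ℝ} (hT : 0 < T) (hη : η ≤ 1 / 2)
    (hparam : 3 * (4 * (28 * σ ^ 2) + 1) * η ^ 2 + M * (4 * (28 * σ ^ 2)) / T ^ 2 ≤ p * a / 4 / 2)
    {N : Finset (EucSp d)} (hNunit : ∀ c ∈ N, ‖c‖ = 1)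
    (hN : ∀ x : EucSp d, ‖x‖ = 1 → ∃ c ∈ N, ‖x - c‖ ≤ η)
    {F : Finset ℝ} (hF : ∀ t : ℝ, |t| ≤ T → ∃ t' ∈ F, |t - t'| ≤ η)
    (hpop : ∀ c ∈ N, ∀ t₁ t₂ : ℝ, a ≤ ∫ u, min (sqDistPair t₁ t₂ (inner ℝ c u)) M ∂θ.noise) :
    P.real {ω | ¬ GoodSample (min (p * a / 4 / 6) (p / 4)) (4 * (28 * σ ^ 2)) (fun i => y i ω)
        (fun i => z i ω)} ≤
      N.card * Real.exp (-5 * m) + K * N.card * F.card ^ 2 * Real.exp (-(p * a / (4 * M)) * m) +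
        K * Real.exp (-(p / 4) * m) := by
  have hmoment := hs.measureReal_exists_sum_inner_sq_ge_le hσ hT2 hNunit
  have hpairs := hs.measureReal_exists_sum_sqDistPair_le hp hw (F := F) ha hM hpop
  have hsizes := hs.measureReal_exists_card_label_le hp hw
  refine (measureReal_mono fun ω hω => ?_).trans ((measureReal_union_le _ _).trans
    (add_le_add ((measureReal_union_le _ _).trans (add_le_add hmoment hpairs)) hsizes))
  refine by_contra fun hcon => hω ?_
  simp only [Set.mem_union, Set.mem_ofPred_eq, not_or, not_exists, not_and, not_le,
    Finset.mem_product, Finset.mem_univ, true_and, Prod.forall] at hcon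
  obtain ⟨⟨h1, h2⟩, h3⟩ := hcon
  exact goodSample_of_net hT hM (by positivity) hη hN hF (min_le_left _ _) hparam
    (fun c hc => (h1 c hc).le) (fun k c hc s₁ hs₁ s₂ hs₂ => (h2 k c s₁ s₂ ⟨hc, hs₁, hs₂⟩).le)
    fun k => (mul_le_mul_of_nonneg_right (min_le_right _ _) (by positivity)).trans
      (h3 k).le

end IsNoiseSample

open scoped NNReal in
theorem exists_net_parameters {A M C : ℝ} (hA : 0 < A) (hM : 0 < M) (hC : 0 < C) :
    ∃ (T : ℝ) (η : ℝ≥0), 0 < T ∧ 0 < η ∧ (η : ℝ) ≤ 1 / 2 ∧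
      3 * (C + 1) * (η : ℝ) ^ 2 + M * C / T ^ 2 ≤ A / 2 := by
  have hη : 0 < √(A / (12 * (C + 1))) := Real.sqrt_pos.2 (by positivity)
  refine ⟨√(4 * M * C / A), ⟨min (1 / 2) √(A / (12 * (C + 1))), by positivity⟩,
    Real.sqrt_pos.2 (by positivity), NNReal.coe_pos.1 (lt_min one_half_pos hη), min_le_left _ _, ?_⟩
  have hnet : min (1 / 2) √(A / (12 * (C + 1))) ^ 2 ≤ A / (12 * (C + 1)) := by
    calc _ ≤ √(A / (12 * (C + 1))) ^ 2 := by gcongr; exact min_le_right _ _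
      _ = _ := Real.sq_sqrt (by positivity)
  calc _ ≤ 3 * (C + 1) * (A / (12 * (C + 1))) + M * C / √(4 * M * C / A) ^ 2 := by
        gcongr; exact hnet
    _ = A / 2 := by rw [Real.sq_sqrt (by positivity)]; field_simp; norm_num

theorem exists_measureReal_not_goodSample_le {σ p : ℝ} (hσ : 0 < σ) (hp : 0 < p) :
    ∃ κ C B γ : ℝ, 0 < κ ∧ 0 < C ∧ 1 ≤ B ∧ 0 < γ ∧
      ∀ {d K m : ℕ} {Ω : Type*} [MeasurableSpace Ω] {P : Measure Ω} [IsProbabilityMeasure P]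
        {θ : MixtureModel d K} {y : Fin m → Ω → Fin K} {z : Fin m → Ω → EucSp d},
        IsT2 σ θ.noise → (∀ j, p ≤ θ.weight j) → IsNoiseSample θ P y z →
        P.real {ω | ¬ GoodSample κ C (fun i => y i ω) (fun i => z i ω)} ≤
          B ^ (d + 1) * Real.exp (-γ * m) := by
  obtain ⟨a, M, ha, hM, hpop⟩ := exists_le_integral_min_sqDistPair hσ
  set C : ℝ := 28 * σ ^ 2
  have hC : 0 < C := by positivity
  obtain ⟨T, η, hT, hη, hη2, hparam⟩ := exists_net_parameters (A := p * a / 4) (C := 4 * C)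
    (by positivity) hM (by positivity)
  obtain ⟨F, hF⟩ := exists_real_net T (NNReal.coe_pos.2 hη)
  set γ : ℝ := min 5 (min (p * a / (4 * M)) (p / 4))
  set G : ℝ := 1 + (F.card ^ 2 + 1) / p
  set D : ℝ := 1 + 2 / η
  have hG : 1 ≤ G := le_add_of_nonneg_right (by positivity)
  have hD : 1 ≤ D := le_add_of_nonneg_right (by positivity)
  refine ⟨min (p * a / 4 / 6) (p / 4), 4 * C, D * G, γ, by positivity, by positivity,
    one_le_mul_of_one_le_of_one_le hD hG, by positivity, ?_⟩
  intro d K m Ω _ P _ θ y z hT2 hw hs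
  have := θ.noise_prob
  obtain ⟨N, hNcard, hNunit, hN⟩ := exists_finset_net hη
    (Metric.sphere_subset_closedBall (x := (0 : EucSp d)))
  rw [finrank_euclideanSpace_fin] at hNcard
  have hNunit : ∀ c ∈ N, ‖c‖ = 1 := fun c hc => mem_sphere_zero_iff_norm.1 (hNunit hc)
  have hbad := hs.measureReal_not_goodSample_le hσ hT2 hp.le hw ha.le hM hT hη2 hparam hNunit
    (fun x hx => hN x (by simpa using hx)) hF fun c hc =>
      hpop hT2 _ (lipschitzWith_one_inner (hNunit c hc)) (θ.memLp_noise_inner c)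
        (θ.integral_noise_inner c) (by rw [θ.variance_noise_inner, hNunit c hc, one_pow])
  have hK : (K : ℝ) ≤ 1 / p := (le_div_iff₀ hp).2 (MixtureModel.natCast_mul_le_one hw)
  calc _ ≤ _ := hbad
    _ ≤ N.card * Real.exp (-γ * m) + K * N.card * F.card ^ 2 * Real.exp (-γ * m) +
        K * Real.exp (-γ * m) := by
        gcongr
        exacts [min_le_left _ _, (min_le_right _ _).trans (min_le_left _ _),
          (min_le_right _ _).trans (min_le_right _ _)]
    _ ≤ D ^ d * Real.exp (-γ * m) + 1 / p * D ^ d * F.card ^ 2 * Real.exp (-γ * m) +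
        1 / p * D ^ d * Real.exp (-γ * m) := by
        gcongr
        exact hK.trans (le_mul_of_one_le_right (by positivity) (one_le_pow₀ hD))
    _ = D ^ d * G * Real.exp (-γ * m) := by simp only [G]; ring
    _ ≤ (D ^ (d + 1) * G ^ (d + 1)) * Real.exp (-γ * m) := by
        gcongr
        exacts [d.le_succ, le_self_pow₀ hG d.succ_ne_zero]
    _ = _ := by rw [mul_pow]

end GoodSample

section Signal

section SingularValues

open LinearMap Module

variable {E F : Type*} [NormedAddCommGroup E] [InnerProductSpace ℝ E] [FiniteDimensional ℝ E]
  [NormedAddCommGroup F] [InnerProductSpace ℝ F] [FiniteDimensional ℝ F] (T : E →ₗ[ℝ] F)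

theorem singularValues_mul_norm_le {i : ℕ} (hi : finrank ℝ (range T) ≤ i + 1) {v : E}
    (hv : v ∈ (ker T)ᗮ) : T.singularValues i * ‖v‖ ≤ ‖T v‖ := by
  have hS := T.isSymmetric_adjoint_comp_self
  set e := hS.eigenvectorBasis rfl
  have hexpand : ‖T v‖ ^ 2 =
      ∑ j : Fin (finrank ℝ E), T.singularValues j ^ 2 * inner ℝ (e j) v ^ 2 := by
    rw [← real_inner_self_eq_norm_sq, ← adjoint_inner_left, ← comp_apply, ← e.sum_inner_mul_inner]
    refine Finset.sum_congr rfl fun j _ => ?_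
    rw [hS v (e j), hS.apply_eigenvectorBasis rfl j, T.sq_singularValues_fin rfl j]
    simp [real_inner_smul_right, real_inner_comm]
    ring
  have hterm : ∀ j : Fin (finrank ℝ E), T.singularValues i ^ 2 * inner ℝ (e j) v ^ 2 ≤
      T.singularValues j ^ 2 * inner ℝ (e j) v ^ 2 := fun j => by
    rcases le_or_gt (j : ℕ) i with hji | hij
    · gcongr
      · exact T.singularValues_nonneg i
      · exact T.singularValues_antitone hji
    · have hzero : T.singularValues j = 0 :=
        (T.singularValues_eq_zero_iff_le_finrank_range).2 (hi.trans hij)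
      have hker : e j ∈ ker T := by
        rw [LinearMap.mem_ker, ← norm_eq_zero, ← sq_eq_zero_iff, ← real_inner_self_eq_norm_sq,
          ← adjoint_inner_left, ← comp_apply, hS.apply_eigenvectorBasis rfl j,
          ← T.sq_singularValues_fin rfl j, hzero]
        simp
      simp [(ker T).inner_right_of_mem_orthogonal hker hv]
  refine le_of_sq_le_sq ?_ (norm_nonneg _)
  calc (T.singularValues i * ‖v‖) ^ 2 = ∑ j, T.singularValues i ^ 2 * inner ℝ (e j) v ^ 2 := by
        rw [mul_pow, ← e.sum_sq_norm_inner_right v, Finset.mul_sum]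
        simp
    _ ≤ ‖T v‖ ^ 2 := hexpand ▸ Finset.sum_le_sum fun j _ => hterm j

theorem exists_adjoint_eq_of_mul_norm_le {R : ℝ} (hR : 0 ≤ R)
    (hT : ∀ v ∈ (ker T)ᗮ, R * ‖v‖ ≤ ‖T v‖) {c : E} (hc : c ∈ (ker T)ᗮ) :
    ∃ b : F, adjoint T b = c ∧ R * ‖b‖ ≤ ‖c‖ := by
  have hS := T.isSymmetric_adjoint_comp_self
  have hrange : (ker T)ᗮ = range (adjoint T ∘ₗ T) := by
    rw [← ker_adjoint_comp_self, ← hS.orthogonal_range, Submodule.orthogonal_orthogonal]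
  obtain ⟨g₀, hg₀⟩ := hrange ▸ hc
  obtain ⟨k, hk, g, hg, rfl⟩ := (ker T).exists_add_mem_mem_orthogonal g₀
  have hgc : adjoint T (T g) = c := by
    rw [← hg₀, comp_apply, map_add, LinearMap.mem_ker.1 hk, zero_add]
  refine ⟨T g, hgc, ?_⟩
  rcases eq_or_ne (T g) 0 with h0 | h0
  · simp [h0]
  · refine le_of_mul_le_mul_right ?_ (norm_pos_iff.2 h0)
    calc R * ‖T g‖ * ‖T g‖ = R * inner ℝ c g := by
          rw [mul_assoc, ← sq, ← real_inner_self_eq_norm_sq, ← adjoint_inner_left, hgc]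
      _ ≤ R * (‖c‖ * ‖g‖) := by gcongr; exact real_inner_le_norm c g
      _ = ‖c‖ * (R * ‖g‖) := by ring
      _ ≤ ‖c‖ * ‖T g‖ := by gcongr; exact hT g hg

end SingularValues

variable {d K : ℕ}

theorem MixtureModel.sum_weight_smul_center_sub (θ : MixtureModel d K) :
    ∑ k, θ.weight k • (θ.center k - θ.meanCenter) = 0 := by
  simp_rw [smul_sub]
  rw [Finset.sum_sub_distrib, ← Finset.sum_smul, θ.weight_sum, one_smul]
  simp [MixtureModel.meanCenter]

theorem MixtureModel.weight_le_one (θ : MixtureModel d K) (j : Fin K) : θ.weight j ≤ 1 :=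
  θ.weight_sum ▸ Finset.single_le_sum (fun i _ => θ.weight_nonneg i) (Finset.mem_univ j)

theorem MixtureModel.toLpLin_signalMatrix_apply (θ : MixtureModel d K)
    (v : EuclideanSpace ℝ (Fin K)) :
    Matrix.toLpLin 2 2 θ.signalMatrix v = ∑ k, v k •
      Matrix.toEuclideanCLM (𝕜 := ℝ) (invSqrt θ.cov) (θ.center k - θ.meanCenter) := by
  ext a
  simp [Matrix.toLpLin_apply, Matrix.mulVec, dotProduct, MixtureModel.signalMatrix, mul_comm]

theorem MixtureModel.toLpLin_signalMatrix_weight (θ : MixtureModel d K) :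
    Matrix.toLpLin 2 2 θ.signalMatrix (WithLp.toLp 2 θ.weight) = 0 := by
  simp only [θ.toLpLin_signalMatrix_apply, ← map_smul, ← map_sum, θ.sum_weight_smul_center_sub,
    map_zero]

theorem MixtureModel.toLp_weight_ne_zero (θ : MixtureModel d K) :
    (WithLp.toLp 2 θ.weight : EuclideanSpace ℝ (Fin K)) ≠ 0 := fun h => by
  have hzero : θ.weight = 0 := congrArg WithLp.ofLp h
  simpa [hzero] using θ.weight_sum

theorem MixtureModel.SignalStrength.ker_toLpLin_signalMatrix {θ : MixtureModel d K} {R : ℝ}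
    (h : θ.SignalStrength R) :
    LinearMap.ker (Matrix.toLpLin 2 2 θ.signalMatrix) = ℝ ∙ WithLp.toLp 2 θ.weight := by
  set T := Matrix.toLpLin 2 2 θ.signalMatrix
  have hle : ℝ ∙ WithLp.toLp 2 θ.weight ≤ LinearMap.ker T :=
    (Submodule.span_singleton_le_iff_mem _ _).2 θ.toLpLin_signalMatrix_weight
  have hspan : Module.finrank ℝ (ℝ ∙ WithLp.toLp 2 θ.weight) = 1 :=
    finrank_span_singleton θ.toLp_weight_ne_zero
  have hrank := (T.singularValues_pos_iff_lt_finrank_range).1 (h.2.1.trans_le h.2.2)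
  have hnullity := T.finrank_range_add_finrank_ker
  have hmono := Submodule.finrank_mono hle
  rw [finrank_euclideanSpace_fin] at hnullity
  exact (Submodule.eq_of_le_of_finrank_le hle (by omega)).symm

theorem MixtureModel.SignalStrength.finrank_range_add_one {θ : MixtureModel d K} {R : ℝ}
    (h : θ.SignalStrength R) :
    Module.finrank ℝ (LinearMap.range (Matrix.toLpLin 2 2 θ.signalMatrix)) + 1 = K := by
  have hnullity := (Matrix.toLpLin 2 2 θ.signalMatrix).finrank_range_add_finrank_ker
  rwa [h.ker_toLpLin_signalMatrix, finrank_span_singleton θ.toLp_weight_ne_zero,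
    finrank_euclideanSpace_fin] at hnullity

theorem MixtureModel.SignalStrength.mul_norm_le {θ : MixtureModel d K} {R : ℝ}
    (h : θ.SignalStrength R) {v : EuclideanSpace ℝ (Fin K)}
    (hv : v ∈ (LinearMap.ker (Matrix.toLpLin 2 2 θ.signalMatrix))ᗮ) :
    R * ‖v‖ ≤ ‖Matrix.toLpLin 2 2 θ.signalMatrix v‖ :=
  (mul_le_mul_of_nonneg_right h.2.2 (norm_nonneg v)).trans
    (singularValues_mul_norm_le _ (by have := h.finrank_range_add_one; omega) hv)

theorem MixtureModel.toLp_ite_sub_weight_mem_orthogonal (θ : MixtureModel d K) (j : Fin K) :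
    (WithLp.toLp 2 fun k => (if k = j then 1 else 0) - θ.weight j) ∈
      (ℝ ∙ (WithLp.toLp 2 θ.weight : EuclideanSpace ℝ (Fin K)))ᗮ := by
  rw [Submodule.mem_orthogonal_singleton_iff_inner_right, PiLp.inner_apply]
  simp [sub_mul, Finset.sum_sub_distrib, ← Finset.mul_sum, θ.weight_sum]

theorem MixtureModel.norm_toLp_ite_sub_weight_sq_le (θ : MixtureModel d K) (j : Fin K) :
    ‖(WithLp.toLp 2 fun k => (if k = j then 1 else 0) - θ.weight j :
      EuclideanSpace ℝ (Fin K))‖ ^ 2 ≤ K := by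
  rw [EuclideanSpace.real_norm_sq_eq]
  have h0 := θ.weight_nonneg j
  have h1 := θ.weight_le_one j
  calc ∑ k, ((if k = j then 1 else 0) - θ.weight j) ^ 2 ≤ ∑ _k : Fin K, (1 : ℝ) :=
        Finset.sum_le_sum fun k _ => by split_ifs <;> nlinarith
    _ = K := by simp

theorem MixtureModel.SignalStrength.exists_affine {θ : MixtureModel d K} {R : ℝ}
    (h : θ.SignalStrength R) (j : Fin K) :
    ∃ (α : ℝ) (b : EucSp d), (∀ k, α + inner ℝ b
        (Matrix.toEuclideanCLM (𝕜 := ℝ) (invSqrt θ.cov) (θ.center k - θ.meanCenter)) =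
        if k = j then 1 else 0) ∧ R ^ 2 * ‖b‖ ^ 2 ≤ K := by
  set T := Matrix.toLpLin 2 2 θ.signalMatrix
  set c : EuclideanSpace ℝ (Fin K) :=
    WithLp.toLp 2 fun k => (if k = j then 1 else 0) - θ.weight j
  obtain ⟨b, hb, hbc⟩ := exists_adjoint_eq_of_mul_norm_le T h.2.1.le (fun v hv => h.mul_norm_le hv)
    (h.ker_toLpLin_signalMatrix ▸ θ.toLp_ite_sub_weight_mem_orthogonal j)
  refine ⟨θ.weight j, b, fun k => ?_, ?_⟩
  · have hTk : T (EuclideanSpace.single k 1) =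
        Matrix.toEuclideanCLM (𝕜 := ℝ) (invSqrt θ.cov) (θ.center k - θ.meanCenter) := by
      simp [T, θ.toLpLin_signalMatrix_apply]
    rw [← hTk, ← LinearMap.adjoint_inner_left, hb, EuclideanSpace.inner_single_right]
    simp
  · rw [← mul_pow]
    exact (pow_le_pow_left₀ (mul_nonneg h.2.1.le (norm_nonneg b)) hbc 2).trans
      (θ.norm_toLp_ite_sub_weight_sq_le j)

end Signal

section Whitening

variable {d m : ℕ}

theorem sqrt_isHermitian (A : Matrix (Fin d) (Fin d) ℝ) : (CFC.sqrt A).IsHermitian :=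
  (Matrix.nonneg_iff_posSemidef.1 (CFC.sqrt_nonneg A)).isHermitian

theorem invSqrt_isHermitian (A : Matrix (Fin d) (Fin d) ℝ) : (invSqrt A).IsHermitian :=
  (sqrt_isHermitian A).inv

theorem sqrt_mul_sqrt {A : Matrix (Fin d) (Fin d) ℝ} (hA : A.PosSemidef) :
    CFC.sqrt A * CFC.sqrt A = A :=
  CFC.sqrt_mul_sqrt_self A (Matrix.nonneg_iff_posSemidef.2 hA)

theorem isUnit_det_sqrt {A : Matrix (Fin d) (Fin d) ℝ} (hA : A.PosDef) :
    IsUnit (CFC.sqrt A).det := by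
  have h1 : (CFC.sqrt A).det * (CFC.sqrt A).det = A.det := by
    rw [← Matrix.det_mul, sqrt_mul_sqrt hA.posSemidef]
  refine isUnit_iff_ne_zero.2 fun h0 => ?_
  rw [h0, mul_zero] at h1
  exact hA.det_pos.ne h1

theorem invSqrt_mul_sqrt {A : Matrix (Fin d) (Fin d) ℝ} (hA : A.PosDef) :
    invSqrt A * CFC.sqrt A = 1 :=
  Matrix.nonsing_inv_mul _ (isUnit_det_sqrt hA)

theorem sqrt_mul_invSqrt {A : Matrix (Fin d) (Fin d) ℝ} (hA : A.PosDef) :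
    CFC.sqrt A * invSqrt A = 1 :=
  Matrix.mul_nonsing_inv _ (isUnit_det_sqrt hA)

theorem inner_toEuclideanCLM_left {A : Matrix (Fin d) (Fin d) ℝ} (hA : A.IsHermitian)
    (u v : EucSp d) :
    inner ℝ (Matrix.toEuclideanCLM (𝕜 := ℝ) A u) v =
      inner ℝ u (Matrix.toEuclideanCLM (𝕜 := ℝ) A v) := by
  have h : star (Matrix.toEuclideanCLM (𝕜 := ℝ) A) = Matrix.toEuclideanCLM (𝕜 := ℝ) A := by
    rw [← map_star]; congr 1
  rw [← ContinuousLinearMap.adjoint_inner_right, ← ContinuousLinearMap.star_eq_adjoint, h]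

theorem toEuclideanCLM_mul_apply (A B : Matrix (Fin d) (Fin d) ℝ) (u : EucSp d) :
    Matrix.toEuclideanCLM (𝕜 := ℝ) (A * B) u =
      Matrix.toEuclideanCLM (𝕜 := ℝ) A (Matrix.toEuclideanCLM (𝕜 := ℝ) B u) := by
  rw [map_mul]; rfl

theorem toEuclideanCLM_one_apply (u : EucSp d) :
    Matrix.toEuclideanCLM (𝕜 := ℝ) (1 : Matrix (Fin d) (Fin d) ℝ) u = u := by
  rw [map_one]; rfl

variable (x : Fin m → EucSp d)

theorem sampleCov_apply (a c : Fin d) : sampleCov x a c =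
    (m : ℝ)⁻¹ * ∑ i, (x i - sampleMean x) a * (x i - sampleMean x) c := rfl

theorem inner_sampleCov (u v : EucSp d) :
    inner ℝ u (Matrix.toEuclideanCLM (𝕜 := ℝ) (sampleCov x) v) =
      (m : ℝ)⁻¹ * ∑ i, inner ℝ u (x i - sampleMean x) * inner ℝ v (x i - sampleMean x) := by
  have hinner : ∀ u v : EucSp d, inner ℝ u v = ∑ a, u a * v a := fun u v => by
    simp [PiLp.inner_apply, mul_comm]
  have hprod : ∀ i, inner ℝ u (x i - sampleMean x) * inner ℝ v (x i - sampleMean x) =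
      ∑ a, ∑ c, u a * v c * ((x i - sampleMean x) a * (x i - sampleMean x) c) := fun i => by
    rw [hinner, hinner, Finset.sum_mul_sum]
    exact Finset.sum_congr rfl fun a _ => Finset.sum_congr rfl fun c _ => by ring
  have happly : ∀ a, Matrix.toEuclideanCLM (𝕜 := ℝ) (sampleCov x) v a =
      ∑ c, sampleCov x a c * v c := fun a => by simp [Matrix.mulVec, dotProduct]
  simp_rw [hprod]
  rw [Finset.sum_comm, hinner, Finset.mul_sum]
  refine Finset.sum_congr rfl fun a _ => ?_
  rw [happly, Finset.sum_comm, Finset.mul_sum, Finset.mul_sum]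
  refine Finset.sum_congr rfl fun c _ => ?_
  rw [sampleCov_apply, ← Finset.mul_sum]
  ring

theorem sampleCov_isHermitian : (sampleCov x).IsHermitian := by
  ext a b
  simp [sampleCov, mul_comm]

theorem dotProduct_sampleCov_mulVec (v : Fin d → ℝ) : star v ⬝ᵥ (sampleCov x).mulVec v =
    (m : ℝ)⁻¹ * ∑ i, inner ℝ (WithLp.toLp 2 v) (x i - sampleMean x) *
      inner ℝ (WithLp.toLp 2 v) (x i - sampleMean x) := by
  rw [← inner_sampleCov]
  simp [PiLp.inner_apply, dotProduct, mul_comm]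

theorem sampleCov_posSemidef : (sampleCov x).PosSemidef :=
  Matrix.PosSemidef.of_dotProduct_mulVec_nonneg (sampleCov_isHermitian x) fun v => by
    rw [dotProduct_sampleCov_mulVec]
    exact mul_nonneg (by positivity) (Finset.sum_nonneg fun i _ => mul_self_nonneg _)

theorem sampleCov_posDef (hm : 0 < m)
    (h : ∀ b : EucSp d, (∀ i, inner ℝ b (x i - sampleMean x) = 0) → b = 0) :
    (sampleCov x).PosDef := by
  refine Matrix.PosDef.of_dotProduct_mulVec_pos (sampleCov_isHermitian x) fun {v} hv => ?_
  set b : EucSp d := WithLp.toLp 2 v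
  have hnonneg : ∀ i ∈ Finset.univ,
      0 ≤ inner ℝ b (x i - sampleMean x) * inner ℝ b (x i - sampleMean x) :=
    fun i _ => mul_self_nonneg _
  rw [dotProduct_sampleCov_mulVec]
  refine mul_pos (by positivity) ((Finset.sum_nonneg hnonneg).lt_of_ne' fun hsum => hv ?_)
  have hzero := (Finset.sum_eq_zero_iff_of_nonneg hnonneg).1 hsum
  exact congrArg WithLp.ofLp (h b fun i => mul_self_eq_zero.1 (hzero i (Finset.mem_univ i)))

theorem sum_sub_sampleMean (hm : 0 < m) : ∑ i, (x i - sampleMean x) = 0 := by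
  have hm' : (m : ℝ) ≠ 0 := by positivity
  rw [Finset.sum_sub_distrib, sampleMean]
  simp only [Finset.sum_const, Finset.card_univ, Fintype.card_fin]
  rw [← Nat.cast_smul_eq_nsmul ℝ, smul_smul, mul_inv_cancel₀ hm', one_smul, sub_self]

theorem sum_whiten (hm : 0 < m) : ∑ i, whiten x (x i) = 0 := by
  simp only [whiten]
  rw [← map_sum, sum_sub_sampleMean x hm, map_zero]

theorem sum_inner_whiten_sq (hm : 0 < m) (hx : (sampleCov x).PosDef) (e : EucSp d) :
    ∑ i, (inner ℝ e (whiten x (x i))) ^ 2 = m * ‖e‖ ^ 2 := by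
  have hm' : (m : ℝ) ≠ 0 := by positivity
  set W := Matrix.toEuclideanCLM (𝕜 := ℝ) (invSqrt (sampleCov x)) with hW
  have hcov : invSqrt (sampleCov x) * sampleCov x * invSqrt (sampleCov x) = 1 := by
    conv_lhs => enter [1, 2]; rw [← sqrt_mul_sqrt hx.posSemidef]
    rw [← Matrix.mul_assoc, invSqrt_mul_sqrt hx, Matrix.one_mul, sqrt_mul_invSqrt hx]
  have hquad : inner ℝ (W e) (Matrix.toEuclideanCLM (𝕜 := ℝ) (sampleCov x) (W e)) = ‖e‖ ^ 2 := by
    rw [hW, inner_toEuclideanCLM_left (invSqrt_isHermitian _), ← toEuclideanCLM_mul_apply,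
      ← toEuclideanCLM_mul_apply, hcov, toEuclideanCLM_one_apply,
      real_inner_self_eq_norm_sq]
  have hwhiten : ∀ i, inner ℝ (W e) (x i - sampleMean x) = inner ℝ e (whiten x (x i)) := fun i =>
    inner_toEuclideanCLM_left (invSqrt_isHermitian _) _ _
  rw [← hquad, inner_sampleCov, mul_inv_cancel_left₀ hm']
  simp_rw [hwhiten, ← sq]

theorem exists_inner_whiten (hx : (sampleCov x).PosDef) (b : EucSp d) :
    ∃ b' : EucSp d, ∀ u, inner ℝ b (u - sampleMean x) = inner ℝ b' (whiten x u) :=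
  ⟨Matrix.toEuclideanCLM (𝕜 := ℝ) (CFC.sqrt (sampleCov x)) b, fun u => by
    rw [inner_toEuclideanCLM_left (sqrt_isHermitian _), whiten, ← toEuclideanCLM_mul_apply,
      sqrt_mul_invSqrt hx, toEuclideanCLM_one_apply]⟩

end Whitening

section KMeans

variable {d K m : ℕ}

/-- The number of points with label `j`. -/
def clusterSize (s : Fin m → Fin K) (j : Fin K) : ℕ := (Finset.univ.filter fun i => s i = j).card

/-- The least-squares affine predictor of the indicator of the cluster `j` on isotropic points. -/
noncomputable def clusterScore (w : Fin m → EucSp d) (s : Fin m → Fin K) (j : Fin K) (u : EucSp d) :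
    ℝ :=
  clusterSize s j / m * (1 + inner ℝ (clusterMean w s j) u)

/-- The residual sum of squares of `clusterScore`. -/
noncomputable def clusterRss (w : Fin m → EucSp d) (s : Fin m → Fin K) (j : Fin K) : ℝ :=
  ∑ i, ((if s i = j then 1 else 0) - clusterScore w s j (w i)) ^ 2

/-- The relative residual `1 - (n_j / m) (1 + ‖c_j‖²)` of the cluster `j`, whose sum over `j` is the
`k`-means loss up to an affine change of scale. -/
noncomputable def clusterDefect (w : Fin m → EucSp d) (s : Fin m → Fin K) (j : Fin K) : ℝ :=
  1 - clusterSize s j / m * (1 + ‖clusterMean w s j‖ ^ 2)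

/-- The points `w i` have mean zero and identity covariance matrix, as whitened points do. -/
structure IsIsotropic (w : Fin m → EucSp d) : Prop where
  sum_eq_zero : ∑ i, w i = 0
  sum_inner_sq : ∀ e : EucSp d, ∑ i, (inner ℝ e (w i)) ^ 2 = m * ‖e‖ ^ 2

theorem isIsotropic_whiten {x : Fin m → EucSp d} (hm : 0 < m) (hx : (sampleCov x).PosDef) :
    IsIsotropic fun i => whiten x (x i) :=
  ⟨sum_whiten x hm, sum_inner_whiten_sq x hm hx⟩

theorem clusterSize_le (s : Fin m → Fin K) (j : Fin K) : clusterSize s j ≤ m :=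
  (Finset.card_filter_le _ _).trans_eq (by simp)

theorem sum_clusterSize (s : Fin m → Fin K) : ∑ j, (clusterSize s j : ℝ) = m := by
  have h := Finset.card_eq_sum_card_fiberwise (f := s) (s := Finset.univ) (t := Finset.univ)
    (by intro i _; simp)
  simp only [Finset.card_univ, Fintype.card_fin] at h
  exact_mod_cast h.symm

variable (w : Fin m → EucSp d) (s : Fin m → Fin K)

theorem clusterSize_smul_clusterMean (j : Fin K) :
    (clusterSize s j : ℝ) • clusterMean w s j = ∑ i with s i = j, w i := by
  unfold clusterMean clusterSize
  rcases Finset.eq_empty_or_nonempty (Finset.univ.filter fun i => s i = j) with h | h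
  · simp [h]
  · rw [smul_smul, mul_inv_cancel₀ (by exact_mod_cast h.card_ne_zero), one_smul]

theorem sum_clusterSize_smul_clusterMean :
    ∑ j, (clusterSize s j : ℝ) • clusterMean w s j = ∑ i, w i := by
  simp_rw [clusterSize_smul_clusterMean]
  exact Finset.sum_fiberwise _ _ _

theorem clusterRss_nonneg (j : Fin K) : 0 ≤ clusterRss w s j :=
  Finset.sum_nonneg fun _ _ => sq_nonneg _

theorem sum_norm_sub_clusterMean_sq (j : Fin K) :
    ∑ i with s i = j, ‖w i - clusterMean w s (s i)‖ ^ 2 =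
      ∑ i with s i = j, ‖w i‖ ^ 2 - clusterSize s j * ‖clusterMean w s j‖ ^ 2 := by
  have expand : ∑ i with s i = j, ‖w i - clusterMean w s (s i)‖ ^ 2 = ∑ i with s i = j,
      (‖w i‖ ^ 2 - 2 * inner ℝ (w i) (clusterMean w s j) + ‖clusterMean w s j‖ ^ 2) := by
    refine Finset.sum_congr rfl fun i hi => ?_
    rw [(Finset.mem_filter.1 hi).2, norm_sub_sq_real]
  rw [expand, Finset.sum_add_distrib, Finset.sum_sub_distrib, ← Finset.mul_sum, ← sum_inner,
    ← clusterSize_smul_clusterMean, real_inner_smul_left, real_inner_self_eq_norm_sq,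
    Finset.sum_const, nsmul_eq_mul, ← clusterSize]
  ring

theorem mul_sum_clusterDefect (hm : 0 < m) : (m : ℝ) * ∑ j, clusterDefect w s j =
    m * (K - 1) - ∑ j, clusterSize s j * ‖clusterMean w s j‖ ^ 2 := by
  have hm' : (m : ℝ) ≠ 0 := by positivity
  have hdefect (j : Fin K) : (m : ℝ) * clusterDefect w s j =
      m - (clusterSize s j + clusterSize s j * ‖clusterMean w s j‖ ^ 2) := by
    rw [clusterDefect]
    field_simp
  simp_rw [Finset.mul_sum, hdefect]
  rw [Finset.sum_sub_distrib, Finset.sum_add_distrib, sum_clusterSize, Finset.sum_const,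
    Finset.card_univ, Fintype.card_fin, nsmul_eq_mul]
  ring

theorem kmeansLoss_eq (hm : 0 < m) :
    kmeansLoss w s = ∑ i, ‖w i‖ ^ 2 - m * (K - 1) + m * ∑ j, clusterDefect w s j := by
  rw [mul_sum_clusterDefect w s hm, kmeansLoss, ← Finset.sum_fiberwise _ s]
  simp_rw [sum_norm_sub_clusterMean_sq]
  rw [Finset.sum_sub_distrib, Finset.sum_fiberwise]
  ring

variable {w s}

theorem clusterSize_pos_of_clusterDefect_lt_one {j : Fin K} (h : clusterDefect w s j < 1) :
    0 < clusterSize s j := by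
  refine Nat.pos_of_ne_zero fun h0 => ?_
  simp [clusterDefect, h0] at h

theorem IsIsotropic.sum_indicator_sub_affine_sq (hw : IsIsotropic w) (j : Fin K) (α : ℝ)
    (b : EucSp d) :
    ∑ i, ((if s i = j then (1 : ℝ) else 0) - (α + inner ℝ b (w i))) ^ 2 =
      clusterSize s j - 2 * clusterSize s j * (α + inner ℝ b (clusterMean w s j)) +
        m * (α ^ 2 + ‖b‖ ^ 2) := by
  have expand (i : Fin m) : ((if s i = j then (1 : ℝ) else 0) - (α + inner ℝ b (w i))) ^ 2 =
      (if s i = j then (1 - 2 * (α + inner ℝ b (w i))) else 0) +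
        (α ^ 2 + 2 * α * inner ℝ b (w i) + (inner ℝ b (w i)) ^ 2) := by
    split_ifs <;> ring
  have sum_inner_eq : ∑ i, inner ℝ b (w i) = 0 := by
    rw [← inner_sum, hw.sum_eq_zero, inner_zero_right]
  have cluster_sum : ∑ i with s i = j, inner ℝ b (w i) =
      clusterSize s j * inner ℝ b (clusterMean w s j) := by
    rw [← inner_sum, ← clusterSize_smul_clusterMean, real_inner_smul_right]
  simp_rw [expand]
  rw [Finset.sum_add_distrib, Finset.sum_add_distrib, Finset.sum_add_distrib, ← Finset.mul_sum,
    sum_inner_eq, hw.sum_inner_sq b, ← Finset.sum_filter, Finset.sum_sub_distrib, ← Finset.mul_sum,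
    Finset.sum_add_distrib, cluster_sum]
  simp only [Finset.sum_const, nsmul_eq_mul, Finset.card_univ, Fintype.card_fin, mul_one]
  rw [← clusterSize]
  ring

theorem IsIsotropic.clusterRss_eq (hw : IsIsotropic w) (hm : 0 < m) (j : Fin K) :
    clusterRss w s j = clusterSize s j * clusterDefect w s j := by
  have hm' : (m : ℝ) ≠ 0 := by positivity
  have score_eq (i : Fin m) : clusterScore w s j (w i) = clusterSize s j / m +
      inner ℝ ((clusterSize s j / m : ℝ) • clusterMean w s j) (w i) := by
    rw [clusterScore, real_inner_smul_left]
    ring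
  simp_rw [clusterRss, score_eq]
  rw [hw.sum_indicator_sub_affine_sq, real_inner_smul_left, real_inner_self_eq_norm_sq, norm_smul,
    mul_pow, Real.norm_eq_abs, sq_abs, clusterDefect]
  field_simp
  ring

theorem IsIsotropic.clusterRss_le (hw : IsIsotropic w) (hm : 0 < m) (j : Fin K) (α : ℝ)
    (b : EucSp d) :
    clusterRss w s j ≤ ∑ i, ((if s i = j then (1 : ℝ) else 0) - (α + inner ℝ b (w i))) ^ 2 := by
  have hm' : (m : ℝ) ≠ 0 := by positivity
  rw [hw.clusterRss_eq hm, hw.sum_indicator_sub_affine_sq, clusterDefect]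
  set n : ℝ := (clusterSize s j : ℝ)
  set c := clusterMean w s j
  have norm_sub_sq : ‖b - (n / m) • c‖ ^ 2 =
      ‖b‖ ^ 2 - 2 * (n / m * inner ℝ b c) + (n / m) ^ 2 * ‖c‖ ^ 2 := by
    rw [norm_sub_sq_real, real_inner_smul_right, norm_smul, mul_pow, Real.norm_eq_abs, sq_abs]
  have excess : n - 2 * n * (α + inner ℝ b c) + m * (α ^ 2 + ‖b‖ ^ 2) -
      n * (1 - n / m * (1 + ‖c‖ ^ 2)) = m * ((α - n / m) ^ 2 + ‖b - (n / m) • c‖ ^ 2) := by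
    rw [norm_sub_sq]
    field_simp
    ring
  have excess_nonneg : 0 ≤ m * ((α - n / m) ^ 2 + ‖b - (n / m) • c‖ ^ 2) := by positivity
  linarith

theorem IsIsotropic.clusterDefect_nonneg (hw : IsIsotropic w) (hm : 0 < m) (j : Fin K) :
    0 ≤ clusterDefect w s j := by
  rcases Nat.eq_zero_or_pos (clusterSize s j) with h | h
  · simp [clusterDefect, h]
  · have hrss := clusterRss_nonneg w s j
    rw [hw.clusterRss_eq hm] at hrss
    exact nonneg_of_mul_nonneg_right hrss (by exact_mod_cast h)

theorem IsIsotropic.sum_clusterScore (hw : IsIsotropic w) (hm : 0 < m) (u : EucSp d) :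
    ∑ j, clusterScore w s j u = 1 := by
  have score_eq (j : Fin K) : clusterScore w s j u = (m : ℝ)⁻¹ * (clusterSize s j +
      inner ℝ ((clusterSize s j : ℝ) • clusterMean w s j) u) := by
    rw [clusterScore, real_inner_smul_left]
    ring
  simp_rw [score_eq]
  rw [← Finset.mul_sum, Finset.sum_add_distrib, ← sum_inner, sum_clusterSize_smul_clusterMean,
    hw.sum_eq_zero, sum_clusterSize, inner_zero_left, add_zero, inv_mul_cancel₀ (by positivity)]

theorem norm_sub_clusterMean_sq {j : Fin K} (hm : 0 < m) (hj : 0 < clusterSize s j)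
    (u : EucSp d) :
    ‖u - clusterMean w s j‖ ^ 2 = ‖u‖ ^ 2 + 1 +
      m / clusterSize s j * (1 - clusterDefect w s j - 2 * clusterScore w s j u) := by
  have hj' : (clusterSize s j : ℝ) ≠ 0 := by positivity
  rw [norm_sub_sq_real, clusterDefect, clusterScore, real_inner_comm]
  field_simp
  ring

theorem norm_sub_clusterMean_lt {u : EucSp d} {l j : Fin K} (hm : 0 < m)
    (hl : 0 < clusterSize s l) (hj : 0 < clusterSize s j)
    (hql : 0 ≤ clusterDefect w s l) (hqj : clusterDefect w s j ≤ 1 / 4)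
    (hfl : 7 / 8 ≤ clusterScore w s l u) (hfj : clusterScore w s j u ≤ 1 / 8) :
    ‖u - clusterMean w s l‖ < ‖u - clusterMean w s j‖ := by
  refine lt_of_pow_lt_pow_left₀ 2 (norm_nonneg _) ?_
  rw [norm_sub_clusterMean_sq hm hl, norm_sub_clusterMean_sq hm hj]
  have term_l : m / clusterSize s l * (1 - clusterDefect w s l - 2 * clusterScore w s l u) < 0 :=
    mul_neg_of_pos_of_neg (by positivity) (by linarith)
  have term_j : 0 < m / clusterSize s j * (1 - clusterDefect w s j - 2 * clusterScore w s j u) :=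
    mul_pos (by positivity) (by linarith)
  linarith

end KMeans

section NearIndicator

variable {ι : Type*} [Fintype ι] {δ : ℝ}

theorem eq_of_one_sub_le_of_sum_eq_one {a : ι → ℝ} (hδ : Fintype.card ι * δ < 1)
    (hsum : ∑ i, a i = 1) (hlow : ∀ i, -δ ≤ a i) {j j' : ι} (hj : 1 - δ ≤ a j)
    (hj' : 1 - δ ≤ a j') : j = j' := by
  classical
  by_contra hne
  have hpair := Finset.sum_le_univ_sum_of_nonneg (s := {j, j'}) (f := fun i => a i + δ)
    fun i => by linarith [hlow i]
  rw [Finset.sum_pair hne, Finset.sum_add_distrib, hsum, Finset.sum_const, Finset.card_univ,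
    nsmul_eq_mul] at hpair
  linarith

theorem exists_perm_of_near_indicator [DecidableEq ι] {a : ι → ι → ℝ}
    (hδ : Fintype.card ι * δ < 1) (hsum : ∀ k, ∑ j, a j k = 1)
    (ha : ∀ j k, |a j k| ≤ δ ∨ |a j k - 1| ≤ δ) (hex : ∀ j, ∃ k, |a j k - 1| ≤ δ) :
    ∃ τ : Equiv.Perm ι, ∀ j k, |a j k - if j = τ k then 1 else 0| ≤ δ := by
  have hlow (j k : ι) : -δ ≤ a j k := by
    rcases ha j k with h | h <;> linarith [(abs_le.1 h).1]
  have huniq {j j' k : ι} (hj : |a j k - 1| ≤ δ) (hj' : |a j' k - 1| ≤ δ) : j = j' :=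
    eq_of_one_sub_le_of_sum_eq_one hδ (hsum k) (hlow · k) (by linarith [(abs_le.1 hj).1])
      (by linarith [(abs_le.1 hj').1])
  choose g hg using hex
  have hinj : Function.Injective g := fun j j' h => huniq (hg j) (h ▸ hg j')
  set e := Equiv.ofBijective g (Finite.injective_iff_bijective.1 hinj)
  have he (k : ι) : |a (e.symm k) k - 1| ≤ δ := by
    simpa only [show g (e.symm k) = k from e.apply_symm_apply k] using hg (e.symm k)
  refine ⟨e.symm, fun j k => ?_⟩
  split_ifs with hjk
  · exact hjk ▸ he k
  · simpa only [sub_zero] using (ha j k).resolve_right fun h => hjk (huniq h (he k))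

end NearIndicator

section AffineRss

variable {d K m : ℕ}

theorem sqDistPair_indicator_le (q : Prop) [Decidable q] (f : ℝ) :
    sqDistPair 0 1 f ≤ ((if q then 1 else 0) - f) ^ 2 := by
  unfold sqDistPair
  split_ifs
  · exact (min_le_right _ _).trans_eq (by ring)
  · exact (min_le_left _ _).trans_eq (by ring)

theorem sqDistPair_le_two_mul (a t : ℝ) :
    sqDistPair 0 1 a ≤ 2 * sqDistPair 0 1 (a + t) + 2 * t ^ 2 := by
  unfold sqDistPair
  rcases min_cases ((a + t - 0) ^ 2) ((a + t - 1) ^ 2) with ⟨h, -⟩ | ⟨h, -⟩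
  · rw [h]
    exact (min_le_left _ _).trans (by nlinarith [sq_nonneg (a + 2 * t)])
  · rw [h]
    exact (min_le_right _ _).trans (by nlinarith [sq_nonneg (a - 1 + 2 * t)])

theorem abs_le_or_abs_sub_one_le {a δ : ℝ} (hδ : 0 ≤ δ) (h : sqDistPair 0 1 a ≤ δ ^ 2) :
    |a| ≤ δ ∨ |a - 1| ≤ δ := by
  rcases min_le_iff.1 h with h | h
  · exact .inl (abs_le_of_sq_le_sq (by simpa only [sub_zero] using h) hδ)
  · exact .inr (abs_le_of_sq_le_sq h hδ)

theorem sqDistPair_zero_one_of_abs_le {a : ℝ} (h : |a| ≤ 1 / 2) : sqDistPair 0 1 a = a ^ 2 := by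
  rw [sqDistPair, sub_zero, min_eq_left]
  nlinarith [(abs_le.1 h).2]

/-- The residual sum of squares in the prediction of the indicator of the cluster `j` of `s` by a
function which is affine in the noise `z i`, with an intercept depending on the class `y i`. -/
noncomputable def affineRss (y : Fin m → Fin K) (z : Fin m → EucSp d) (s : Fin m → Fin K)
    (j : Fin K) (α : Fin K → ℝ) (b : EucSp d) : ℝ :=
  ∑ i, ((if s i = j then 1 else 0) - (α (y i) + inner ℝ b (z i))) ^ 2

variable (y : Fin m → Fin K) (z : Fin m → EucSp d) (s : Fin m → Fin K) (j : Fin K)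
  (α : Fin K → ℝ) (b : EucSp d)

theorem affineRss_nonneg : 0 ≤ affineRss y z s j α b := Finset.sum_nonneg fun _ _ => sq_nonneg _

theorem sum_sqDistPair_le_affineRss (k : Fin K) :
    ∑ i with y i = k, sqDistPair 0 1 (α k + inner ℝ b (z i)) ≤ affineRss y z s j α b := by
  calc _ = ∑ i with y i = k, sqDistPair 0 1 (α (y i) + inner ℝ b (z i)) :=
        Finset.sum_congr rfl fun i hi => by rw [(Finset.mem_filter.1 hi).2]
    _ ≤ ∑ i, sqDistPair 0 1 (α (y i) + inner ℝ b (z i)) :=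
        Finset.sum_le_sum_of_subset_of_nonneg (Finset.filter_subset _ _)
          fun i _ _ => sqDistPair_nonneg _ _ _
    _ ≤ _ := Finset.sum_le_sum fun i _ => sqDistPair_indicator_le _ _

theorem clusterSize_le_two_mul_affineRss_add :
    (clusterSize s j : ℝ) ≤
      2 * affineRss y z s j α b + 4 * ∑ i, α (y i) ^ 2 + 4 * ∑ i, inner ℝ b (z i) ^ 2 := by
  rw [clusterSize, Finset.card_filter, Nat.cast_sum, affineRss, Finset.mul_sum, Finset.mul_sum,
    Finset.mul_sum, ← Finset.sum_add_distrib, ← Finset.sum_add_distrib]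
  refine Finset.sum_le_sum fun i _ => ?_
  split_ifs
  · push_cast
    nlinarith [sq_nonneg (2 * (α (y i) + inner ℝ b (z i)) - 1),
      sq_nonneg (α (y i) - inner ℝ b (z i))]
  · rw [Nat.cast_zero]
    positivity

variable {y z s} in
theorem hammingDist_le_sum_affineRss {α : Fin K → Fin K → ℝ} {b : Fin K → EucSp d}
    {τ : Equiv.Perm (Fin K)} (hτ : ∀ j k, |α j k - if j = τ k then 1 else 0| ≤ 1 / 16) :
    (hammingDist s (fun i => τ (y i)) : ℝ) ≤
      ∑ j, 4 * (affineRss y z s j (α j) (b j) + ∑ i, inner ℝ (b j) (z i) ^ 2) := by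
  have hpoint (i : Fin m) (hi : s i ≠ τ (y i)) : (1 : ℝ) ≤
      4 * ((1 - (α (s i) (y i) + inner ℝ (b (s i)) (z i))) ^ 2 +
        inner ℝ (b (s i)) (z i) ^ 2) := by
    have hα := hτ (s i) (y i)
    rw [if_neg hi, sub_zero] at hα
    set t := inner ℝ (b (s i)) (z i)
    nlinarith [(abs_le.1 hα).2, sq_nonneg (1 - (α (s i) (y i) + t) - t)]
  simp_rw [affineRss, ← Finset.sum_add_distrib, Finset.mul_sum]
  rw [Finset.sum_comm, hammingDist, Finset.card_filter, Nat.cast_sum]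
  refine Finset.sum_le_sum fun i _ => ?_
  split_ifs with hi
  · rw [Nat.cast_one]
    refine (hpoint i hi).trans ?_
    convert Finset.single_le_sum (f := fun j =>
      4 * (((if s i = j then 1 else 0) - (α j (y i) + inner ℝ (b j) (z i))) ^ 2 +
        inner ℝ (b j) (z i) ^ 2)) (fun j _ => by positivity) (Finset.mem_univ (s i)) using 4
    rw [if_pos rfl]
  · rw [Nat.cast_zero]
    exact Finset.sum_nonneg fun j _ => by positivity

end AffineRss

section GoodSample

variable {d K m : ℕ} {κ C : ℝ} {y : Fin m → Fin K} {z : Fin m → EucSp d}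

theorem GoodSample.natCast_mul_le_one (hG : GoodSample κ C y z) (hm : 0 < m) : K * κ ≤ 1 := by
  have hm' : (0 : ℝ) < m := by positivity
  have hsum : ∑ _k : Fin K, κ * m ≤ ∑ k, (clusterSize y k : ℝ) :=
    Finset.sum_le_sum fun k _ => hG.le_card k
  rw [sum_clusterSize, Finset.sum_const, Finset.card_univ, Fintype.card_fin, nsmul_eq_mul,
    ← mul_assoc] at hsum
  exact le_of_mul_le_mul_right (hsum.trans_eq (one_mul _).symm) hm'

theorem GoodSample.le_one (hκ : 0 < κ) (hG : GoodSample κ C y z) (hm : 0 < m) : κ ≤ 1 := by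
  have hK : (1 : ℝ) ≤ K := by exact_mod_cast (y ⟨0, hm⟩).pos
  exact (le_mul_of_one_le_left hκ.le hK).trans (hG.natCast_mul_le_one hm)

variable (s : Fin m → Fin K) (j : Fin K) (α : Fin K → ℝ) (b : EucSp d)

theorem GoodSample.mul_norm_sq_le_affineRss (hG : GoodSample κ C y z) (hm : 0 < m) :
    κ * m * ‖b‖ ^ 2 ≤ affineRss y z s j α b :=
  (hG.le_sum_sqDistPair b (α (y ⟨0, hm⟩)) _).trans (sum_sqDistPair_le_affineRss y z s j α b _)

theorem GoodSample.mul_sum_inner_sq_le_affineRss (hκ : 0 < κ) (hC : 0 ≤ C)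
    (hG : GoodSample κ C y z) (hm : 0 < m) :
    κ * ∑ i, inner ℝ b (z i) ^ 2 ≤ C * affineRss y z s j α b := by
  calc κ * ∑ i, inner ℝ b (z i) ^ 2 ≤ κ * (C * m * ‖b‖ ^ 2) := by
        gcongr
        exact hG.sum_inner_sq_le b
    _ = C * (κ * m * ‖b‖ ^ 2) := by ring
    _ ≤ _ := by
        gcongr
        exact hG.mul_norm_sq_le_affineRss s j α b hm

theorem GoodSample.mul_sqDistPair_le_affineRss (hκ : 0 < κ) (hC : 0 ≤ C)
    (hG : GoodSample κ C y z) (hm : 0 < m) (k : Fin K) :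
    κ ^ 2 * m * sqDistPair 0 1 (α k) ≤ 2 * (κ + C) * affineRss y z s j α b := by
  have hclass : κ * m * sqDistPair 0 1 (α k) ≤
      2 * affineRss y z s j α b + 2 * ∑ i, inner ℝ b (z i) ^ 2 := by
    calc κ * m * sqDistPair 0 1 (α k)
        ≤ ((Finset.univ.filter fun i => y i = k).card : ℝ) * sqDistPair 0 1 (α k) :=
          mul_le_mul_of_nonneg_right (hG.le_card k) (sqDistPair_nonneg _ _ _)
      _ = ∑ i with y i = k, sqDistPair 0 1 (α k) := by rw [Finset.sum_const, nsmul_eq_mul]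
      _ ≤ ∑ i with y i = k, (2 * sqDistPair 0 1 (α k + inner ℝ b (z i)) +
            2 * inner ℝ b (z i) ^ 2) :=
          Finset.sum_le_sum fun i _ => sqDistPair_le_two_mul _ _
      _ = 2 * ∑ i with y i = k, sqDistPair 0 1 (α k + inner ℝ b (z i)) +
            2 * ∑ i with y i = k, inner ℝ b (z i) ^ 2 := by
          rw [Finset.sum_add_distrib, Finset.mul_sum, Finset.mul_sum]
      _ ≤ _ := by
          gcongr
          · exact sum_sqDistPair_le_affineRss y z s j α b k
          · exact Finset.filter_subset _ _
  calc κ ^ 2 * m * sqDistPair 0 1 (α k) = κ * (κ * m * sqDistPair 0 1 (α k)) := by ring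
    _ ≤ κ * (2 * affineRss y z s j α b + 2 * ∑ i, inner ℝ b (z i) ^ 2) := by gcongr
    _ = 2 * κ * affineRss y z s j α b + 2 * (κ * ∑ i, inner ℝ b (z i) ^ 2) := by ring
    _ ≤ _ := by linarith [hG.mul_sum_inner_sq_le_affineRss s j α b hκ hC hm]

variable {α} in
theorem GoodSample.mul_clusterSize_le_affineRss (hκ : 0 < κ) (hC : 0 ≤ C)
    (hG : GoodSample κ C y z) (hm : 0 < m) (hα : ∀ k, |α k| ≤ 1 / 2) :
    κ ^ 2 * clusterSize s j ≤ 14 * (κ + C) * affineRss y z s j α b := by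
  set ρ := affineRss y z s j α b
  have hρ : 0 ≤ ρ := affineRss_nonneg y z s j α b
  have hκ1 : κ ≤ 1 := hG.le_one hκ hm
  have intercepts : κ ^ 2 * ∑ i, α (y i) ^ 2 ≤ 2 * (κ + C) * ρ := by
    have hterm (i : Fin m) : κ ^ 2 * m * α (y i) ^ 2 ≤ 2 * (κ + C) * ρ := by
      rw [← sqDistPair_zero_one_of_abs_le (hα _)]
      exact hG.mul_sqDistPair_le_affineRss s j α b hκ hC hm _
    have hsum := Finset.sum_le_sum fun i (_ : i ∈ Finset.univ) => hterm i
    rw [← Finset.mul_sum, Finset.sum_const, Finset.card_univ, Fintype.card_fin, nsmul_eq_mul]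
      at hsum
    refine le_of_mul_le_mul_left ?_ (by positivity : (0 : ℝ) < m)
    linarith
  have slopes : κ ^ 2 * ∑ i, inner ℝ b (z i) ^ 2 ≤ C * ρ :=
    calc _ ≤ κ * ∑ i, inner ℝ b (z i) ^ 2 :=
          mul_le_mul_of_nonneg_right (by nlinarith) (Finset.sum_nonneg fun _ _ => sq_nonneg _)
      _ ≤ _ := hG.mul_sum_inner_sq_le_affineRss s j α b hκ hC hm
  have residual : κ ^ 2 * ρ ≤ κ * ρ := by gcongr; nlinarith
  have hsize := mul_le_mul_of_nonneg_left (clusterSize_le_two_mul_affineRss_add y z s j α b)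
    (sq_nonneg κ)
  nlinarith [mul_nonneg hκ.le hρ, mul_nonneg hC hρ]

theorem GoodSample.norm_sq_le (hκ : 0 < κ) (hG : GoodSample κ C y z) (hm : 0 < m) {E : ℝ}
    (hE : 0 ≤ E) (hrss : affineRss y z s j α b ≤ E * clusterSize s j) : ‖b‖ ^ 2 ≤ E / κ := by
  rw [le_div_iff₀ hκ]
  refine le_of_mul_le_mul_left ?_ (by positivity : (0 : ℝ) < m)
  calc m * (‖b‖ ^ 2 * κ) = κ * m * ‖b‖ ^ 2 := by ring
    _ ≤ E * clusterSize s j := (hG.mul_norm_sq_le_affineRss s j α b hm).trans hrss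
    _ ≤ E * m := by
        gcongr
        exact clusterSize_le s j
    _ = m * E := mul_comm _ _

variable {s j α b} in
theorem GoodSample.abs_le_or_abs_sub_one_le (hκ : 0 < κ) (hC : 0 ≤ C) (hG : GoodSample κ C y z)
    (hm : 0 < m) {E : ℝ} (hE : 0 ≤ E) (hsmall : 512 * (κ + C) * E ≤ κ ^ 4)
    (hrss : affineRss y z s j α b ≤ E * clusterSize s j) (k : Fin K) :
    |α k| ≤ κ / 16 ∨ |α k - 1| ≤ κ / 16 := by
  refine _root_.abs_le_or_abs_sub_one_le (by positivity) ?_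
  refine le_of_mul_le_mul_left ?_ (by positivity : (0 : ℝ) < 256 * κ ^ 2 * m)
  have hsize : (clusterSize s j : ℝ) ≤ m := by exact_mod_cast clusterSize_le s j
  calc 256 * κ ^ 2 * m * sqDistPair 0 1 (α k) = 256 * (κ ^ 2 * m * sqDistPair 0 1 (α k)) := by ring
    _ ≤ 256 * (2 * (κ + C) * (E * m)) := by
        have := hG.mul_sqDistPair_le_affineRss s j α b hκ hC hm k
        have : affineRss y z s j α b ≤ E * m := hrss.trans (by gcongr)
        grw [‹κ ^ 2 * m * _ ≤ _›, this]
    _ = 512 * (κ + C) * E * m := by ring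
    _ ≤ κ ^ 4 * m := by gcongr
    _ = 256 * κ ^ 2 * m * (κ / 16) ^ 2 := by ring

theorem GoodSample.exists_abs_sub_one_le (hκ : 0 < κ) (hC : 0 ≤ C) (hG : GoodSample κ C y z)
    (hm : 0 < m) {E : ℝ} (hE : 0 ≤ E) (hsmall : 512 * (κ + C) * E ≤ κ ^ 4)
    (hrss : affineRss y z s j α b ≤ E * clusterSize s j) (hj : 0 < clusterSize s j) :
    ∃ k, |α k - 1| ≤ κ / 16 := by
  by_contra! hfar
  have hκ1 : κ ≤ 1 := hG.le_one hκ hm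
  have hα (k : Fin K) : |α k| ≤ 1 / 2 := by
    linarith [(hG.abs_le_or_abs_sub_one_le hκ hC hm hE hsmall hrss k).resolve_right (hfar k).not_ge]
  have hj' : (0 : ℝ) < clusterSize s j := by exact_mod_cast hj
  have hle : κ ^ 2 * clusterSize s j ≤ 14 * (κ + C) * E * clusterSize s j := by
    calc _ ≤ 14 * (κ + C) * affineRss y z s j α b :=
          hG.mul_clusterSize_le_affineRss s j b hκ hC hm hα
      _ ≤ 14 * (κ + C) * (E * clusterSize s j) := by gcongr
      _ = _ := by ring
  have hpow : κ ^ 4 ≤ κ ^ 2 := pow_le_pow_of_le_one hκ.le hκ1 (by norm_num)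
  nlinarith [le_of_mul_le_mul_right hle hj', sq_pos_of_pos hκ]

variable {s} in
theorem GoodSample.exists_perm (hκ : 0 < κ) (hC : 0 ≤ C) (hG : GoodSample κ C y z) (hm : 0 < m)
    {α : Fin K → Fin K → ℝ} {b : Fin K → EucSp d} {E : ℝ} (hE : 0 ≤ E)
    (hsmall : 512 * (κ + C) * E ≤ κ ^ 4) (hsum : ∀ k, ∑ j, α j k = 1)
    (hsize : ∀ j, 0 < clusterSize s j)
    (hrss : ∀ j, affineRss y z s j (α j) (b j) ≤ E * clusterSize s j) :
    ∃ τ : Equiv.Perm (Fin K), ∀ j k, |α j k - if j = τ k then 1 else 0| ≤ 1 / 16 := by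
  have hKκ := hG.natCast_mul_le_one hm
  obtain ⟨τ, hτ⟩ := exists_perm_of_near_indicator
    (by rw [Fintype.card_fin]; linarith) hsum
    (fun j => hG.abs_le_or_abs_sub_one_le hκ hC hm hE hsmall (hrss j))
    (fun j => hG.exists_abs_sub_one_le s j (α j) (b j) hκ hC hm hE hsmall (hrss j) (hsize j))
  exact ⟨τ, fun j k => (hτ j k).trans (by linarith [hG.le_one hκ hm])⟩

variable {s} in
theorem GoodSample.hammingDist_le (hκ : 0 < κ) (hC : 0 ≤ C) (hG : GoodSample κ C y z) (hm : 0 < m)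
    {α : Fin K → Fin K → ℝ} {b : Fin K → EucSp d} {E : ℝ}
    (hsmall : 512 * (κ + C) * E ≤ κ ^ 4) {τ : Equiv.Perm (Fin K)}
    (hτ : ∀ j k, |α j k - if j = τ k then 1 else 0| ≤ 1 / 16)
    (hrss : ∀ j, affineRss y z s j (α j) (b j) ≤ E * clusterSize s j) :
    (hammingDist s (fun i => τ (y i)) : ℝ) ≤ κ / 4 * m := by
  refine le_of_mul_le_mul_left ?_ hκ
  calc κ * (hammingDist s (fun i => τ (y i)) : ℝ)
      ≤ κ * ∑ j, 4 * (affineRss y z s j (α j) (b j) + ∑ i, inner ℝ (b j) (z i) ^ 2) := by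
        gcongr
        exact hammingDist_le_sum_affineRss hτ
    _ ≤ ∑ j, 4 * (κ + C) * E * clusterSize s j := by
        rw [Finset.mul_sum]
        refine Finset.sum_le_sum fun j _ => ?_
        have hinner := hG.mul_sum_inner_sq_le_affineRss s j (α j) (b j) hκ hC hm
        have := mul_le_mul_of_nonneg_left (hrss j) (by positivity : 0 ≤ 4 * (κ + C))
        linarith
    _ = 4 * (κ + C) * E * m := by rw [← Finset.mul_sum, sum_clusterSize]
    _ ≤ κ ^ 4 / 4 * m := by
        gcongr
        linarith [pow_pos hκ 4]
    _ ≤ κ ^ 2 / 4 * m := by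
        gcongr ?_ / 4 * _
        exact pow_le_pow_of_le_one hκ.le (hG.le_one hκ hm) (by norm_num)
    _ = κ * (κ / 4 * m) := by ring

end GoodSample

section Training

variable {d K m : ℕ} {κ C R : ℝ} {y : Fin m → Fin K} {z : Fin m → EucSp d} {θ : MixtureModel d K}
  {x : Fin m → EucSp d} {s : Fin m → Fin K}

/-- The observation `μ_k + Σ^{1/2} u` of class `k` with noise `u`. -/
noncomputable def MixtureModel.observe (θ : MixtureModel d K) (k : Fin K) (u : EucSp d) : EucSp d :=
  θ.center k + Matrix.toEuclideanCLM (𝕜 := ℝ) (CFC.sqrt θ.cov) u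

/-- The slope of the `j`-th least-squares score, in the coordinates of the noise. -/
noncomputable def MixtureModel.trainedSlope (θ : MixtureModel d K) (x : Fin m → EucSp d)
    (s : Fin m → Fin K) (j : Fin K) : EucSp d :=
  (clusterSize s j / m : ℝ) • Matrix.toEuclideanCLM (𝕜 := ℝ) (CFC.sqrt θ.cov)
    (Matrix.toEuclideanCLM (𝕜 := ℝ) (invSqrt (sampleCov x)) (whitenedCenter x s j))

theorem MixtureModel.clusterScore_whiten_observe (θ : MixtureModel d K) (x : Fin m → EucSp d)
    (s : Fin m → Fin K) (j k : Fin K) (u : EucSp d) :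
    clusterScore (fun i => whiten x (x i)) s j (whiten x (θ.observe k u)) =
      clusterScore (fun i => whiten x (x i)) s j (whiten x (θ.center k)) +
        inner ℝ (θ.trainedSlope x s j) u := by
  have hwhiten : whiten x (θ.observe k u) = whiten x (θ.center k) +
      Matrix.toEuclideanCLM (𝕜 := ℝ) (invSqrt (sampleCov x))
        (Matrix.toEuclideanCLM (𝕜 := ℝ) (CFC.sqrt θ.cov) u) := by
    rw [whiten, whiten, ← map_add, observe, add_sub_right_comm]
  rw [hwhiten, clusterScore, clusterScore, trainedSlope, real_inner_smul_left,
    inner_toEuclideanCLM_left (sqrt_isHermitian _),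
    inner_toEuclideanCLM_left (invSqrt_isHermitian _), inner_add_right, whitenedCenter]
  ring

theorem GoodSample.sampleCov_posDef (hκ : 0 < κ) (hG : GoodSample κ C y z) (hm : 0 < m)
    (hθ : θ.cov.PosDef) (hx : ∀ i, x i = θ.observe (y i) (z i)) : (sampleCov x).PosDef := by
  refine _root_.sampleCov_posDef x hm fun b hb => ?_
  set T := Matrix.toEuclideanCLM (𝕜 := ℝ) (CFC.sqrt θ.cov) with hT
  set k := y ⟨0, hm⟩
  set β : ℝ := inner ℝ b (θ.center k - sampleMean x)
  have hzero : ∑ i with y i = k, sqDistPair 0 1 (β + inner ℝ (T b) (z i)) = 0 := by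
    refine Finset.sum_eq_zero fun i hi => ?_
    have hbi := hb i
    rw [hx i, (Finset.mem_filter.1 hi).2, MixtureModel.observe, add_sub_right_comm, inner_add_right,
      ← inner_toEuclideanCLM_left (sqrt_isHermitian _)] at hbi
    rw [hT, hbi, sqDistPair_zero_one_of_abs_le (by norm_num), zero_pow two_ne_zero]
  have hTb : T b = 0 := by
    by_contra hne
    have hpos : 0 < κ * m * ‖T b‖ ^ 2 := by positivity
    linarith [hG.le_sum_sqDistPair (T b) β k]
  calc b = Matrix.toEuclideanCLM (𝕜 := ℝ) (invSqrt θ.cov) (T b) := by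
        rw [hT, ← toEuclideanCLM_mul_apply, invSqrt_mul_sqrt hθ, toEuclideanCLM_one_apply]
    _ = 0 := by rw [hTb, map_zero]

theorem MixtureModel.SignalStrength.exists_affine_whiten (hθ : θ.SignalStrength R)
    (hx : (sampleCov x).PosDef) (j : Fin K) :
    ∃ (α : ℝ) (b' b : EucSp d), (∀ k u, α + inner ℝ b' (whiten x (θ.observe k u)) =
        (if k = j then 1 else 0) + inner ℝ b u) ∧ R ^ 2 * ‖b‖ ^ 2 ≤ K := by
  obtain ⟨α, b, hval, hb⟩ := hθ.exists_affine j
  set a := Matrix.toEuclideanCLM (𝕜 := ℝ) (invSqrt θ.cov) b with ha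
  obtain ⟨b', hb'⟩ := exists_inner_whiten x hx a
  refine ⟨α + inner ℝ a (sampleMean x - θ.meanCenter), b', b, fun k u => ?_, hb⟩
  have hsub : sampleMean x - θ.meanCenter + (θ.observe k u - sampleMean x) =
      (θ.center k - θ.meanCenter) + Matrix.toEuclideanCLM (𝕜 := ℝ) (CFC.sqrt θ.cov) u := by
    rw [observe]
    abel
  rw [← hb', ← hval k, add_assoc, ← inner_add_right, hsub, ha,
    inner_toEuclideanCLM_left (invSqrt_isHermitian _), map_add, inner_add_right,
    ← toEuclideanCLM_mul_apply, invSqrt_mul_sqrt hθ.1, toEuclideanCLM_one_apply, add_assoc]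

theorem GoodSample.clusterDefect_le (hκ : 0 < κ) (hC : 0 ≤ C) (hG : GoodSample κ C y z) (hm : 0 < m)
    (hθ : θ.SignalStrength R) (hx : ∀ i, x i = θ.observe (y i) (z i)) (j : Fin K) :
    clusterDefect (fun i => whiten x (x i)) y j ≤ C * K / (κ * R ^ 2) := by
  have hm' : (0 : ℝ) < m := by positivity
  have hR : 0 < R := hθ.2.1
  have hcov := hG.sampleCov_posDef hκ hm hθ.1 hx
  have hw := isIsotropic_whiten hm hcov
  obtain ⟨α, b', b, hval, hb⟩ := hθ.exists_affine_whiten hcov j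
  have hrss : clusterRss (fun i => whiten x (x i)) y j ≤ C * m * ‖b‖ ^ 2 := by
    calc _ ≤ ∑ i, inner ℝ b (z i) ^ 2 := by
          refine (hw.clusterRss_le hm j α b').trans_eq (Finset.sum_congr rfl fun i _ => ?_)
          rw [hx i, hval (y i) (z i)]
          ring
      _ ≤ _ := hG.sum_inner_sq_le b
  have hdefect : m * (κ * clusterDefect (fun i => whiten x (x i)) y j) ≤ m * (C * ‖b‖ ^ 2) := by
    calc _ = κ * m * clusterDefect (fun i => whiten x (x i)) y j := by ring
      _ ≤ clusterSize y j * clusterDefect (fun i => whiten x (x i)) y j :=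
          mul_le_mul_of_nonneg_right (hG.le_card j) (hw.clusterDefect_nonneg hm j)
      _ = clusterRss (fun i => whiten x (x i)) y j := (hw.clusterRss_eq hm j).symm
      _ ≤ _ := hrss.trans_eq (by ring)
  rw [le_div_iff₀ (by positivity)]
  calc _ = κ * clusterDefect (fun i => whiten x (x i)) y j * R ^ 2 := by ring
    _ ≤ C * ‖b‖ ^ 2 * R ^ 2 := by
        gcongr ?_ * _
        exact le_of_mul_le_mul_left hdefect hm'
    _ = C * (R ^ 2 * ‖b‖ ^ 2) := by ring
    _ ≤ _ := by gcongr

theorem IsWhitenedKMeans.sum_clusterDefect_le (hs : IsWhitenedKMeans x s) (hm : 0 < m)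
    (s' : Fin m → Fin K) : ∑ j, clusterDefect (fun i => whiten x (x i)) s j ≤
      ∑ j, clusterDefect (fun i => whiten x (x i)) s' j := by
  have hloss := hs s'
  rw [kmeansLoss_eq _ _ hm, kmeansLoss_eq _ _ hm] at hloss
  exact le_of_mul_le_mul_left (by linarith) (by positivity : (0 : ℝ) < m)

theorem IsWhitenedKMeans.clusterDefect_le (hs : IsWhitenedKMeans x s) (hκ : 0 < κ) (hC : 0 ≤ C)
    (hG : GoodSample κ C y z) (hm : 0 < m) (hθ : θ.SignalStrength R)
    (hx : ∀ i, x i = θ.observe (y i) (z i)) (j : Fin K) :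
    clusterDefect (fun i => whiten x (x i)) s j ≤ C / (κ ^ 3 * R ^ 2) := by
  have hR : 0 < R := hθ.2.1
  have hw := isIsotropic_whiten hm (hG.sampleCov_posDef hκ hm hθ.1 hx)
  calc _ ≤ ∑ j, clusterDefect (fun i => whiten x (x i)) s j :=
        Finset.single_le_sum (fun j _ => hw.clusterDefect_nonneg hm j) (Finset.mem_univ j)
    _ ≤ ∑ j, clusterDefect (fun i => whiten x (x i)) y j := hs.sum_clusterDefect_le hm y
    _ ≤ ∑ _j : Fin K, C * K / (κ * R ^ 2) :=
        Finset.sum_le_sum fun j _ => hG.clusterDefect_le hκ hC hm hθ hx j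
    _ = C * (K * κ) ^ 2 / (κ ^ 3 * R ^ 2) := by
        rw [Finset.sum_const, Finset.card_univ, Fintype.card_fin, nsmul_eq_mul]
        field_simp
    _ ≤ _ := by
        gcongr
        exact mul_le_of_le_one_right hC
          (pow_le_one₀ (by positivity) (hG.natCast_mul_le_one hm))

theorem IsIsotropic.eq_of_forall_norm_sub_clusterMean_le {w : Fin m → EucSp d} (hw : IsIsotropic w)
    (hm : 0 < m) (hdefect : ∀ j, clusterDefect w s j ≤ 1 / 4) {u : EucSp d} {l j : Fin K}
    (hu : ∀ j, |clusterScore w s j u - if j = l then 1 else 0| ≤ 1 / 8)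
    (hj : ‖u - clusterMean w s j‖ ≤ ‖u - clusterMean w s l‖) : j = l := by
  have hsize (j : Fin K) : 0 < clusterSize s j :=
    clusterSize_pos_of_clusterDefect_lt_one ((hdefect j).trans_lt (by norm_num))
  by_contra hne
  have hl := hu l
  have hj' := hu j
  rw [if_pos rfl] at hl
  rw [if_neg hne, sub_zero] at hj'
  exact hj.not_gt (norm_sub_clusterMean_lt hm (hsize l) (hsize j) (hw.clusterDefect_nonneg hm l)
    (hdefect j) (by linarith [(abs_le.1 hl).1]) (abs_le.1 hj').2)

theorem GoodSample.training (hκ : 0 < κ) (hC : 0 ≤ C) (hG : GoodSample κ C y z) (hm : 0 < m)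
    (hθ : θ.SignalStrength R) (hx : ∀ i, x i = θ.observe (y i) (z i)) (hs : IsWhitenedKMeans x s)
    (hsmall : 512 * (κ + C) * (C / (κ ^ 3 * R ^ 2)) ≤ κ ^ 4) :
    ∃ τ : Equiv.Perm (Fin K), (∀ j, ‖θ.trainedSlope x s j‖ ^ 2 ≤ C / (κ ^ 3 * R ^ 2) / κ) ∧
      (∀ k u j, (∀ l, |inner ℝ (θ.trainedSlope x s l) u| ≤ 1 / 16) →
        IsPredictedLabel x s (θ.observe k u) j → j = τ k) ∧
      (hammingDist s (fun i => τ (y i)) : ℝ) ≤ κ / 4 * m := by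
  have hw := isIsotropic_whiten hm (hG.sampleCov_posDef hκ hm hθ.1 hx)
  have hdefect (j) := hs.clusterDefect_le hκ hC hG hm hθ hx j
  set E := C / (κ ^ 3 * R ^ 2)
  have hE : 0 ≤ E := by positivity
  have hE4 : E ≤ 1 / 4 := by
    have hκ4 : κ ^ 4 ≤ κ := pow_le_of_le_one hκ.le (hG.le_one hκ hm) (by norm_num)
    refine le_of_mul_le_mul_left ?_ hκ
    nlinarith [mul_nonneg hC hE, mul_nonneg hκ.le hE]
  set w : Fin m → EucSp d := fun i => whiten x (x i) with hwx
  have hrss (j : Fin K) : affineRss y z s j (fun k => clusterScore w s j (whiten x (θ.center k)))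
      (θ.trainedSlope x s j) ≤ E * clusterSize s j := by
    simp_rw [affineRss, hwx, ← θ.clusterScore_whiten_observe, ← hx]
    rw [← hwx, ← clusterRss, hw.clusterRss_eq hm, mul_comm]
    gcongr
    exact hdefect j
  obtain ⟨τ, hτ⟩ := hG.exists_perm hκ hC hm hE hsmall (fun k => hw.sum_clusterScore hm _)
    (fun j => clusterSize_pos_of_clusterDefect_lt_one (by linarith [hdefect j])) hrss
  refine ⟨τ, fun j => hG.norm_sq_le s j _ _ hκ hm hE (hrss j), fun k u j hu hpred => ?_,
    hG.hammingDist_le hκ hC hm hsmall hτ hrss⟩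
  refine hw.eq_of_forall_norm_sub_clusterMean_le hm (fun j => (hdefect j).trans hE4) (fun l => ?_)
    (hpred (τ k))
  rw [θ.clusterScore_whiten_observe, add_sub_right_comm]
  exact (abs_add_le _ _).trans (by linarith [hτ l k, hu l])

end Training

section Measurability

variable {d K m : ℕ}

theorem measurable_toEuclideanCLM_inv_apply {α : Type*} [TopologicalSpace α] [MeasurableSpace α]
    [OpensMeasurableSpace α] {A : α → Matrix (Fin d) (Fin d) ℝ} (hA : Continuous A)
    {v : α → EucSp d} (hv : Measurable v) :
    Measurable fun x => Matrix.toEuclideanCLM (𝕜 := ℝ) (A x)⁻¹ (v x) := by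
  have hentry (a c : Fin d) : Measurable fun x => (A x)⁻¹ a c := by
    simp only [Matrix.inv_def, Matrix.smul_apply, Ring.inverse_eq_inv', smul_eq_mul]
    exact hA.matrix_det.measurable.inv.mul (hA.matrix_adjugate.matrix_elem a c).measurable
  have hcoord (a : Fin d) : Measurable fun x => ((A x)⁻¹.mulVec (v x)) a := by
    simp only [Matrix.mulVec, dotProduct]
    exact Finset.measurable_fun_sum _ fun c _ =>
      (hentry a c).mul ((EuclideanSpace.proj (𝕜 := ℝ) c).measurable.comp hv)
  exact (WithLp.measurable_toLp 2 (Fin d → ℝ)).comp (measurable_pi_lambda _ hcoord)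

theorem continuous_sampleCov : Continuous fun x : Fin m → EucSp d => sampleCov x :=
  continuous_matrix fun a c => by
    simp only [sampleCov, Matrix.of_apply, sampleMean]
    fun_prop

theorem continuous_sqrt_sampleCov :
    Continuous fun x : Fin m → EucSp d => CFC.sqrt (sampleCov x) :=
  CFC.continuousOn_sqrt.comp_continuous continuous_sampleCov
    fun x => (sampleCov_posSemidef x).nonneg

theorem measurable_whiten_apply (i : Fin m) :
    Measurable fun x : Fin m → EucSp d => whiten x (x i) :=
  measurable_toEuclideanCLM_inv_apply continuous_sqrt_sampleCov (by unfold sampleMean; fun_prop)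

theorem measurable_whitenedCenter (s : Fin m → Fin K) (j : Fin K) :
    Measurable fun x : Fin m → EucSp d => whitenedCenter x s j := by
  unfold whitenedCenter clusterMean
  exact (Finset.measurable_fun_sum _ fun i _ => measurable_whiten_apply i).const_smul (_ : ℝ)

theorem MixtureModel.measurable_trainedSlope (θ : MixtureModel d K) (s : Fin m → Fin K)
    (j : Fin K) : Measurable fun x => θ.trainedSlope x s j := by
  have hcenter := measurable_toEuclideanCLM_inv_apply continuous_sqrt_sampleCov
    (measurable_whitenedCenter (d := d) s j)
  have hslope := (Matrix.toEuclideanCLM (𝕜 := ℝ) (CFC.sqrt θ.cov)).measurable.comp hcenter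
  exact hslope.const_smul (clusterSize s j / m : ℝ)

theorem measurable_apply_of_countable {α β γ : Type*} [MeasurableSpace α] [MeasurableSpace β]
    [MeasurableSpace γ] [Countable β] [MeasurableSingletonClass β] {F : α → β → γ}
    (hF : ∀ b, Measurable fun a => F a b) {g : α → β} (hg : Measurable g) :
    Measurable fun a => F a (g a) :=
  (measurable_from_prod_countable_left (f := fun q : α × β => F q.1 q.2) hF).comp
    (measurable_id.prodMk hg)

theorem MixtureModel.measurable_trainedSlope_solver (θ : MixtureModel d K)
    {solver : (Fin m → EucSp d) → Fin m → Fin K} (hsolver : Measurable solver) (j : Fin K) :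
    Measurable fun x => θ.trainedSlope x (solver x) j :=
  measurable_apply_of_countable (F := fun x s => θ.trainedSlope x s j)
    (fun s => θ.measurable_trainedSlope s j) hsolver

theorem MixtureModel.measurable_observe (θ : MixtureModel d K) :
    Measurable fun q : Fin K × EucSp d => θ.observe q.1 q.2 :=
  ((measurable_of_countable θ.center).comp measurable_fst).add
    ((ContinuousLinearMap.measurable _).comp measurable_snd)

end Measurability

section Independence

variable {Ω : Type*} [MeasurableSpace Ω] {P : Measure Ω}

theorem measureReal_le_of_indepFun {α β : Type*} [MeasurableSpace α] [MeasurableSpace β]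
    [IsProbabilityMeasure P] {X : Ω → α} {Z : Ω → β} (hX : Measurable X) (hZ : Measurable Z)
    (hind : IndepFun X Z P) {S : α → β → Prop} (hS : MeasurableSet {q : α × β | S q.1 q.2}) {r : ℝ}
    (hr : ∀ a, (P.map Z).real {b | S a b} ≤ r) : P.real {ω | S (X ω) (Z ω)} ≤ r := by
  have := Measure.isProbabilityMeasure_map (μ := P) hX.aemeasurable
  have := Measure.isProbabilityMeasure_map (μ := P) hZ.aemeasurable
  have hprod := (indepFun_iff_map_prod_eq_prod_map_map hX.aemeasurable hZ.aemeasurable).1 hind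
  obtain ⟨ω₀⟩ := P.nonempty_of_neZero
  refine ENNReal.toReal_le_of_le_ofReal (measureReal_nonneg.trans (hr (X ω₀))) ?_
  calc P {ω | S (X ω) (Z ω)} = (P.map X).prod (P.map Z) {q | S q.1 q.2} := by
        rw [← hprod, Measure.map_apply (hX.prodMk hZ) hS]; rfl
    _ = ∫⁻ a, P.map Z {b | S a b} ∂(P.map X) := by rw [Measure.prod_apply hS]; rfl
    _ ≤ ∫⁻ _a, ENNReal.ofReal r ∂(P.map X) :=
        lintegral_mono fun a => ENNReal.le_ofReal_iff_toReal_le (measure_ne_top _ _)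
          (measureReal_nonneg.trans (hr a)) |>.2 (hr a)
    _ = ENNReal.ofReal r := by simp

theorem IsNoiseSample.indepFun_observe {d K : ℕ} {ι ι' : Type*} [Finite ι'] {θ : MixtureModel d K}
    {y : ι → Ω → Fin K} {z : ι → Ω → EucSp d} (h : IsNoiseSample θ P y z) {f : ι' → ι} {i₀ : ι}
    (hf : ∀ i, f i ≠ i₀) :
    IndepFun (fun ω i => θ.observe (y (f i) ω) (z (f i) ω)) (z i₀) P := by
  classical
  cases nonempty_fintype ι'
  have hpairs := h.indep.indepFun_finset (Finset.univ.image f) {i₀} (by simp [hf])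
    fun i => (h.measurable_label i).prodMk (h.measurable_noise i)
  have hobserve : Measurable fun (g : Finset.univ.image f → Fin K × EucSp d) (i : ι') =>
      θ.observe (g ⟨f i, by simp⟩).1 (g ⟨f i, by simp⟩).2 :=
    measurable_pi_lambda _ fun i => θ.measurable_observe.comp (measurable_pi_apply _)
  exact hpairs.comp (ψ := fun g => (g ⟨i₀, by simp⟩).2) hobserve
    (measurable_snd.comp (measurable_pi_apply _))

end Independence

section SlopeError

variable {d K m : ℕ} {θ : MixtureModel d K} {σ v : ℝ}

theorem IsT2.measureReal_lt_abs_inner_le (hT2 : IsT2 σ θ.noise) {b : EucSp d}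
    (hb : ‖b‖ ^ 2 ≤ v) {t : ℝ} (hσ : 0 < σ) (ht : 0 < t) :
    θ.noise.real {u | t < |inner ℝ b u|} ≤ 2 * Real.exp (-(t ^ 2 / (2 * σ ^ 2 * v))) := by
  have := θ.noise_prob
  rcases eq_or_ne b 0 with rfl | hb0
  · simp only [inner_zero_left, abs_zero, ht.not_gt, Set.ofPred_false, measureReal_empty]
    positivity
  have hlip : LipschitzWith ‖b‖₊ fun u : EucSp d => inner ℝ b u := by
    have h := (innerSL ℝ b).lipschitz
    rwa [show ‖innerSL ℝ b‖₊ = ‖b‖₊ from NNReal.eq (innerSL_apply_norm ℝ b)] at h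
  calc θ.noise.real {u | t < |inner ℝ b u|}
      ≤ θ.noise.real {u | t ≤ |inner ℝ b u - ∫ u', inner ℝ b u' ∂θ.noise|} :=
        measureReal_mono fun u hu => by
          simpa only [Set.mem_ofPred_eq, θ.integral_noise_inner, sub_zero] using hu.le
    _ ≤ 2 * Real.exp (-(t ^ 2 / (2 * σ ^ 2 * ‖b‖ ^ 2))) :=
        hT2.measureReal_le_abs_sub_integral_le_exp hlip (θ.integrable_noise_inner b) ht
    _ ≤ 2 * Real.exp (-(t ^ 2 / (2 * σ ^ 2 * v))) := by
        have := norm_pos_iff.2 hb0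
        gcongr

/-- The noise `u` of a new observation has a non-negligible component along one of the slopes
of squared norm at most `v` of the classifier trained on `x` with labels `s`. Off this event a
well trained classifier does not err. -/
def MixtureModel.SlopeError (θ : MixtureModel d K) (v : ℝ) (x : Fin m → EucSp d)
    (s : Fin m → Fin K) (u : EucSp d) : Prop :=
  ∃ l, ‖θ.trainedSlope x s l‖ ^ 2 ≤ v ∧ 1 / 16 < |inner ℝ (θ.trainedSlope x s l) u|

theorem IsT2.measureReal_slopeError_le (hT2 : IsT2 σ θ.noise) (hσ : 0 < σ)
    (x : Fin m → EucSp d) (s : Fin m → Fin K) :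
    θ.noise.real {u | θ.SlopeError v x s u} ≤
      K * (2 * Real.exp (-((1 / 16) ^ 2 / (2 * σ ^ 2 * v)))) := by
  have hslope (l : Fin K) : θ.noise.real {u | ‖θ.trainedSlope x s l‖ ^ 2 ≤ v ∧
      1 / 16 < |inner ℝ (θ.trainedSlope x s l) u|} ≤
        2 * Real.exp (-((1 / 16) ^ 2 / (2 * σ ^ 2 * v))) := by
    by_cases hl : ‖θ.trainedSlope x s l‖ ^ 2 ≤ v
    · simpa only [hl, true_and] using hT2.measureReal_lt_abs_inner_le hl hσ (by norm_num)
    · simp only [hl, false_and, Set.ofPred_false, measureReal_empty]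
      positivity
  have hunion := measureReal_exists_mem_le (P := θ.noise) (s := (Finset.univ : Finset (Fin K)))
    fun l _ => hslope l
  simpa [MixtureModel.SlopeError] using hunion

theorem MixtureModel.measurableSet_slopeError (θ : MixtureModel d K) (v : ℝ)
    {solver : (Fin m → EucSp d) → Fin m → Fin K} (hsolver : Measurable solver) :
    MeasurableSet {q : (Fin m → EucSp d) × EucSp d | θ.SlopeError v q.1 (solver q.1) q.2} := by
  simp only [SlopeError, Set.ofPred_exists, Set.ofPred_and]
  refine MeasurableSet.iUnion fun l => ?_
  have hslope := (θ.measurable_trainedSlope_solver hsolver l).comp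
    (measurable_fst : Measurable (Prod.fst : (Fin m → EucSp d) × EucSp d → _))
  exact (measurableSet_le (hslope.norm.pow_const 2) measurable_const).inter
    (measurableSet_lt measurable_const (hslope.inner measurable_snd).abs)

variable {Ω ι : Type*} [MeasurableSpace Ω] {P : Measure Ω}
  {y : ι → Ω → Fin K} {z : ι → Ω → EucSp d} {solver : (Fin m → EucSp d) → Fin m → Fin K}

theorem IsNoiseSample.measurable_observe (h : IsNoiseSample θ P y z) (f : Fin m → ι) :
    Measurable fun ω i => θ.observe (y (f i) ω) (z (f i) ω) :=
  measurable_pi_lambda _ fun _ =>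
    θ.measurable_observe.comp ((h.measurable_label _).prodMk (h.measurable_noise _))

theorem IsNoiseSample.measurableSet_slopeError (h : IsNoiseSample θ P y z)
    (f : Fin m → ι) (i₀ : ι) (hsolver : Measurable solver) (v : ℝ) :
    MeasurableSet {ω | θ.SlopeError v (fun i => θ.observe (y (f i) ω) (z (f i) ω))
      (solver fun i => θ.observe (y (f i) ω) (z (f i) ω)) (z i₀ ω)} :=
  (h.measurable_observe f).prodMk (h.measurable_noise i₀)
    (θ.measurableSet_slopeError v hsolver)

theorem IsNoiseSample.measureReal_slopeError_le [IsProbabilityMeasure P]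
    (h : IsNoiseSample θ P y z) (hT2 : IsT2 σ θ.noise) (hσ : 0 < σ) {f : Fin m → ι} {i₀ : ι}
    (hf : ∀ i, f i ≠ i₀) (hsolver : Measurable solver) (v : ℝ) :
    P.real {ω | θ.SlopeError v (fun i => θ.observe (y (f i) ω) (z (f i) ω))
      (solver fun i => θ.observe (y (f i) ω) (z (f i) ω)) (z i₀ ω)} ≤
        K * (2 * Real.exp (-((1 / 16) ^ 2 / (2 * σ ^ 2 * v)))) := by
  refine measureReal_le_of_indepFun (S := fun x u => θ.SlopeError v x (solver x) u)
    (h.measurable_observe f) (h.measurable_noise i₀)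
    (h.indepFun_observe hf) (θ.measurableSet_slopeError v hsolver) fun x => ?_
  rw [h.noise_law]
  exact hT2.measureReal_slopeError_le hσ x _

end SlopeError

section Alignment

variable {K m n : ℕ}

theorem hammingDist_append {α : Type*} [DecidableEq α] (a : Fin m → α) (b : Fin n → α)
    (v : Fin (m + n) → α) : hammingDist (Fin.append a b) v =
      hammingDist a (fun i => v (Fin.castAdd n i)) + hammingDist b fun i => v (Fin.natAdd m i) := by
  simp only [hammingDist, Finset.card_filter, Fin.sum_univ_add, Fin.append_left, Fin.append_right]

theorem clusterSize_le_hammingDist {α : Type*} [DecidableEq α] (y : Fin m → Fin K)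
    (f g : Fin K → α) {k : Fin K} (h : f k ≠ g k) :
    clusterSize y k ≤ hammingDist (fun i => f (y i)) fun i => g (y i) :=
  Finset.card_le_card fun i hi => by
    simp only [Finset.mem_filter, Finset.mem_univ, true_and] at hi ⊢
    rwa [hi]

theorem IsAlignment.apply_eq {s y ytilde : Fin m → Fin K} {τ τ₁ τ₂ : Equiv.Perm (Fin K)}
    (h : IsAlignment s ytilde τ) {k : Fin K}
    (hk : 2 * (hammingDist s (fun i => τ₁ (y i)) + hammingDist ytilde fun i => τ₂ (y i)) <
      clusterSize y k) : τ (τ₂ k) = τ₁ k := by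
  by_contra hne
  have hperm (ρ : Equiv.Perm (Fin K)) (u v : Fin m → Fin K) :
      hammingDist (fun i => ρ (u i)) (fun i => ρ (v i)) = hammingDist u v :=
    hammingDist_comp (fun _ => ρ) fun _ => ρ.injective
  have hopt : hammingDist s (fun i => τ (ytilde i)) ≤
      hammingDist s (fun i => τ₁ (y i)) + hammingDist ytilde fun i => τ₂ (y i) := by
    refine (h (τ₂.symm.trans τ₁)).trans ((hammingDist_triangle _ (fun i => τ₁ (y i)) _).trans ?_)
    have := hperm (τ₂.symm.trans τ₁) (fun i => τ₂ (y i)) ytilde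
    simp only [Equiv.trans_apply, Equiv.symm_apply_apply] at this ⊢
    rw [this, hammingDist_comm ytilde]
  have hdisagree := clusterSize_le_hammingDist y τ₁ (fun j => τ (τ₂ j)) (Ne.symm hne)
  have htri := hammingDist_triangle_left (fun i => τ₁ (y i)) (fun i => τ (τ₂ (y i))) s
  have htri' := hammingDist_triangle s (fun i => τ (ytilde i)) (fun i => τ (τ₂ (y i)))
  rw [hperm] at htri'
  omega

end Alignment

section MisclassError

variable {K m n : ℕ}

theorem misclassError_nonneg (u v : Fin n → Fin K) : 0 ≤ misclassError u v :=
  mul_nonneg (by positivity) (Real.iInf_nonneg fun _ => by positivity)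

theorem misclassError_le_hammingDist (u v : Fin n → Fin K) (τ : Equiv.Perm (Fin K)) :
    misclassError u v ≤ (n : ℝ)⁻¹ * hammingDist u (fun i => τ (v i)) := by
  unfold misclassError
  gcongr
  exact ciInf_le (Set.finite_range _).bddBelow τ

theorem misclassError_le_one (u v : Fin n → Fin K) : misclassError u v ≤ 1 := by
  refine (misclassError_le_hammingDist u v 1).trans (inv_mul_le_one_of_le₀ ?_ (by positivity))
  simpa using Nat.cast_le (α := ℝ).2 (hammingDist_le_card_fintype (x := u) (y := v))

theorem inv_le_misclassError {u v : Fin n → Fin K} (h : misclassError u v ≠ 0) :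
    (n : ℝ)⁻¹ ≤ misclassError u v := by
  obtain ⟨τ, hτ⟩ := exists_eq_ciInf_of_finite
    (f := fun τ : Equiv.Perm (Fin K) => (hammingDist u (fun i => τ (v i)) : ℝ))
  unfold misclassError at h ⊢
  rw [← hτ] at h ⊢
  refine le_mul_of_one_le_right (by positivity) ?_
  exact_mod_cast Nat.one_le_iff_ne_zero.2 fun h0 => h (by rw [h0, Nat.cast_zero, mul_zero])

theorem misclassError_append_le_of_forall_apply_eq {a b : Fin m → Fin K}
    {y : Fin (m + m) → Fin K} {τ τ₁ τ₂ : Equiv.Perm (Fin K)} (hτ : ∀ k, τ (τ₂ k) = τ₁ k) :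
    misclassError (Fin.append (fun i => τ (a i)) b) y ≤ ((m + m : ℕ) : ℝ)⁻¹ *
      (hammingDist a (fun i => τ₂ (y (Fin.castAdd m i))) +
        hammingDist b fun i => τ₁ (y (Fin.natAdd m i))) := by
  refine (misclassError_le_hammingDist _ _ τ₁).trans_eq ?_
  have haligned : hammingDist (fun i => τ (a i)) (fun i => τ₁ (y (Fin.castAdd m i))) =
      hammingDist a fun i => τ₂ (y (Fin.castAdd m i)) := by
    simp only [← hτ]
    exact hammingDist_comp (fun _ => τ) fun _ => τ.injective
  rw [hammingDist_append, haligned, Nat.cast_add (hammingDist _ _)]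

/-- Either the alignment recovers the relabelling `τ₁`, or the predicted labels `a` of the first
half have so many errors that the bound is at least `1`. -/
theorem misclassError_append_le {s a b : Fin m → Fin K} {y : Fin (m + m) → Fin K}
    {τ τ₁ τ₂ : Equiv.Perm (Fin K)} (hm : 0 < m) (h : IsAlignment s a τ) {κ : ℝ} (hκ : 0 < κ)
    (hclass : ∀ k, κ * m ≤ clusterSize (fun i => y (Fin.castAdd m i)) k)
    (hs : hammingDist s (fun i => τ₁ (y (Fin.castAdd m i))) ≤ κ / 4 * m) :
    misclassError (Fin.append (fun i => τ (a i)) b) y ≤ (1 + 8 / κ) * ((m + m : ℕ) : ℝ)⁻¹ *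
      (hammingDist a (fun i => τ₂ (y (Fin.castAdd m i))) +
        hammingDist b fun i => τ₁ (y (Fin.natAdd m i))) := by
  set e₁ := hammingDist a fun i => τ₂ (y (Fin.castAdd m i))
  set e₂ := hammingDist b fun i => τ₁ (y (Fin.natAdd m i))
  have : (0 : ℝ) < m := by exact_mod_cast hm
  have hκ' : 0 < 8 / κ := by positivity
  by_cases hfew : 4 * (e₁ : ℝ) < κ * m
  · have hτ (k : Fin K) : τ (τ₂ k) = τ₁ k := by
      refine h.apply_eq (y := fun i => y (Fin.castAdd m i)) ?_
      have := hclass k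
      rify
      linarith
    refine (misclassError_append_le_of_forall_apply_eq hτ).trans ?_
    rw [mul_assoc]
    exact le_mul_of_one_le_left (by positivity) (by linarith)
  · calc misclassError _ y ≤ 1 := misclassError_le_one _ _
      _ = 8 / κ * ((m + m : ℕ) : ℝ)⁻¹ * (κ * m / 4) := by push_cast; field_simp; norm_num
      _ ≤ (1 + 8 / κ) * ((m + m : ℕ) : ℝ)⁻¹ * (e₁ + e₂) := by
        gcongr
        · linarith
        · linarith [Nat.cast_nonneg (α := ℝ) e₂]

variable {Ω : Type*} [MeasurableSpace Ω] {P : Measure Ω} {yhat : Ω → Fin n → Fin K}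
  {y : Fin n → Ω → Fin K}

theorem integral_misclassError_le_one [IsProbabilityMeasure P] :
    ∫ ω, misclassError (yhat ω) (fun i => y i ω) ∂P ≤ 1 := by
  simpa using integral_mono_of_nonneg (μ := P) (ae_of_all _ fun _ => misclassError_nonneg _ _)
    (integrable_const 1) (ae_of_all _ fun ω => misclassError_le_one (yhat ω) fun i => y i ω)

theorem measurable_misclassError (hyhat : Measurable yhat) (hy : ∀ i, Measurable (y i)) :
    Measurable fun ω => misclassError (yhat ω) fun i => y i ω :=
  measurable_apply_of_countable (F := fun ω v => misclassError (yhat ω) v)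
    (fun v => (measurable_of_countable fun u => misclassError u v).comp hyhat)
    (measurable_pi_lambda _ hy)

theorem integrable_misclassError [IsFiniteMeasure P] (hyhat : Measurable yhat)
    (hy : ∀ i, Measurable (y i)) :
    Integrable (fun ω => misclassError (yhat ω) fun i => y i ω) P :=
  .of_bound (measurable_misclassError hyhat hy).aestronglyMeasurable 1 <| ae_of_all _ fun ω => by
    rw [Real.norm_of_nonneg (misclassError_nonneg _ _)]
    exact misclassError_le_one _ _

theorem one_sub_mul_integral_misclassError_le [IsProbabilityMeasure P] (hyhat : Measurable yhat)
    (hy : ∀ i, Measurable (y i)) (hn : 0 < n) :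
    1 - n * ∫ ω, misclassError (yhat ω) (fun i => y i ω) ∂P ≤
      P.real {ω | misclassError (yhat ω) (fun i => y i ω) = 0} := by
  have hexact : MeasurableSet {ω | misclassError (yhat ω) (fun i => y i ω) = 0} :=
    measurable_misclassError hyhat hy (measurableSet_singleton 0)
  have hmarkov := mul_meas_ge_le_integral_of_nonneg (μ := P)
    (ae_of_all _ fun ω => misclassError_nonneg (yhat ω) fun i => y i ω)
    (integrable_misclassError hyhat hy) (n : ℝ)⁻¹
  have hinexact : P.real {ω | misclassError (yhat ω) (fun i => y i ω) = 0}ᶜ ≤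
      P.real {ω | (n : ℝ)⁻¹ ≤ misclassError (yhat ω) (fun i => y i ω)} :=
    measureReal_mono fun ω hω => inv_le_misclassError hω
  rw [probReal_compl_eq_one_sub hexact] at hinexact
  rw [inv_mul_le_iff₀ (by exact_mod_cast hn)] at hmarkov
  linarith

end MisclassError

section ErrorBound

variable {d K m : ℕ} {θ : MixtureModel d K}
  {solver₁ solver₂ : (Fin m → EucSp d) → Fin m → Fin K}

/-- The slope errors of cross-validation: `inl i` is the error at the `i`-th point of the first half
of the classifier trained on the second half, `inr i` the one with the halves exchanged. -/
def MixtureModel.CrossSlopeError (θ : MixtureModel d K) (v : ℝ)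
    (solver₁ solver₂ : (Fin m → EucSp d) → Fin m → Fin K) (x z : Fin (m + m) → EucSp d) :
    Fin m ⊕ Fin m → Prop
  | .inl i => θ.SlopeError v (secondHalf x) (solver₂ (secondHalf x)) (firstHalf z i)
  | .inr i => θ.SlopeError v (firstHalf x) (solver₁ (firstHalf x)) (secondHalf z i)

theorem hammingDist_le_sum_indicator {ι α : Type*} [Fintype ι] [DecidableEq α] {u v : ι → α}
    {S : Set ι} (h : ∀ i, u i ≠ v i → i ∈ S) :
    (hammingDist u v : ℝ) ≤ ∑ i, S.indicator 1 i := by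
  classical
  simp only [hammingDist, Finset.card_filter, Nat.cast_sum, Set.indicator_apply, Pi.one_apply]
  gcongr with i
  split_ifs with hne hi hi <;> simp [h i, *] at *

theorem misclassError_le_of_goodSample {κ C R : ℝ} (hκ : 0 < κ) (hC : 0 ≤ C) (hm : 0 < m)
    (hθ : θ.SignalStrength R) (hsmall : 512 * (κ + C) * (C / (κ ^ 3 * R ^ 2)) ≤ κ ^ 4)
    {y : Fin (m + m) → Fin K} {z : Fin (m + m) → EucSp d}
    (hG₁ : GoodSample κ C (fun i => y (Fin.castAdd m i)) fun i => z (Fin.castAdd m i))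
    (hG₂ : GoodSample κ C (fun i => y (Fin.natAdd m i)) fun i => z (Fin.natAdd m i))
    (hs₁ : ∀ x, IsWhitenedKMeans x (solver₁ x)) (hs₂ : ∀ x, IsWhitenedKMeans x (solver₂ x))
    {yhat : Fin (m + m) → Fin K}
    (hout : IsCVKMeansOutput solver₁ solver₂ (fun i => θ.observe (y i) (z i)) yhat) :
    misclassError yhat y ≤ (1 + 8 / κ) * ((m + m : ℕ) : ℝ)⁻¹ *
      ∑ i, {i | θ.CrossSlopeError (C / (κ ^ 3 * R ^ 2) / κ) solver₁ solver₂
        (fun i => θ.observe (y i) (z i)) z i}.indicator 1 i := by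
  obtain ⟨a, b, τ, ha, hb, halign, rfl⟩ := hout
  obtain ⟨τ₁, hslope₁, hclass₁, hlabels⟩ :=
    hG₁.training hκ hC hm hθ (fun _ => rfl) (hs₁ _) hsmall
  obtain ⟨τ₂, hslope₂, hclass₂, -⟩ :=
    hG₂.training hκ hC hm hθ (fun _ => rfl) (hs₂ _) hsmall
  refine (misclassError_append_le (τ₂ := τ₂) hm halign hκ hG₁.le_card hlabels).trans ?_
  rw [Fintype.sum_sum_type]
  gcongr
  · refine hammingDist_le_sum_indicator (S := {i | θ.CrossSlopeError _ _ _ _ _ (.inl i)})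
      fun i hne => ?_
    by_contra hslope
    refine hne (hclass₂ _ _ _ (fun l => ?_) (ha i))
    by_contra! hlt
    exact hslope ⟨l, hslope₂ l, hlt⟩
  · refine hammingDist_le_sum_indicator (S := {i | θ.CrossSlopeError _ _ _ _ _ (.inr i)})
      fun i hne => ?_
    by_contra hslope
    refine hne (hclass₁ _ _ _ (fun l => ?_) (hb i))
    by_contra! hlt
    exact hslope ⟨l, hslope₁ l, hlt⟩

variable {Ω : Type*} [MeasurableSpace Ω] {P : Measure Ω}

theorem integral_le_measureReal_add_mul_sum [IsFiniteMeasure P] {ι : Type*} [Fintype ι]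
    {X : Ω → ℝ} {bad : Set Ω} {F : ι → Set Ω} {a : ℝ} (ha : 0 ≤ a) (hX0 : ∀ ω, 0 ≤ X ω)
    (hX1 : ∀ ω, X ω ≤ 1) (hF : ∀ i, MeasurableSet (F i))
    (h : ∀ᵐ ω ∂P, ω ∉ bad → X ω ≤ a * ∑ i, (F i).indicator 1 ω) :
    ∫ ω, X ω ∂P ≤ P.real bad + a * ∑ i, P.real (F i) := by
  have hbad := measurableSet_toMeasurable P bad
  have hint {A : Set Ω} (hA : MeasurableSet A) : Integrable (A.indicator (1 : Ω → ℝ)) P :=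
    (integrable_const 1).indicator hA
  have hsum : Integrable (fun ω => a * ∑ i, (F i).indicator (1 : Ω → ℝ) ω) P :=
    (integrable_finsetSum _ fun i _ => hint (hF i)).const_mul a
  have hbound : ∀ᵐ ω ∂P, X ω ≤ (toMeasurable P bad).indicator 1 ω +
      a * ∑ i, (F i).indicator 1 ω := by
    filter_upwards [h] with ω hω
    have hnonneg (A : Set Ω) : 0 ≤ A.indicator (1 : Ω → ℝ) ω :=
      Set.indicator_nonneg (fun _ _ => zero_le_one) ω
    by_cases hωbad : ω ∈ toMeasurable P bad
    · rw [Set.indicator_of_mem hωbad]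
      exact (hX1 ω).trans (le_add_of_nonneg_right
        (mul_nonneg ha (Finset.sum_nonneg fun i _ => hnonneg (F i))))
    · exact (hω fun hmem => hωbad (subset_toMeasurable P bad hmem)).trans
        (le_add_of_nonneg_left (hnonneg _))
  calc ∫ ω, X ω ∂P ≤ ∫ ω, ((toMeasurable P bad).indicator 1 ω +
        a * ∑ i, (F i).indicator 1 ω) ∂P :=
        integral_mono_of_nonneg (ae_of_all _ hX0) ((hint hbad).add hsum) hbound
    _ = P.real bad + a * ∑ i, P.real (F i) := by
        rw [integral_add (hint hbad) hsum, integral_const_mul,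
          integral_finsetSum _ fun i _ => hint (hF i)]
        simp only [integral_indicator_one, hbad, hF, measureReal_def, measure_toMeasurable]

variable {σ : ℝ} {y : Fin (m + m) → Ω → Fin K} {z : Fin (m + m) → Ω → EucSp d}

theorem IsNoiseSample.measurableSet_crossSlopeError (h : IsNoiseSample θ P y z)
    (hs₁ : Measurable solver₁) (hs₂ : Measurable solver₂) (v : ℝ) :
    ∀ i, MeasurableSet {ω | θ.CrossSlopeError v solver₁ solver₂
      (fun i => θ.observe (y i ω) (z i ω)) (fun i => z i ω) i}
  | .inl i => h.measurableSet_slopeError (Fin.natAdd m) (Fin.castAdd m i) hs₂ v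
  | .inr i => h.measurableSet_slopeError (Fin.castAdd m) (Fin.natAdd m i) hs₁ v

theorem IsNoiseSample.measureReal_crossSlopeError_le [IsProbabilityMeasure P]
    (h : IsNoiseSample θ P y z) (hT2 : IsT2 σ θ.noise) (hσ : 0 < σ) (hs₁ : Measurable solver₁)
    (hs₂ : Measurable solver₂) (v : ℝ) (i : Fin m ⊕ Fin m) :
    P.real {ω | θ.CrossSlopeError v solver₁ solver₂ (fun i => θ.observe (y i ω) (z i ω))
      (fun i => z i ω) i} ≤ K * (2 * Real.exp (-((1 / 16) ^ 2 / (2 * σ ^ 2 * v)))) := by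
  have hdisjoint (i j : Fin m) : Fin.natAdd m i ≠ Fin.castAdd m j := by
    simp only [ne_eq, Fin.ext_iff, Fin.val_natAdd, Fin.val_castAdd]
    omega
  rcases i with i | i
  · exact h.measureReal_slopeError_le hT2 hσ (fun j => hdisjoint j i) hs₂ v
  · exact h.measureReal_slopeError_le hT2 hσ (fun j => (hdisjoint i j).symm) hs₁ v

theorem IsNoiseSample.integral_misclassError_le [IsProbabilityMeasure P]
    (h : IsNoiseSample θ P y z) {κ C R : ℝ} (hT2 : IsT2 σ θ.noise) (hσ : 0 < σ) (hκ : 0 < κ)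
    (hC : 0 ≤ C) (hm : 0 < m) (hθ : θ.SignalStrength R)
    (hsmall : 512 * (κ + C) * (C / (κ ^ 3 * R ^ 2)) ≤ κ ^ 4)
    (hs₁ : IsWhitenedKMeansSolver solver₁) (hs₂ : IsWhitenedKMeansSolver solver₂)
    {yhat : Ω → Fin (m + m) → Fin K} (hout : ∀ᵐ ω ∂P, IsCVKMeansOutput solver₁ solver₂
      (fun i => θ.observe (y i ω) (z i ω)) (yhat ω)) :
    ∫ ω, misclassError (yhat ω) (fun i => y i ω) ∂P ≤
      P.real {ω | ¬ GoodSample κ C (fun i => y (Fin.castAdd m i) ω)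
        fun i => z (Fin.castAdd m i) ω} +
      P.real {ω | ¬ GoodSample κ C (fun i => y (Fin.natAdd m i) ω)
        fun i => z (Fin.natAdd m i) ω} +
      (1 + 8 / κ) * (2 * K * Real.exp (-(κ ^ 4 / (512 * σ ^ 2 * C)) * R ^ 2)) := by
  set v := C / (κ ^ 3 * R ^ 2) / κ with hv
  have hexp : (1 / 16) ^ 2 / (2 * σ ^ 2 * v) = κ ^ 4 / (512 * σ ^ 2 * C) * R ^ 2 := by
    have := hθ.2.1
    rw [hv]
    field_simp
    norm_num
  have hprob := h.measureReal_crossSlopeError_le hT2 hσ hs₁.1 hs₂.1 v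
  refine (integral_le_measureReal_add_mul_sum (a := (1 + 8 / κ) * ((m + m : ℕ) : ℝ)⁻¹)
    (by positivity) (fun _ => misclassError_nonneg _ _) (fun _ => misclassError_le_one _ _)
    (h.measurableSet_crossSlopeError hs₁.1 hs₂.1 v) (hout.mono fun ω hω hgood => ?_)).trans
    (add_le_add (measureReal_union_le {ω | ¬ GoodSample κ C (fun i => y (Fin.castAdd m i) ω)
        fun i => z (Fin.castAdd m i) ω} {ω | ¬ GoodSample κ C (fun i => y (Fin.natAdd m i) ω)
        fun i => z (Fin.natAdd m i) ω}) ?_)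
  · simp only [Set.mem_union, Set.mem_ofPred_eq, not_or, not_not] at hgood
    exact misclassError_le_of_goodSample hκ hC hm hθ hsmall hgood.1 hgood.2 hs₁.2 hs₂.2 hω
  · have : (0 : ℝ) < m := by exact_mod_cast hm
    calc _ ≤ (1 + 8 / κ) * ((m + m : ℕ) : ℝ)⁻¹ * ∑ _i : Fin m ⊕ Fin m,
          K * (2 * Real.exp (-((1 / 16) ^ 2 / (2 * σ ^ 2 * v)))) := by
          gcongr with i
          exact hprob i
      _ = _ := by
          rw [hexp, Finset.sum_const, Finset.card_univ, Fintype.card_sum, Fintype.card_fin,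
            nsmul_eq_mul]
          push_cast
          field_simp

end ErrorBound

theorem exists_integral_misclassError_le {σ p : ℝ} (hσ : 0 < σ) (hp : 0 < p) :
    ∃ c C B γ : ℝ, 0 < c ∧ 0 < C ∧ 1 ≤ B ∧ 0 < γ ∧
      ∀ {d K m : ℕ} {Ω : Type*} [MeasurableSpace Ω] {P : Measure Ω} [IsProbabilityMeasure P]
        {θ : MixtureModel d K} {R : ℝ} {y : Fin (m + m) → Ω → Fin K}
        {x : Fin (m + m) → Ω → EucSp d} {solver₁ solver₂ : (Fin m → EucSp d) → Fin m → Fin K}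
        {yhat : Ω → Fin (m + m) → Fin K},
        0 < m → IsMixtureSample θ P y x → IsT2 σ θ.noise →
        (∀ j, p ≤ θ.weight j) → θ.SignalStrength R →
        IsWhitenedKMeansSolver solver₁ → IsWhitenedKMeansSolver solver₂ →
        (∀ᵐ ω ∂P, IsCVKMeansOutput solver₁ solver₂ (fun i => x i ω) (yhat ω)) →
        ∫ ω, misclassError (yhat ω) (fun i => y i ω) ∂P ≤
          C * (Real.exp (-c * R ^ 2) + B ^ (d + 1) * Real.exp (-γ * m)) := by
  obtain ⟨κ, C, B, γ, hκ, hC, hB, hγ, hgood⟩ := exists_measureReal_not_goodSample_le hσ hp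
  set c := κ ^ 4 / (512 * σ ^ 2 * C)
  have hc : 0 < c := by positivity
  set A := (1 + 8 / κ) * (2 / p)
  set r := 512 * (κ + C) * C / κ ^ 7 with hr
  refine ⟨c, 2 + A + Real.exp (c * r), B, γ, hc, by positivity, hB, hγ, ?_⟩
  intro d K m Ω _ P _ θ R y x solver₁ solver₂ yhat hm hsample hT2 hw hθ hs₁ hs₂ hout
  obtain ⟨z, hy, hz, hind, hyz, hlaw, hnoise, hx⟩ := hsample
  have hS : IsNoiseSample θ P y z := ⟨hy, hz, hind, hyz, hlaw, hnoise⟩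
  set q := B ^ (d + 1) * Real.exp (-γ * m)
  have hR := hθ.2.1
  suffices hbound : ∫ ω, misclassError (yhat ω) (fun i => y i ω) ∂P ≤
      2 * q + (A + Real.exp (c * r)) * Real.exp (-c * R ^ 2) by
    have : 0 ≤ 2 * Real.exp (-c * R ^ 2) + (A + Real.exp (c * r)) * q := by positivity
    linarith
  by_cases hsmall : 512 * (κ + C) * (C / (κ ^ 3 * R ^ 2)) ≤ κ ^ 4
  · have hK : (K : ℝ) ≤ 1 / p := (le_div_iff₀ hp).2 (θ.natCast_mul_le_one hw)
    have hgood₁ := hgood hT2 hw (hS.comp (Fin.castAdd_injective m m))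
    have hgood₂ := hgood hT2 hw (hS.comp (Fin.natAdd_injective m m))
    calc _ ≤ q + q + (1 + 8 / κ) * (2 * K * Real.exp (-c * R ^ 2)) :=
          (hS.integral_misclassError_le hT2 hσ hκ hC.le hm hθ hsmall hs₁ hs₂
            (by simpa only [MixtureModel.observe, hx] using hout)).trans (by gcongr)
      _ ≤ q + q + (1 + 8 / κ) * (2 * (1 / p) * Real.exp (-c * R ^ 2)) := by gcongr
      _ = 2 * q + A * Real.exp (-c * R ^ 2) := by ring
      _ ≤ _ := by
        gcongr
        exact le_add_of_nonneg_right (by positivity)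
  · have hRr : R ^ 2 ≤ r := by
      rw [not_le, ← mul_div_assoc, lt_div_iff₀ (by positivity)] at hsmall
      rw [hr, le_div_iff₀ (by positivity)]
      linarith
    calc _ ≤ 1 := integral_misclassError_le_one
      _ ≤ Real.exp (c * r) * Real.exp (-c * R ^ 2) := by
          rw [← Real.exp_add]
          exact Real.one_le_exp (by linarith [mul_le_mul_of_nonneg_left hRr hc.le])
      _ ≤ (A + Real.exp (c * r)) * Real.exp (-c * R ^ 2) := by
          gcongr
          exact le_add_of_nonneg_left (by positivity)
      _ ≤ _ := le_add_of_nonneg_left (by positivity)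

section Asymptotics

variable {ι : Type*} {l : Filter ι}

theorem tendsto_natCast_add_self_atTop :
    Tendsto (fun m : ℕ => ((m + m : ℕ) : ℝ)) atTop atTop :=
  tendsto_natCast_atTop_atTop.comp (tendsto_id.atTop_add_atTop tendsto_id)

theorem exists_forall_lt_add_self {q : ℕ → Prop} (hq : ∀ᶠ m in atTop, q m) :
    ∃ N : ℕ, ∀ m : ℕ, N < m + m → q m := by
  obtain ⟨N, hN⟩ := eventually_atTop.1 hq
  exact ⟨N + N, fun m hm => hN m (by omega)⟩

theorem isLittleO_of_tendsto_div_mul_log_sq {n d : ι → ℝ} (hn : Tendsto n l atTop)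
    (hd : Tendsto (fun i => n i / (d i * Real.log (n i) ^ 2)) l atTop) : d =o[l] n := by
  have hlog : d =O[l] fun i => d i * Real.log (n i) ^ 2 := .of_bound 1 <| by
    filter_upwards [(Real.tendsto_log_atTop.comp hn).eventually_ge_atTop 1] with i hi
    rw [one_mul, norm_mul, norm_pow]
    exact le_mul_of_one_le_right (norm_nonneg _) (one_le_pow₀ (hi.trans (Real.le_norm_self _)))
  have hratio : Tendsto (fun i => d i * Real.log (n i) ^ 2 / n i) l (𝓝 0) := by
    simpa only [Pi.inv_def, inv_div] using hd.inv_tendsto_atTop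
  refine hlog.trans_isLittleO (Asymptotics.isLittleO_of_tendsto' ?_ hratio)
  filter_upwards [hn.eventually_gt_atTop 0] with i hi h0
  exact absurd h0 hi.ne'

theorem eventually_pow_mul_exp_neg_le_inv_pow {B γ : ℝ} (hB : 0 < B) (hγ : 0 < γ) {d : ℕ → ℕ}
    (hd : (fun m => (d m : ℝ)) =o[atTop] fun m => ((m + m : ℕ) : ℝ)) (k : ℕ) :
    ∀ᶠ m : ℕ in atTop, B ^ (d m + 1) * Real.exp (-γ * m) ≤ (((m + m : ℕ) : ℝ) ^ k)⁻¹ := by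
  have hn := tendsto_natCast_add_self_atTop
  have hone : (fun _ => (1 : ℝ)) =o[atTop] fun m : ℕ => ((m + m : ℕ) : ℝ) :=
    Asymptotics.isLittleO_const_left.2 (.inr (tendsto_abs_atTop_atTop.comp hn))
  have hlog : (fun m : ℕ => Real.log (m + m : ℕ)) =o[atTop] fun m => ((m + m : ℕ) : ℝ) :=
    Real.isLittleO_log_id_atTop.comp_tendsto hn
  have hexponent := ((hd.add hone).const_mul_left (Real.log B)).add (hlog.const_mul_left k)
  filter_upwards [hexponent.bound (half_pos hγ), eventually_gt_atTop 0] with m hm hm0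
  have hn0 : (0 : ℝ) < (m + m : ℕ) := by positivity
  rw [Real.norm_of_nonneg hn0.le] at hm
  have hle := (Real.le_norm_self _).trans hm
  rw [← Real.exp_log (pow_pos hB _), ← Real.exp_log (inv_pos.2 (pow_pos hn0 k)), ← Real.exp_add,
    Real.exp_le_exp, Real.log_inv, Real.log_pow, Real.log_pow]
  push_cast at hle ⊢
  linarith

theorem inv_pow_le_exp_neg {c R n : ℝ} (hc : 0 < c) (hR : 0 ≤ R) (hn : 1 ≤ n)
    (h : R ≤ √(c⁻¹ * Real.log n)) {k : ℕ} (hk : 1 ≤ k) : (n ^ k)⁻¹ ≤ Real.exp (-c * R ^ 2) := by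
  have hlog : 0 ≤ Real.log n := Real.log_nonneg hn
  have hR2 : c * R ^ 2 ≤ Real.log n :=
    (le_inv_mul_iff₀ hc).1 ((Real.le_sqrt hR (by positivity)).1 h)
  have hk' : (1 : ℝ) ≤ k := by exact_mod_cast hk
  rw [← Real.exp_log (show 0 < (n ^ k)⁻¹ by positivity), Real.exp_le_exp, Real.log_inv,
    Real.log_pow]
  linarith [le_mul_of_one_le_left hlog hk']

theorem mul_exp_neg_le_rpow_neg {c ε R n : ℝ} (hc : 0 < c) (hn : 0 < n)
    (h : √((1 + ε) * c⁻¹ * Real.log n) ≤ R) : n * Real.exp (-c * R ^ 2) ≤ n ^ (-ε) := by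
  have hR2 : (1 + ε) * Real.log n ≤ c * R ^ 2 := by
    have := mul_le_mul_of_nonneg_left (Real.sqrt_le_iff.1 h).2 hc.le
    field_simp at this
    linarith
  nth_rw 1 [← Real.exp_log hn]
  rw [← Real.exp_add, Real.rpow_def_of_pos hn, Real.exp_le_exp]
  linarith

theorem tendsto_mul_nhds_zero_of_le_exp_neg_add_inv_pow {e R n : ι → ℝ} {c C ε : ℝ} {k : ℕ}
    (hc : 0 < c) (hC : 0 ≤ C) (hε : 0 < ε) (hk : 2 ≤ k) (hn : Tendsto n l atTop)
    (he0 : ∀ i, 0 ≤ e i) (he : ∀ᶠ i in l, e i ≤ C * (Real.exp (-c * R i ^ 2) + (n i ^ k)⁻¹))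
    (hR : ∀ᶠ i in l, √((1 + ε) * c⁻¹ * Real.log (n i)) ≤ R i) :
    Tendsto (fun i => n i * e i) l (𝓝 0) := by
  have hlim : Tendsto (fun i => C * (n i ^ (-ε) + (n i)⁻¹)) l (𝓝 0) := by
    simpa using (((tendsto_rpow_neg_atTop hε).comp hn).add
      (tendsto_inv_atTop_zero.comp hn)).const_mul C
  refine squeeze_zero' ?_ ?_ hlim
  · filter_upwards [hn.eventually_ge_atTop 0] with i hi using mul_nonneg hi (he0 i)
  · filter_upwards [he, hR, hn.eventually_ge_atTop 1] with i hei hRi hni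
    have hn0 : 0 < n i := by linarith
    have hpow : n i * (n i ^ k)⁻¹ ≤ (n i)⁻¹ := by
      rw [← div_eq_mul_inv, div_le_iff₀ (by positivity), ← div_eq_inv_mul, le_div_iff₀ hn0, ← sq]
      exact pow_le_pow_right₀ hni hk
    calc n i * e i ≤ n i * (C * (Real.exp (-c * R i ^ 2) + (n i ^ k)⁻¹)) := by gcongr
      _ = C * (n i * Real.exp (-c * R i ^ 2) + n i * (n i ^ k)⁻¹) := by ring
      _ ≤ C * (n i ^ (-ε) + (n i)⁻¹) := by
        gcongr
        exact mul_exp_neg_le_rpow_neg hc hn0 hRi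

end Asymptotics

theorem mainTheorem2_general (σ : ℝ) (hσ : 0 < σ) (p : ℝ) (hp : 0 < p) :
    ∃ c : ℝ, 0 < c ∧ ∃ C : ℝ, 0 < C ∧
      ∀ (d K : ℕ → ℕ) (R : ℕ → ℝ) (θ : ∀ m, MixtureModel (d m) (K m))
        (Ω : ℕ → Type*) [∀ m, MeasurableSpace (Ω m)]
        (P : ∀ m, Measure (Ω m)) [∀ m, IsProbabilityMeasure (P m)]
        (y : ∀ m, Fin (m + m) → Ω m → Fin (K m))
        (x : ∀ m, Fin (m + m) → Ω m → EucSp (d m))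
        (solver₁ solver₂ : ∀ m, (Fin m → EucSp (d m)) → Fin m → Fin (K m))
        (yhat : ∀ m, Ω m → Fin (m + m) → Fin (K m)),
        (∀ m, IsMixtureSample (θ m) (P m) (y m) (x m)) →
        (∀ m, IsT2 σ (θ m).noise) →
        (∀ m j, p ≤ (θ m).weight j) →
        (∀ m, (θ m).SignalStrength (R m)) →
        (fun m => (d m : ℝ)) =o[atTop] (fun m => ((m + m : ℕ) : ℝ)) →
        (∀ m, IsWhitenedKMeansSolver (solver₁ m)) →
        (∀ m, IsWhitenedKMeansSolver (solver₂ m)) →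
        (∀ m, Measurable (yhat m)) →
        (∀ m, ∀ᵐ ω ∂(P m),
          IsCVKMeansOutput (solver₁ m) (solver₂ m) (fun i => x m i ω) (yhat m ω)) →
        (∃ N : ℕ, ∀ m : ℕ, N < m + m →
          ∫ ω, misclassError (yhat m ω) (fun i => y m i ω) ∂(P m) ≤
            C * (Real.exp (-c * R m ^ 2) + (((m + m : ℕ) : ℝ) ^ 10)⁻¹)) ∧
        ((∀ᶠ m : ℕ in atTop, R m ≤ √(c⁻¹ * Real.log (m + m : ℕ))) →
          ∃ N : ℕ, ∀ m : ℕ, N < m + m →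
            ∫ ω, misclassError (yhat m ω) (fun i => y m i ω) ∂(P m) ≤
              C * Real.exp (-c * R m ^ 2)) ∧
        (∀ ε : ℝ, 0 < ε →
          (∀ᶠ m : ℕ in atTop, √((1 + ε) * c⁻¹ * Real.log (m + m : ℕ)) ≤ R m) →
          Tendsto (fun m => (P m).real {ω | misclassError (yhat m ω) (fun i => y m i ω) = 0})
            atTop (𝓝 1)) := by
  obtain ⟨c, C, B, γ, hc, hC, hB, hγ, hbound⟩ := exists_integral_misclassError_le hσ hp
  refine ⟨c, hc, 2 * C, by positivity, ?_⟩
  intro d K R θ Ω _ P _ y x solver₁ solver₂ yhat hsample hT2 hw hθ hd hs₁ hs₂ hyhat hout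
  have hn := tendsto_natCast_add_self_atTop
  have herr : ∀ᶠ m : ℕ in atTop, ∫ ω, misclassError (yhat m ω) (fun i => y m i ω) ∂(P m) ≤
      C * (Real.exp (-c * R m ^ 2) + (((m + m : ℕ) : ℝ) ^ 10)⁻¹) := by
    filter_upwards [eventually_gt_atTop 0,
      eventually_pow_mul_exp_neg_le_inv_pow (zero_lt_one.trans_le hB) hγ hd 10] with m hm hexp
    exact (hbound hm (hsample m) (hT2 m) (hw m) (hθ m) (hs₁ m) (hs₂ m) (hout m)).trans
      (by gcongr)
  refine ⟨exists_forall_lt_add_self ?_, fun hsmall => exists_forall_lt_add_self ?_,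
    fun ε hε hlarge => ?_⟩
  · filter_upwards [herr] with m hm
    exact hm.trans (by gcongr; linarith)
  · filter_upwards [herr, hsmall, hn.eventually_ge_atTop 1] with m hm hRm hm1
    have := inv_pow_le_exp_neg hc (hθ m).2.1.le hm1 hRm (show 1 ≤ 10 by norm_num)
    calc _ ≤ C * (Real.exp (-c * R m ^ 2) + Real.exp (-c * R m ^ 2)) := hm.trans (by gcongr)
      _ = _ := by ring
  · have hlim := (tendsto_mul_nhds_zero_of_le_exp_neg_add_inv_pow hc hC.le hε (by norm_num) hn
      (fun _ => integral_nonneg fun _ => misclassError_nonneg _ _) herr hlarge).const_sub 1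
    rw [sub_zero] at hlim
    refine tendsto_of_tendsto_of_tendsto_of_le_of_le' hlim tendsto_const_nhds ?_
      (Eventually.of_forall fun m => measureReal_le_one)
    filter_upwards [eventually_gt_atTop 0] with m hm
    obtain ⟨_, hy, -⟩ := hsample m
    exact one_sub_mul_integral_misclassError_le (hyhat m) hy (by omega)

theorem mainTheorem2 (σ : ℝ) (hσ : 0 < σ) (K₀ : ℕ) (p : ℝ) (hp : 0 < p) :
    ∃ c : ℝ, 0 < c ∧ ∃ C : ℝ, 0 < C ∧
      ∀ (d K : ℕ → ℕ) (R : ℕ → ℝ) (θ : ∀ m, MixtureModel (d m) (K m))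
        (Ω : ℕ → Type*) [∀ m, MeasurableSpace (Ω m)]
        (P : ∀ m, Measure (Ω m)) [∀ m, IsProbabilityMeasure (P m)]
        (y : ∀ m, Fin (m + m) → Ω m → Fin (K m))
        (x : ∀ m, Fin (m + m) → Ω m → EucSp (d m))
        (solver₁ solver₂ : ∀ m, (Fin m → EucSp (d m)) → Fin m → Fin (K m))
        (yhat : ∀ m, Ω m → Fin (m + m) → Fin (K m)),
        (∀ m, 2 ≤ K m) →
        (∀ m, IsMixtureSample (θ m) (P m) (y m) (x m)) →
        (∀ m, IsT2 σ (θ m).noise) →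
        (∀ m, K m ≤ K₀) →
        (∀ m j, p ≤ (θ m).weight j) →
        (∀ m, (θ m).SignalStrength (R m)) →
        Tendsto R atTop atTop →
        Tendsto (fun m : ℕ => ((m + m : ℕ) : ℝ) / (d m * Real.log (m + m : ℕ) ^ 2))
          atTop atTop →
        (∀ m, IsWhitenedKMeansSolver (solver₁ m)) →
        (∀ m, IsWhitenedKMeansSolver (solver₂ m)) →
        (∀ m, Measurable (yhat m)) →
        (∀ m, ∀ᵐ ω ∂(P m),
          IsCVKMeansOutput (solver₁ m) (solver₂ m) (fun i => x m i ω) (yhat m ω)) →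
        (∃ N : ℕ, ∀ m : ℕ, N < m + m →
          ∫ ω, misclassError (yhat m ω) (fun i => y m i ω) ∂(P m) ≤
            C * (Real.exp (-c * R m ^ 2) + (((m + m : ℕ) : ℝ) ^ 10)⁻¹)) ∧
        ((∀ᶠ m : ℕ in atTop, R m ≤ √(c⁻¹ * Real.log (m + m : ℕ))) →
          ∃ N : ℕ, ∀ m : ℕ, N < m + m →
            ∫ ω, misclassError (yhat m ω) (fun i => y m i ω) ∂(P m) ≤
              C * Real.exp (-c * R m ^ 2)) ∧
        (∀ ε : ℝ, 0 < ε →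
          (∀ᶠ m : ℕ in atTop, √((1 + ε) * c⁻¹ * Real.log (m + m : ℕ)) ≤ R m) →
          Tendsto (fun m => (P m).real {ω | misclassError (yhat m ω) (fun i => y m i ω) = 0})
            atTop (𝓝 1)) := by
  obtain ⟨c, hc, C, hC, h⟩ := mainTheorem2_general σ hσ p hp
  exact ⟨c, hc, C, hC, fun d K R θ Ω _ P _ y x solver₁ solver₂ yhat _ hsample hT2 _ hw hθ _ hd =>
    h d K R θ Ω P y x solver₁ solver₂ yhat hsample hT2 hw hθ
      (isLittleO_of_tendsto_div_mul_log_sq tendsto_natCast_add_self_atTop hd)⟩
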